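/- Smooth means $C^\infty$, a domain is a nonempty connected open subset of $\mathbb R^N$, and the pseudo-Euclidean space $E^{m}_q$ is $\mathbb R^{m}$ with the scalar product $(x,y)=-\sum_{i\le q}x^iy^i+\sum_{i>q}x^iy^i$. Repeated indices are summed over $1,\dots,N$. An $N$-dimensional submanifold of $E^{2N}_q$ is given by a smooth immersion $r:U\to E^{2N}_q$ of a domain $U$ whose first fundamental form $g_{ij}=(r_{u^i},r_{u^j})$ is nondegenerate. It is flat if the Levi-Civita connection $\nabla$ of $g$ (with Christoffel symbols $\Gamma^k_{ij}$) has zero curvature, and torsionless if it has a smooth frame $\nu_1,\dots,\nu_N$ of its normal spaces with constant Gram matrix and $(\partial_i\nu_\alpha,\nu_\beta)=0$. A flat torsionless submanifold is potential if there are a smooth function $\Phi:U\to\mathbb R$ and a smooth frame $n_1,\dots,n_N$ of its normal spaces, whose index is a covector index for the coordinates $u$, with zero torsion, $(\partial_k n_i,n_j)=\Gamma^l_{ki}(n_l,n_j)$ (in flat coordinates: $(\partial_kn_i,n_j)=0$, so the Gram matrix is constant), and with second fundamental forms $(n_i,r_{u^ju^k})=\nabla_i\nabla_j\nabla_k\Phi$.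 The associativity (WDVV) equations for a smooth function $\Phi$ and a constant nondegenerate symmetric matrix $\eta=(\eta_{ij})$ with inverse $(\eta^{ij})$ are $$\frac{\partial^3\Phi}{\partial u^i\partial u^j\partial u^k}\,\eta^{kl}\,\frac{\partial^3\Phi}{\partial u^l\partial u^m\partial u^n}=\frac{\partial^3\Phi}{\partial u^i\partial u^m\partial u^k}\,\eta^{kl}\,\frac{\partial^3\Phi}{\partial u^l\partial u^j\partial u^n}\qquad(1\le i,j,m,n\le N).$$ **Theorem.** The associativity equations describe the potential flat torsionless $N$-dimensional submanifolds of $2N$-dimensional pseudo-Euclidean spaces, in the following sense. 1. Every potential flat torsionless submanifold of $E^{2N}_q$, with potential $\Phi$ and frame $(n_i)$, has flat coordinates near each of its points. In any flat coordinates $y$ on a connected open part (where the first fundamental form is a constant matrix $\eta$), $\eta$ is symmetric and nondegenerate, $\Phi$ satisfies the associativity equations with $\eta$, the frame $\frac{\partial u^i}{\partial y^a}n_i$ has a constant nondegenerate symmetric Gram matrix $\mu$ and zero torsion, and the second fundamental forms with respect to it are $\frac{\partial^3\Phi}{\partial y^a\partial y^b\partial y^c}dy^bdy^c$. 2. Let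 $\eta$ be a nondegenerate symmetric $N\times N$ matrix, $c\ne0$ a real number, $U\subset\mathbb R^N$ a simply connected open set and $\Phi:U\to\mathbb R$ a smooth function. Then $\Phi$ satisfies the associativity equations with $\eta$ on $U$ if and only if there is a potential flat torsionless submanifold $r:U\to E^{2N}_q$ with potential $\Phi$, where $q$ is the number of negative eigenvalues of $\eta$ plus that of $c^{-1}\eta$, whose first fundamental form is $\eta_{ij}du^idu^j$ and whose second fundamental forms, with respect to a torsion-free normal frame $n_1,\dots,n_N$ with Gram matrix $c^{-1}\eta$, are $\frac{\partial^3\Phi}{\partial u^n\partial u^i\partial u^j}du^idu^j$, $1\le n\le N$. 3. Such a submanifold is unique up to motions: two potential flat torsionless submanifolds $U\to E^{2N}_q$ with the same constant first fundamental form $\eta$, the same constant Gram matrix $\mu$ of their torsion-free normal frames, and the same second fundamental forms given by the third derivatives of $\Phi$, are carried into each other, with their frames, by a motion $x\mapsto Ax+b$ of $E^{2N}_q$. 4. For such a submanifold $r:U\to E^{2N}_q$ with its frame, in flat coordinates, a function $\Phi'$ is also a potential if and only if $\Phi'-\Phi$ is a polynomial of degree at most two on $U$. -/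

import Mathlib

open scoped ContDiff

noncomputable section

/-- The partial derivative `∂f/∂u^i` of a function of `N` real variables. -/
def partialD {N : ℕ} {F : Type*} [NormedAddCommGroup F] [NormedSpace ℝ F]
    (i : Fin N) (f : (Fin N → ℝ) → F) (u : Fin N → ℝ) : F :=
  fderiv ℝ f u (Pi.single i 1)

/-- The scalar product of the pseudo-Euclidean space of dimension `m` and index `q`:
`q` minus signs followed by `m - q` plus signs. -/
def psInner {m : ℕ} (q : ℕ) (x y : Fin m → ℝ) : ℝ :=
  ∑ i : Fin m, (if (i : ℕ) < q then (-1 : ℝ) else 1) * (x i * y i)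

/-- The linear part of a motion: a linear bijection preserving the scalar product. -/
def IsPsIsometry {m : ℕ} (q : ℕ) (A : (Fin m → ℝ) ≃ₗ[ℝ] (Fin m → ℝ)) : Prop :=
  ∀ x y, psInner q (A x) (A y) = psInner q x y

/-- The negative index of inertia of a real symmetric matrix: the number of its negative
eigenvalues, with multiplicity. -/
def negIndex {N : ℕ} (A : Matrix (Fin N) (Fin N) ℝ) : ℕ :=
  A.charpoly.roots.countP (fun x => x < 0)

section Metric

variable {N : ℕ}

/-- Christoffel symbols `Γ^k_{ij}` of the Levi-Civita connection of a metric `g`. -/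
def christoffel (g : (Fin N → ℝ) → Matrix (Fin N) (Fin N) ℝ) (k i j : Fin N)
    (u : Fin N → ℝ) : ℝ :=
  (1 / 2 : ℝ) * ∑ l, (g u)⁻¹ k l *
    (partialD i (fun v => g v l j) u + partialD j (fun v => g v i l) u
      - partialD l (fun v => g v i j) u)

/-- The curvature tensor `R^l_{kij}` of the Levi-Civita connection of a metric `g`. -/
def curvature (g : (Fin N → ℝ) → Matrix (Fin N) (Fin N) ℝ) (l k i j : Fin N)
    (u : Fin N → ℝ) : ℝ :=
  partialD i (christoffel g l j k) u - partialD j (christoffel g l i k) u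
    + ∑ s, (christoffel g l i s u * christoffel g s j k u
      - christoffel g l j s u * christoffel g s i k u)

/-- The second covariant derivative `∇_j ∇_k Φ` of a function. -/
def covHess (g : (Fin N → ℝ) → Matrix (Fin N) (Fin N) ℝ) (Φ : (Fin N → ℝ) → ℝ)
    (j k : Fin N) (u : Fin N → ℝ) : ℝ :=
  partialD j (partialD k Φ) u - ∑ l, christoffel g l j k u * partialD l Φ u

/-- The third covariant derivative `∇_i ∇_j ∇_k Φ` of a function. -/
def covThird (g : (Fin N → ℝ) → Matrix (Fin N) (Fin N) ℝ) (Φ : (Fin N → ℝ) → ℝ)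
    (i j k : Fin N) (u : Fin N → ℝ) : ℝ :=
  partialD i (covHess g Φ j k) u - ∑ l, christoffel g l i j u * covHess g Φ l k u
    - ∑ l, christoffel g l i k u * covHess g Φ j l u

/-- The third partial derivative `∂³Φ/∂u^i ∂u^j ∂u^k`. -/
def third (Φ : (Fin N → ℝ) → ℝ) (i j k : Fin N) (u : Fin N → ℝ) : ℝ :=
  partialD i (partialD j (partialD k Φ)) u

/-- The associativity (WDVV) equations on `U` for the potential `Φ` and the constant metric
`η_{ij}`; the coefficients `η^{ij}` are the entries of the inverse matrix. -/
def Associativity (η : Matrix (Fin N) (Fin N) ℝ) (U : Set (Fin N → ℝ))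
    (Φ : (Fin N → ℝ) → ℝ) : Prop :=
  ∀ u ∈ U, ∀ i j m n : Fin N,
    ∑ k, ∑ l, third Φ i j k u * η⁻¹ k l * third Φ l m n u
      = ∑ k, ∑ l, third Φ i m k u * η⁻¹ k l * third Φ l j n u

end Metric

section Submanifold

variable {N L : ℕ}

/-- The first fundamental form `g_{ij} = (r_{u^i}, r_{u^j})`. -/
def firstForm {m : ℕ} (q : ℕ) (r : (Fin N → ℝ) → Fin m → ℝ) (u : Fin N → ℝ) :
    Matrix (Fin N) (Fin N) ℝ :=
  Matrix.of fun i j => psInner q (partialD i r u) (partialD j r u)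

/-- The coefficients `(ν, r_{u^i u^j})` of the second fundamental form of `r` with respect to a
normal field `ν`. -/
def secondForm {m : ℕ} (q : ℕ) (r ν : (Fin N → ℝ) → Fin m → ℝ) (i j : Fin N)
    (u : Fin N → ℝ) : ℝ :=
  psInner q (ν u) (partialD i (partialD j r) u)

/-- The Gram matrix of a family of vector fields. -/
def gram {m : ℕ} (q : ℕ) (n : Fin L → (Fin N → ℝ) → Fin m → ℝ) (u : Fin N → ℝ) :
    Matrix (Fin L) (Fin L) ℝ :=
  Matrix.of fun α β => psInner q (n α u) (n β u)

/-- The coefficients `(∂_i n_α, n_β)`. For a normal frame with constant Gram matrix these are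
the coefficients of torsion. -/
def torsion {m : ℕ} (q : ℕ) (n : Fin L → (Fin N → ℝ) → Fin m → ℝ) (α β : Fin L) (i : Fin N)
    (u : Fin N → ℝ) : ℝ :=
  psInner q (partialD i (n α) u) (n β u)

/-- A smooth totally nonisotropic `N`-dimensional submanifold of the pseudo-Euclidean space of
dimension `N + L` and index `q`, parametrized by a domain `U`. -/
structure IsSubmanifold (q : ℕ) (U : Set (Fin N → ℝ))
    (r : (Fin N → ℝ) → Fin (N + L) → ℝ) : Prop where
  isOpen : IsOpen U
  isConnected : IsConnected U
  smooth : ContDiffOn ℝ ∞ r U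
  immersion : ∀ u ∈ U, LinearIndependent ℝ (fun i : Fin N => partialD i r u)
  nonisotropic : ∀ u ∈ U, (firstForm q r u).det ≠ 0

/-- A smooth frame of the normal spaces (which have dimension `L`). -/
structure IsNormalFrame (q : ℕ) (U : Set (Fin N → ℝ)) (r : (Fin N → ℝ) → Fin (N + L) → ℝ)
    (n : Fin L → (Fin N → ℝ) → Fin (N + L) → ℝ) : Prop where
  smooth : ∀ α, ContDiffOn ℝ ∞ (n α) U
  normal : ∀ u ∈ U, ∀ α i, psInner q (n α u) (partialD i r u) = 0
  linearIndependent : ∀ u ∈ U, LinearIndependent ℝ (fun α => n α u)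

/-- The first fundamental form is a flat metric. -/
def IsFlat (q : ℕ) (U : Set (Fin N → ℝ)) (r : (Fin N → ℝ) → Fin (N + L) → ℝ) : Prop :=
  ∀ u ∈ U, ∀ l k i j, curvature (firstForm q r) l k i j u = 0

/-- Zero torsion: there is a normal frame with constant Gram matrix whose torsion forms
vanish. -/
def IsTorsionless (q : ℕ) (U : Set (Fin N → ℝ)) (r : (Fin N → ℝ) → Fin (N + L) → ℝ) : Prop :=
  ∃ (n : Fin L → (Fin N → ℝ) → Fin (N + L) → ℝ) (μ : Matrix (Fin L) (Fin L) ℝ),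
    IsNormalFrame q U r n ∧ (∀ u ∈ U, gram q n u = μ) ∧
      ∀ u ∈ U, ∀ α β i, torsion q n α β i u = 0

/-- `r` is a flat torsionless submanifold of a `2N`-dimensional pseudo-Euclidean space which is
potential, with potential `Φ`, its second fundamental forms being taken with respect to the
normal frame `n_1, …, n_N`.

The index `i` of `n_i` is a covector index for the coordinates `u` (it is the index of `∇_i` in
`∇_i ∇_j ∇_k Φ`), so the requirement that the frame have zero torsion is
`(∂_k n_i, n_j) = Γ^l_{ki} (n_l, n_j)`; in flat coordinates, where `Γ = 0`, this says that
the torsion forms vanish and that the Gram matrix is constant. -/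
structure IsPotentialFlatTorsionless (q : ℕ) (U : Set (Fin N → ℝ))
    (r : (Fin N → ℝ) → Fin (N + N) → ℝ) (Φ : (Fin N → ℝ) → ℝ)
    (n : Fin N → (Fin N → ℝ) → Fin (N + N) → ℝ) : Prop where
  submanifold : IsSubmanifold q U r
  flat : IsFlat q U r
  torsionless : IsTorsionless q U r
  smooth_potential : ContDiffOn ℝ ∞ Φ U
  normalFrame : IsNormalFrame q U r n
  parallel : ∀ u ∈ U, ∀ i j k, torsion q n i j k u
    = ∑ l, christoffel (firstForm q r) l k i u * gram q n u l j
  second_eq : ∀ u ∈ U, ∀ i j k,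
    secondForm q r (n i) j k u = covThird (firstForm q r) Φ i j k u

/-- A potential flat torsionless submanifold written in flat coordinates: the first fundamental
form is the constant matrix `η`, the normal frame has the constant Gram matrix `μ` and zero
torsion, and the second fundamental forms are given by the third partial derivatives
of `Φ`. -/
structure IsFlatRealization (q : ℕ) (U : Set (Fin N → ℝ)) (η μ : Matrix (Fin N) (Fin N) ℝ)
    (Φ : (Fin N → ℝ) → ℝ) (r : (Fin N → ℝ) → Fin (N + N) → ℝ)
    (n : Fin N → (Fin N → ℝ) → Fin (N + N) → ℝ) : Prop
    extends IsPotentialFlatTorsionless q U r Φ n where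
  first_eq : ∀ u ∈ U, firstForm q r u = η
  gram_eq : ∀ u ∈ U, gram q n u = μ
  torsion_eq : ∀ u ∈ U, ∀ i j k, torsion q n i j k u = 0
  second_eq_third : ∀ u ∈ U, ∀ i j k, secondForm q r (n i) j k u = third Φ i j k u

/-- `φ : W → U` introduces flat coordinates (the coordinates of `W`) on an open part of the
submanifold `r : U → E`: it is a diffeomorphism of the domain `W` onto an open subset of `U`, and
the first fundamental form in the new coordinates is the constant matrix `η`. -/
structure IsFlatChart {m : ℕ} (q : ℕ) (U : Set (Fin N → ℝ)) (r : (Fin N → ℝ) → Fin m → ℝ)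
    (W : Set (Fin N → ℝ)) (φ : (Fin N → ℝ) → Fin N → ℝ)
    (η : Matrix (Fin N) (Fin N) ℝ) : Prop where
  isOpen : IsOpen W
  isConnected : IsConnected W
  smooth : ContDiffOn ℝ ∞ φ W
  mapsTo : Set.MapsTo φ W U
  injOn : Set.InjOn φ W
  regular : ∀ y ∈ W, LinearIndependent ℝ (fun a : Fin N => partialD a φ y)
  first_eq : ∀ y ∈ W, firstForm q (fun z => r (φ z)) y = η

/-- The frame `n_i` in new coordinates `y`, where `u = φ(y)`; its index is a covector index:
`n_a = ∑ i, (∂u^i/∂y^a) n_i`. -/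
def pullFrame {m : ℕ} (φ : (Fin N → ℝ) → Fin N → ℝ) (n : Fin N → (Fin N → ℝ) → Fin m → ℝ)
    (a : Fin N) (y : Fin N → ℝ) : Fin m → ℝ :=
  ∑ i, (partialD a φ y i) • n i (φ y)

end Submanifold

end

/-!
In flat coordinates a potential flat torsionless submanifold with first fundamental form `η`,
normal Gram matrix `μ` and potential `Φ` is governed by the Gauss–Weingarten system
`∂_i r_j = Φ_{aij} μ^{ab} n_b`, `∂_i n_a = -Φ_{aik} η^{kl} r_l`, together with `∂_i r = r_i`.
This is a linear total differential system for the tuple `(r, r_j, n_a)` (`gwFrame`, `gwCoeff`,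
`IsFlatRealization.partialD_gwFrame`), and the four assertions are statements about it.

*The associativity equations.* The derivatives of the normal frame are tangent, so that
differentiating `(∂_i n_a, n_b) = 0` shows that `(∂_i n_a, ∂_j n_b)`, which is
`Φ_{aik} η^{kl} Φ_{lbj}`, is symmetric in `i` and `j`: the Ricci equations are the associativity
equations (`IsFlatRealization.associativity`).

*Existence.* If `μ = c⁻¹ η`, the Gauss and the Ricci equations are proportional, the Codazzi
equations say that fourth derivatives commute, and the integrability conditions of the system
reduce to associativity (`gwCoeff_compat`). The Frobenius theorem for linear systems
(`exists_linear_system_solution`) then gives a solution on a simply connected open set. Locally a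
flat connection is trivialized by solving ordinary differential equations along rays, Grönwall's
inequality providing the differentiability in the endpoint
(`exists_local_fundamental_solution`). Globally the flat sections form a covering space, which has
sections over a simply connected base (`exists_flat_section`, `exists_global_flat_solution`).
The initial frame has the Gram matrix `η ⊕ μ`, and exists by Sylvester's law in the space of index
`negIndex η + negIndex μ` (`exists_vectors_gram_fromBlocks`). The Gram matrix of the solution and
the constant `η ⊕ μ` solve the same linear system, hence agree (`gram_gwSystem`), and the solution
is the required submanifold with its frame.

*Uniqueness.* Two realizations solve the same system. The linear map matching their frames at one
point is an isometry, and uniqueness for the system (`linear_system_unique`) extends the matching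
to the whole domain (`IsFlatRealization.exists_motion`). The potential enters only through its third
derivatives, whence the last assertion (`IsFlatRealization.potential_iff`).

*Flat coordinates.* On a potential submanifold in arbitrary coordinates let `ν_β` be a torsion-free
normal frame. The functions `C_{iβ} = (n_i, ν_β)` form, for each `β`, a covariantly constant
covector field. The forms `C_{iβ} du^i` are closed and independent, so they are differentials of
local coordinates `y^β`, in which the Christoffel symbols vanish
(`IsPotentialFlatTorsionless.exists_isFlatChart`). In flat coordinates third covariant derivatives
become third partial derivatives (`third_comp_eq_covThird`), and the frame transforms like a
covector (`IsPotentialFlatTorsionless.exists_isFlatRealization`).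
-/

noncomputable section

open scoped Topology

/-! ### Partial derivatives and the scalar product -/

section calculus

variable {N : ℕ} {F : Type*} [NormedAddCommGroup F] [NormedSpace ℝ F]

theorem partialD_congr {U : Set (Fin N → ℝ)} (hU : IsOpen U) {f g : (Fin N → ℝ) → F}
    (h : Set.EqOn f g U) {u : Fin N → ℝ} (hu : u ∈ U) (i : Fin N) :
    partialD i f u = partialD i g u := by
  unfold partialD
  rw [(h.eventuallyEq_of_mem (hU.mem_nhds hu)).fderiv_eq]

theorem partialD_const (c : F) (i : Fin N) (u : Fin N → ℝ) :
    partialD i (fun _ => c) u = 0 := by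
  simp [partialD]

theorem partialD_add {f g : (Fin N → ℝ) → F} {u : Fin N → ℝ} (hf : DifferentiableAt ℝ f u)
    (hg : DifferentiableAt ℝ g u) (i : Fin N) :
    partialD i (fun v => f v + g v) u = partialD i f u + partialD i g u := by
  simp [partialD, fderiv_fun_add hf hg]

theorem partialD_sub {f g : (Fin N → ℝ) → F} {u : Fin N → ℝ} (hf : DifferentiableAt ℝ f u)
    (hg : DifferentiableAt ℝ g u) (i : Fin N) :
    partialD i (fun v => f v - g v) u = partialD i f u - partialD i g u := by
  simp [partialD, fderiv_fun_sub hf hg]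

theorem partialD_smul {f : (Fin N → ℝ) → ℝ} {g : (Fin N → ℝ) → F} {u : Fin N → ℝ}
    (hf : DifferentiableAt ℝ f u) (hg : DifferentiableAt ℝ g u) (i : Fin N) :
    partialD i (fun v => f v • g v) u = f u • partialD i g u + partialD i f u • g u := by
  simp [partialD, fderiv_fun_smul hf hg]

theorem partialD_mul {f g : (Fin N → ℝ) → ℝ} {u : Fin N → ℝ}
    (hf : DifferentiableAt ℝ f u) (hg : DifferentiableAt ℝ g u) (i : Fin N) :
    partialD i (fun v => f v * g v) u = f u * partialD i g u + partialD i f u * g u :=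
  partialD_smul hf hg i

theorem partialD_const_smul {f : (Fin N → ℝ) → F} {u : Fin N → ℝ} (hf : DifferentiableAt ℝ f u)
    (c : ℝ) (i : Fin N) : partialD i (fun v => c • f v) u = c • partialD i f u := by
  simp [partialD, fderiv_fun_const_smul hf]

theorem partialD_const_mul {f : (Fin N → ℝ) → ℝ} {u : Fin N → ℝ} (hf : DifferentiableAt ℝ f u)
    (c : ℝ) (i : Fin N) : partialD i (fun v => c * f v) u = c * partialD i f u :=
  partialD_const_smul hf c i

theorem partialD_smul_const {f : (Fin N → ℝ) → ℝ} {u : Fin N → ℝ} (hf : DifferentiableAt ℝ f u)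
    (c : F) (i : Fin N) : partialD i (fun v => f v • c) u = partialD i f u • c := by
  rw [partialD_smul hf (differentiableAt_const c), partialD_const, smul_zero, zero_add]

theorem partialD_sum {ι : Type*} {s : Finset ι} {f : ι → (Fin N → ℝ) → F} {u : Fin N → ℝ}
    (hf : ∀ a ∈ s, DifferentiableAt ℝ (f a) u) (i : Fin N) :
    partialD i (fun v => ∑ a ∈ s, f a v) u = ∑ a ∈ s, partialD i (f a) u := by
  simp [partialD, fderiv_fun_sum hf]

theorem partialD_apply {ι : Type*} [Fintype ι] {G : ι → Type*} [∀ a, NormedAddCommGroup (G a)]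
    [∀ a, NormedSpace ℝ (G a)] {f : (Fin N → ℝ) → ∀ a, G a} {u : Fin N → ℝ}
    (hf : DifferentiableAt ℝ f u) (i : Fin N) (a : ι) :
    partialD i f u a = partialD i (fun v => f v a) u := by
  simp [partialD, fderiv_apply hf]

theorem partialD_clm_comp {G : Type*} [NormedAddCommGroup G] [NormedSpace ℝ G] (T : F →L[ℝ] G)
    {f : (Fin N → ℝ) → F} {u : Fin N → ℝ} (hf : DifferentiableAt ℝ f u) (i : Fin N) :
    partialD i (fun v => T (f v)) u = T (partialD i f u) := by
  have : HasFDerivAt (fun v => T (f v)) (T ∘L fderiv ℝ f u) u :=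
    T.hasFDerivAt.comp u hf.hasFDerivAt
  simp [partialD, this.fderiv]

theorem partialD_clm_apply {G : Type*} [NormedAddCommGroup G] [NormedSpace ℝ G]
    {f : (Fin N → ℝ) → G →L[ℝ] F} {u : Fin N → ℝ} (hf : DifferentiableAt ℝ f u) (w : G)
    (i : Fin N) : partialD i (fun v => f v w) u = partialD i f u w :=
  partialD_clm_comp (ContinuousLinearMap.apply ℝ F w) hf i

theorem partialD_coord (i j : Fin N) (u : Fin N → ℝ) :
    partialD i (fun v : Fin N → ℝ => v j) u = if i = j then 1 else 0 := by
  have : HasFDerivAt (fun v : Fin N → ℝ => v j) (ContinuousLinearMap.proj j) u :=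
    (ContinuousLinearMap.proj (R := ℝ) (φ := fun _ : Fin N => ℝ) j).hasFDerivAt
  simp [partialD, this.fderiv, Pi.single_apply, eq_comm]

theorem fderiv_eq_sum_partialD (f : (Fin N → ℝ) → F) (u h : Fin N → ℝ) :
    fderiv ℝ f u h = ∑ i, h i • partialD i f u := by
  conv_lhs => rw [pi_eq_sum_univ' h]
  simp only [map_sum, map_smul, partialD]

theorem partialD_eq_of_hasFDerivAt {f : (Fin N → ℝ) → F} {u : Fin N → ℝ}
    {T : (Fin N → ℝ) →L[ℝ] F} (hf : HasFDerivAt f T u) (i : Fin N) :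
    partialD i f u = T (Pi.single i 1) := by
  rw [partialD, hf.fderiv]

/-- The chain rule in coordinates. -/
theorem partialD_comp {M : ℕ} {φ : (Fin M → ℝ) → Fin N → ℝ} {f : (Fin N → ℝ) → F}
    {y : Fin M → ℝ} (hf : DifferentiableAt ℝ f (φ y)) (hφ : DifferentiableAt ℝ φ y) (a : Fin M) :
    partialD a (fun z => f (φ z)) y = ∑ i, partialD a φ y i • partialD i f (φ y) := by
  have : HasFDerivAt (fun z => f (φ z)) (fderiv ℝ f (φ y) ∘L fderiv ℝ φ y) y :=
    hf.hasFDerivAt.comp y hφ.hasFDerivAt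
  rw [partialD_eq_of_hasFDerivAt this, ContinuousLinearMap.comp_apply, fderiv_eq_sum_partialD]
  rfl

section smooth

variable {U : Set (Fin N → ℝ)}

theorem ContDiffOn.diffAt {f : (Fin N → ℝ) → F} (hf : ContDiffOn ℝ ∞ f U) (hU : IsOpen U)
    {u : Fin N → ℝ} (hu : u ∈ U) : DifferentiableAt ℝ f u :=
  (hf.contDiffAt (hU.mem_nhds hu)).differentiableAt (by simp)

theorem ContDiffOn.partialD {f : (Fin N → ℝ) → F} (hf : ContDiffOn ℝ ∞ f U) (hU : IsOpen U)
    (i : Fin N) : ContDiffOn ℝ ∞ (partialD i f) U :=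
  (hf.fderiv_of_isOpen hU (m := ∞) (by simp)).clm_apply contDiffOn_const

theorem partialD_comm {f : (Fin N → ℝ) → F} (hf : ContDiffOn ℝ ∞ f U) (hU : IsOpen U)
    {u : Fin N → ℝ} (hu : u ∈ U) (i j : Fin N) :
    partialD i (partialD j f) u = partialD j (partialD i f) u := by
  have hs : IsSymmSndFDerivAt ℝ f u :=
    (hf.contDiffAt (hU.mem_nhds hu)).isSymmSndFDerivAt (by
      rw [minSmoothness_of_isRCLikeNormedField]; exact WithTop.coe_le_coe.2 (le_top : (2 : ℕ∞) ≤ ⊤))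
  have hd : DifferentiableAt ℝ (fderiv ℝ f) u :=
    (hf.fderiv_of_isOpen hU (m := ∞) (by simp)).diffAt hU hu
  have key : ∀ a b : Fin N, partialD a (partialD b f) u
      = fderiv ℝ (fderiv ℝ f) u (Pi.single a 1) (Pi.single b 1) := by
    intro a b
    have := hd.hasFDerivAt.clm_apply (hasFDerivAt_const (Pi.single b (1 : ℝ)) u)
    have h2 : HasFDerivAt (partialD b f) _ u := this
    rw [partialD_eq_of_hasFDerivAt h2]
    simp
  rw [key, key, hs.eq]

/-- A function with vanishing partial derivatives on a domain is constant there. -/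
theorem eq_of_partialD_eq_zero {f : (Fin N → ℝ) → F} (hf : ContDiffOn ℝ ∞ f U) (hU : IsOpen U)
    (hc : IsPreconnected U) (h : ∀ u ∈ U, ∀ i, partialD i f u = 0) {u v : Fin N → ℝ}
    (hu : u ∈ U) (hv : v ∈ U) : f u = f v := by
  refine hU.is_const_of_fderiv_eq_zero hc (fun x hx => (hf.diffAt hU hx).differentiableWithinAt)
    (fun x hx => ?_) hu hv
  ext w
  simp [fderiv_eq_sum_partialD, h x hx]

theorem third_congr {Φ Ψ : (Fin N → ℝ) → ℝ} (hU : IsOpen U) (h : Set.EqOn Φ Ψ U)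
    {u : Fin N → ℝ} (hu : u ∈ U) (i j k : Fin N) : third Φ i j k u = third Ψ i j k u :=
  partialD_congr hU (fun _ hv => partialD_congr hU (fun _ hw => partialD_congr hU h hw k) hv j) hu i

variable {Φ : (Fin N → ℝ) → ℝ}

theorem third_swap_left (hΦ : ContDiffOn ℝ ∞ Φ U) (hU : IsOpen U) {u : Fin N → ℝ} (hu : u ∈ U)
    (i j k : Fin N) : third Φ i j k u = third Φ j i k u :=
  partialD_comm (hΦ.partialD hU k) hU hu i j

theorem third_swap_right (hΦ : ContDiffOn ℝ ∞ Φ U) (hU : IsOpen U) {u : Fin N → ℝ} (hu : u ∈ U)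
    (i j k : Fin N) : third Φ i j k u = third Φ i k j u :=
  partialD_congr hU (fun _ hv => partialD_comm hΦ hU hv j k) hu i

theorem contDiffOn_third (hΦ : ContDiffOn ℝ ∞ Φ U) (hU : IsOpen U) (i j k : Fin N) :
    ContDiffOn ℝ ∞ (third Φ i j k) U :=
  ((hΦ.partialD hU k).partialD hU j).partialD hU i

/-- The derivative of the third derivatives is symmetric in the first two indices. -/
theorem partialD_third_comm (hΦ : ContDiffOn ℝ ∞ Φ U) (hU : IsOpen U) {u : Fin N → ℝ}
    (hu : u ∈ U) (i j k l : Fin N) :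
    partialD i (third Φ j k l) u = partialD j (third Φ i k l) u :=
  partialD_comm ((hΦ.partialD hU l).partialD hU k) hU hu i j

end smooth

section psInner

variable {m : ℕ} (q : ℕ)

theorem psInner_comm (x y : Fin m → ℝ) : psInner q x y = psInner q y x := by
  simp [psInner, mul_comm]

/-- The scalar product as a bilinear form. -/
def psForm : (Fin m → ℝ) →ₗ[ℝ] (Fin m → ℝ) →ₗ[ℝ] ℝ :=
  LinearMap.mk₂ ℝ (psInner q)
    (fun x y z => by simp [psInner, ← Finset.sum_add_distrib, add_mul, mul_add])
    (fun c x y => by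
      simp only [psInner, Finset.mul_sum, Pi.smul_apply, smul_eq_mul]
      exact Finset.sum_congr rfl fun i _ => by ring)
    (fun x y z => by simp [psInner, ← Finset.sum_add_distrib, mul_add])
    (fun c x y => by
      simp only [psInner, Finset.mul_sum, Pi.smul_apply, smul_eq_mul]
      exact Finset.sum_congr rfl fun i _ => by ring)

theorem psInner_eq_psForm (x y : Fin m → ℝ) : psInner q x y = psForm q x y := rfl

theorem psInner_add_left (x y z : Fin m → ℝ) :
    psInner q (x + y) z = psInner q x z + psInner q y z := by
  simp [psInner_eq_psForm]

theorem psInner_add_right (x y z : Fin m → ℝ) :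
    psInner q x (y + z) = psInner q x y + psInner q x z := by
  simp [psInner_eq_psForm]

theorem psInner_sub_left (x y z : Fin m → ℝ) :
    psInner q (x - y) z = psInner q x z - psInner q y z := by
  simp [psInner_eq_psForm]

theorem psInner_smul_left (c : ℝ) (x y : Fin m → ℝ) :
    psInner q (c • x) y = c * psInner q x y := by
  simp [psInner_eq_psForm]

theorem psInner_smul_right (c : ℝ) (x y : Fin m → ℝ) :
    psInner q x (c • y) = c * psInner q x y := by
  simp [psInner_eq_psForm]

theorem psInner_zero_left (y : Fin m → ℝ) : psInner q 0 y = 0 := by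
  simp [psInner_eq_psForm]

theorem psInner_sum_left {ι : Type*} (s : Finset ι) (x : ι → Fin m → ℝ) (y : Fin m → ℝ) :
    psInner q (∑ a ∈ s, x a) y = ∑ a ∈ s, psInner q (x a) y := by
  simp [psInner_eq_psForm]

theorem psInner_sum_right {ι : Type*} (s : Finset ι) (x : Fin m → ℝ) (y : ι → Fin m → ℝ) :
    psInner q x (∑ a ∈ s, y a) = ∑ a ∈ s, psInner q x (y a) := by
  simp [psInner_eq_psForm]

/-- The scalar product is nondegenerate. -/
theorem eq_zero_of_psInner_eq_zero {x : Fin m → ℝ} (h : ∀ y, psInner q x y = 0) : x = 0 := by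
  funext i
  have := h (Pi.single i 1)
  simp only [psInner, Pi.single_apply, mul_ite, mul_one, mul_zero, Finset.sum_ite_eq',
    Finset.mem_univ, if_true] at this
  split_ifs at this <;> simpa using this

theorem differentiableAt_psInner {f g : (Fin N → ℝ) → Fin m → ℝ} {u : Fin N → ℝ}
    (hf : DifferentiableAt ℝ f u) (hg : DifferentiableAt ℝ g u) :
    DifferentiableAt ℝ (fun v => psInner q (f v) (g v)) u := by
  have h1 := differentiableAt_pi.1 hf
  have h2 := differentiableAt_pi.1 hg
  unfold psInner
  fun_prop

theorem contDiffOn_psInner {f g : (Fin N → ℝ) → Fin m → ℝ} {U : Set (Fin N → ℝ)}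
    (hf : ContDiffOn ℝ ∞ f U) (hg : ContDiffOn ℝ ∞ g U) :
    ContDiffOn ℝ ∞ (fun v => psInner q (f v) (g v)) U := by
  have h1 := contDiffOn_pi.1 hf
  have h2 := contDiffOn_pi.1 hg
  unfold psInner
  fun_prop

/-- The product rule for the scalar product. -/
theorem partialD_psInner {f g : (Fin N → ℝ) → Fin m → ℝ} {u : Fin N → ℝ}
    (hf : DifferentiableAt ℝ f u) (hg : DifferentiableAt ℝ g u) (i : Fin N) :
    partialD i (fun v => psInner q (f v) (g v)) u
      = psInner q (partialD i f u) (g u) + psInner q (f u) (partialD i g u) := by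
  have h1 := differentiableAt_pi.1 hf
  have h2 := differentiableAt_pi.1 hg
  unfold psInner
  rw [partialD_sum (fun a _ => by fun_prop), ← Finset.sum_add_distrib]
  refine Finset.sum_congr rfl fun a _ => ?_
  rw [partialD_const_mul (by fun_prop), partialD_mul (h1 a) (h2 a), partialD_apply hf,
    partialD_apply hg]
  ring

end psInner

end calculus

/-! ### Uniqueness for total differential systems and linear equations on a segment -/

/-- **Uniqueness** for total differential systems: if the derivative of `f` on a domain is bounded
by a continuous multiple of `f` and `f` vanishes at one point, then `f` vanishes identically. -/
theorem eq_zero_of_norm_fderiv_le {E W : Type*} [NormedAddCommGroup E] [NormedSpace ℝ E]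
    [NormedAddCommGroup W] [NormedSpace ℝ W] {U : Set E} (hU : IsOpen U) (hc : IsPreconnected U)
    {f : E → W} {K : E → ℝ} (hf : DifferentiableOn ℝ f U) (hK : ContinuousOn K U)
    (hb : ∀ x ∈ U, ‖fderiv ℝ f x‖ ≤ K x * ‖f x‖) {p : E} (hp : p ∈ U) (h0 : f p = 0) :
    ∀ x ∈ U, f x = 0 := by
  -- the zero set is closed in `U` by continuity and open by Grönwall along segments
  have hopen : ∀ x ∈ U, f x = 0 → ∀ᶠ y in 𝓝 x, f y = 0 := by
    intro x hx hfx
    have hKx : ∀ᶠ y in 𝓝 x, y ∈ U ∧ K y < K x + 1 :=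
      (hU.eventually_mem hx).and
        ((hK.continuousAt (hU.mem_nhds hx)).eventually_lt continuousAt_const (by simp))
    obtain ⟨r, hr, hball⟩ := Metric.eventually_nhds_iff_ball.1 hKx
    filter_upwards [Metric.ball_mem_nhds x hr] with y hy
    have hseg : ∀ t ∈ Set.Icc (0 : ℝ) 1, x + t • (y - x) ∈ Metric.ball x r := by
      intro t ht
      have : x + t • (y - x) = (1 - t) • x + t • y := by module
      rw [this]
      exact convex_ball x r (Metric.mem_ball_self hr) hy (by linarith [ht.2]) ht.1 (by ring)
    have hder : ∀ t ∈ Set.Icc (0 : ℝ) 1, HasDerivAt (fun s : ℝ => f (x + s • (y - x)))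
        (fderiv ℝ f (x + t • (y - x)) (y - x)) t := by
      intro t ht
      have h1 : HasDerivAt (fun s : ℝ => x + s • (y - x)) (y - x) t := by
        simpa using ((hasDerivAt_id t).smul_const (y - x)).const_add x
      have h2 := (hf.differentiableAt (hU.mem_nhds (hball _ (hseg t ht)).1)).hasFDerivAt
      exact h2.comp_hasDerivAt t h1
    have := eq_zero_of_abs_deriv_le_mul_abs_self_of_eq_zero_right
      (f := fun s : ℝ => f (x + s • (y - x))) (a := 0) (b := 1) (K := (K x + 1) * ‖y - x‖)
      (fun t ht => (hder t ht).continuousAt.continuousWithinAt)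
      (fun t ht => (hder t ⟨ht.1, ht.2.le⟩).hasDerivWithinAt) (by simpa using hfx)
      (fun t ht => by
        have hz := hball _ (hseg t ⟨ht.1, ht.2.le⟩)
        calc _ ≤ ‖fderiv ℝ f (x + t • (y - x))‖ * ‖y - x‖ := ContinuousLinearMap.le_opNorm _ _
          _ ≤ (K (x + t • (y - x)) * ‖f (x + t • (y - x))‖) * ‖y - x‖ := by
            gcongr; exact hb _ hz.1
          _ ≤ ((K x + 1) * ‖f (x + t • (y - x))‖) * ‖y - x‖ := by gcongr; exact hz.2.le
          _ = _ := by ring) 1 (by simp)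
    simpa using this
  have hsub : U ⊆ {x | ∀ᶠ y in 𝓝 x, f y = 0} := by
    refine hc.subset_of_closure_inter_subset isOpen_setOfPred_eventually_nhds
      ⟨p, hp, hopen p hp h0⟩ ?_
    rintro x ⟨hx, hxU⟩
    refine hopen x hxU ?_
    by_contra hne
    have : ∀ᶠ y in 𝓝 x, f y ≠ 0 :=
      (hf.continuousOn.continuousAt (hU.mem_nhds hxU)).eventually_ne hne
    obtain ⟨y, hy1, hy2⟩ := mem_closure_iff_nhds.1 hx _ this
    exact hy1 hy2.self_of_nhds
  exact fun x hx => (hsub hx).self_of_nhds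

section local_existence

variable {E R : Type*} [NormedAddCommGroup E] [NormedSpace ℝ E] [NormedRing R] [NormedAlgebra ℝ R]

/-- The differential system `dX = A X` for a connection form `A` with values in a
normed algebra. -/
def IsFundamentalAt (A : E → E →L[ℝ] R) (X : E → R) (x : E) : Prop :=
  HasFDerivAt X ((ContinuousLinearMap.mul ℝ R).flip (X x) ∘L A x) x

/-- A linear ordinary differential equation with small coefficients is solvable on `[0, 1]`. -/
theorem exists_linear_ode_solution [CompleteSpace R] {a : ℝ → R} {κ : ℝ}
    (ha : ContinuousOn a (Set.Icc 0 1)) (hκ : ∀ t ∈ Set.Icc (0 : ℝ) 1, ‖a t‖ ≤ κ)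
    (hsmall : κ * (‖(1 : R)‖ + 1) ≤ 1) :
    ∃ γ : ℝ → R, γ 0 = 1 ∧
      ∀ t ∈ Set.Icc (0 : ℝ) 1, HasDerivWithinAt γ (a t * γ t) (Set.Icc 0 1) t := by
  have hκ0 : 0 ≤ κ := (norm_nonneg _).trans (hκ 0 (by simp))
  have hpl : IsPicardLindelof (fun t x => a t * x) (tmin := 0) (tmax := 1) ⟨0, by simp⟩ (1 : R)
      1 0 1 ⟨κ, hκ0⟩ := by
    refine ⟨fun t ht => ?_, fun x _ => ha.mul continuousOn_const, fun t ht x hx => ?_, by simp⟩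
    · refine LipschitzOnWith.of_dist_le_mul fun x _ y _ => ?_
      rw [dist_eq_norm, dist_eq_norm, ← mul_sub]
      exact (norm_mul_le _ _).trans (by gcongr; exact hκ t ht)
    · have hx' : ‖x‖ ≤ ‖(1 : R)‖ + 1 := by
        have := norm_sub_norm_le x 1
        rw [Metric.mem_closedBall, dist_eq_norm] at hx
        have hx : ‖x - 1‖ ≤ 1 := by simpa using hx
        linarith
      calc ‖a t * x‖ ≤ ‖a t‖ * ‖x‖ := norm_mul_le _ _
        _ ≤ κ * (‖(1 : R)‖ + 1) := by gcongr; exact hκ t ht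
        _ ≤ _ := by simpa using hsmall
  obtain ⟨γ, h0, h⟩ := hpl.exists_eq_forall_mem_Icc_hasDerivWithinAt₀
  exact ⟨γ, h0, h⟩

/-- Grönwall's inequality on `[0, 1]` for a linear equation with an error term. -/
theorem norm_le_of_linear_ode {γ a e : ℝ → R} {δ ε : ℝ}
    (hγ : ∀ t ∈ Set.Icc (0 : ℝ) 1, HasDerivWithinAt γ (a t * γ t + e t) (Set.Icc 0 1) t)
    (ha : ∀ t ∈ Set.Icc (0 : ℝ) 1, ‖a t‖ ≤ 1) (he : ∀ t ∈ Set.Icc (0 : ℝ) 1, ‖e t‖ ≤ ε)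
    (h0 : ‖γ 0‖ ≤ δ) {t : ℝ} (ht : t ∈ Set.Icc (0 : ℝ) 1) : ‖γ t‖ ≤ (δ + ε) * Real.exp 1 := by
  have hδ : 0 ≤ δ := (norm_nonneg _).trans h0
  have hε : 0 ≤ ε := (norm_nonneg _).trans (he 0 (by simp))
  have := norm_le_gronwallBound_of_norm_deriv_right_le (f := γ) (K := 1) (δ := δ) (ε := ε)
    (a := 0) (b := 1) (f' := fun t => a t * γ t + e t)
    (fun t ht => (hγ t ht).continuousWithinAt)
    (fun t ht => (hγ t ⟨ht.1, ht.2.le⟩).mono_of_mem_nhdsWithin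
      (Icc_mem_nhdsGE_of_mem ht)) h0
    (fun t ht => by
      have ht' : t ∈ Set.Icc (0 : ℝ) 1 := ⟨ht.1, ht.2.le⟩
      refine (norm_add_le _ _).trans (add_le_add ((norm_mul_le _ _).trans ?_) (he t ht'))
      gcongr
      exact ha t ht') t ht
  rw [gronwallBound_of_K_ne_0 one_ne_zero] at this
  have hexp : Real.exp t ≤ Real.exp 1 := Real.exp_le_exp.2 ht.2
  have : ‖γ t‖ ≤ δ * Real.exp t + ε * (Real.exp t - 1) := by simpa using this
  nlinarith [Real.exp_pos t]

end local_existence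

/-! ### Local solutions of compatible linear total differential systems -/

section local_existence

variable {E : Type*} [NormedAddCommGroup E] [NormedSpace ℝ E]

/-- Uniform second-order Taylor estimates for a smooth function near a point. -/
theorem exists_ball_taylor_bounds {G : Type*} [NormedAddCommGroup G] [NormedSpace ℝ G]
    {A : E → G} {U : Set E} (hU : IsOpen U) (hA : ContDiffOn ℝ ∞ A U) {p : E} (hp : p ∈ U) :
    ∃ ρ > 0, Metric.ball p ρ ⊆ U ∧ ∃ C > 0, (∀ x ∈ Metric.ball p ρ, ‖A x‖ ≤ C) ∧
      (∀ x ∈ Metric.ball p ρ, ∀ y ∈ Metric.ball p ρ, ‖A x - A y‖ ≤ C * ‖x - y‖) ∧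
      ∀ x ∈ Metric.ball p ρ, ∀ y ∈ Metric.ball p ρ,
        ‖A y - A x - fderiv ℝ A x (y - x)‖ ≤ C * ‖y - x‖ ^ 2 := by
  have hAp : ContDiffAt ℝ ∞ A p := hA.contDiffAt (hU.mem_nhds hp)
  have hDp : ContDiffAt ℝ ∞ (fderiv ℝ A) p := hAp.fderiv_right (by simp)
  obtain ⟨K, s, hs, hKs⟩ := (hAp.of_le (by simp) : ContDiffAt ℝ 1 A p).exists_lipschitzOnWith
  obtain ⟨K', s', hs', hKs'⟩ :=
    (hDp.of_le (by simp) : ContDiffAt ℝ 1 (fderiv ℝ A) p).exists_lipschitzOnWith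
  have hb : ∀ᶠ x in 𝓝 p, ‖A x‖ < ‖A p‖ + 1 :=
    hAp.continuousAt.norm.eventually_lt continuousAt_const (by simp)
  obtain ⟨ρ, hρ, hball⟩ := Metric.mem_nhds_iff.1
    (Filter.inter_mem (Filter.inter_mem (hU.mem_nhds hp) hb) (Filter.inter_mem hs hs'))
  refine ⟨ρ, hρ, fun x hx => (hball hx).1.1, ‖A p‖ + 1 + K + K', by positivity,
    fun x hx => ?_, fun x hx y hy => ?_, fun x hx y hy => ?_⟩
  · have : ‖A x‖ < ‖A p‖ + 1 := (hball hx).1.2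
    linarith [K.coe_nonneg, K'.coe_nonneg]
  · have := hKs.dist_le_mul x (hball hx).2.1 y (hball hy).2.1
    rw [dist_eq_norm, dist_eq_norm] at this
    refine this.trans ?_
    gcongr
    linarith [norm_nonneg (A p), K'.coe_nonneg]
  · have hseg : segment ℝ x y ⊆ Metric.ball p ρ := (convex_ball p ρ).segment_subset hx hy
    have := (convex_segment x y).norm_image_sub_le_of_norm_hasFDerivWithin_le
      (f := fun z => A z - fderiv ℝ A x z) (f' := fun z => fderiv ℝ A z - fderiv ℝ A x)
      (C := K' * ‖y - x‖)
      (fun z hz => by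
        have hd : DifferentiableAt ℝ A z :=
          (hA.contDiffAt (hU.mem_nhds (hball (hseg hz)).1.1)).differentiableAt (by simp)
        exact (hd.hasFDerivAt.sub (fderiv ℝ A x).hasFDerivAt).hasFDerivWithinAt)
      (fun z hz => by
        have := hKs'.dist_le_mul z (hball (hseg hz)).2.2 x (hball hx).2.2
        rw [dist_eq_norm, dist_eq_norm] at this
        refine this.trans ?_
        gcongr
        obtain ⟨t, ht, rfl⟩ := (segment_eq_image' ℝ x y).subset hz
        rw [add_sub_cancel_left, norm_smul, Real.norm_of_nonneg ht.1]
        exact mul_le_of_le_one_left (norm_nonneg _) ht.2)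
      (left_mem_segment ℝ x y) (right_mem_segment ℝ x y)
    calc ‖A y - A x - fderiv ℝ A x (y - x)‖
        = ‖A y - fderiv ℝ A x y - (A x - fderiv ℝ A x x)‖ := by rw [map_sub]; congr 1; abel
      _ ≤ K' * ‖y - x‖ * ‖y - x‖ := this
      _ = K' * ‖y - x‖ ^ 2 := by ring
      _ ≤ _ := by gcongr; linarith [norm_nonneg (A p), K.coe_nonneg]

variable {R : Type*} [NormedRing R] [NormedAlgebra ℝ R]

/-- **Local integrability of flat connections.** If the connection form `A` is flat, the system
`dX = A X` has an invertible solution near every point. The solution is obtained by solving the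
linear differential equation `γ' = A(p + t y)(y) γ` along the rays from `p`. -/
theorem exists_local_fundamental_solution [CompleteSpace R] {A : E → E →L[ℝ] R} {U : Set E}
    (hU : IsOpen U) (hA : ContDiffOn ℝ ∞ A U)
    (hflat : ∀ x ∈ U, ∀ h k,
      fderiv ℝ A x h k + A x k * A x h = fderiv ℝ A x k h + A x h * A x k)
    {p : E} (hp : p ∈ U) :
    ∃ r > 0, Metric.ball p r ⊆ U ∧ ∃ X : E → R, ∀ x ∈ Metric.ball p r,
      IsFundamentalAt A X x ∧ IsUnit (X x) := by
  obtain ⟨ρ, hρ, hρU, C, hC, hbd, hlip, htay⟩ := exists_ball_taylor_bounds hU hA hp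
  set o : ℝ := ‖(1 : R)‖
  have ho0 : 0 ≤ o := norm_nonneg _
  set r : ℝ := min ρ (1 / (C * (o + 1)))
  have hr0 : 0 < r := by positivity
  have hCr : C * r * (o + 1) ≤ 1 := by
    calc C * r * (o + 1) ≤ C * (1 / (C * (o + 1))) * (o + 1) := by
          gcongr; exact min_le_right _ _
      _ = 1 := by field_simp
  have hCr1 : C * r ≤ 1 := by nlinarith [mul_pos hC hr0]
  -- points of the rays
  have hray : ∀ y : E, ‖y‖ < r → ∀ t ∈ Set.Icc (0 : ℝ) 1, p + t • y ∈ Metric.ball p ρ := by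
    intro y hy t ht
    rw [Metric.mem_ball, dist_eq_norm, add_sub_cancel_left, norm_smul,
      Real.norm_of_nonneg ht.1]
    calc t * ‖y‖ ≤ ‖y‖ := mul_le_of_le_one_left (norm_nonneg _) ht.2
      _ < ρ := hy.trans_le (min_le_left _ _)
  have hAd : ∀ x ∈ Metric.ball p ρ, HasFDerivAt A (fderiv ℝ A x) x := fun x hx =>
    ((hA.contDiffAt (hU.mem_nhds (hρU hx))).differentiableAt (by simp)).hasFDerivAt
  have hrayd : ∀ y h : E, ‖y‖ < r → ∀ t ∈ Set.Icc (0 : ℝ) 1,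
      HasDerivAt (fun s : ℝ => A (p + s • y) h) (fderiv ℝ A (p + t • y) y h) t := by
    intro y h hy t ht
    have h1 : HasDerivAt (fun s : ℝ => p + s • y) y t := by
      simpa using ((hasDerivAt_id t).smul_const y).const_add p
    have h2 := (hAd _ (hray y hy t ht)).comp_hasDerivAt t h1
    simpa using h2.clm_apply (hasDerivAt_const t h)
  have hsmall : ∀ y : E, ‖y‖ < r → ∀ t ∈ Set.Icc (0 : ℝ) 1, ‖A (p + t • y) y‖ ≤ C * r := by
    intro y hy t ht
    calc _ ≤ ‖A (p + t • y)‖ * ‖y‖ := ContinuousLinearMap.le_opNorm _ _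
      _ ≤ C * r := by gcongr; exact hbd _ (hray y hy t ht)
  have hsol : ∀ y : E, ‖y‖ < r → ∃ γ : ℝ → R, γ 0 = 1 ∧ ∀ t ∈ Set.Icc (0 : ℝ) 1,
      HasDerivWithinAt γ (A (p + t • y) y * γ t) (Set.Icc 0 1) t := fun y hy =>
    exists_linear_ode_solution
      (fun t ht => (hrayd y y hy t ht).continuousAt.continuousWithinAt) (hsmall y hy) hCr
  choose! γ hγ0 hγ using hsol
  set M : ℝ := o * Real.exp 1
  have hM0 : 0 ≤ M := by positivity
  have hγM : ∀ y : E, ‖y‖ < r → ∀ t ∈ Set.Icc (0 : ℝ) 1, ‖γ y t‖ ≤ M := by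
    intro y hy t ht
    have := norm_le_of_linear_ode (γ := γ y) (a := fun t => A (p + t • y) y) (e := 0) (δ := o)
      (ε := 0) (fun t ht => by simpa using hγ y hy t ht)
      (fun t ht => (hsmall y hy t ht).trans hCr1) (by simp) (by rw [hγ0 y hy]) ht
    simpa using this
  -- variation of the coefficient between neighbouring rays
  have hvar : ∀ y h : E, ‖y‖ < r → ‖y + h‖ < r → ∀ t ∈ Set.Icc (0 : ℝ) 1,
      ‖A (p + t • (y + h)) (y + h) - A (p + t • y) y‖ ≤ (C * r + C) * ‖h‖ := by
    intro y h hy hyh t ht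
    have h1 : ‖A (p + t • (y + h)) - A (p + t • y)‖ ≤ C * ‖h‖ := by
      refine (hlip _ (hray _ hyh t ht) _ (hray y hy t ht)).trans ?_
      gcongr
      have : p + t • (y + h) - (p + t • y) = t • h := by module
      rw [this, norm_smul, Real.norm_of_nonneg ht.1]
      exact mul_le_of_le_one_left (norm_nonneg _) ht.2
    have h2 : A (p + t • (y + h)) (y + h) - A (p + t • y) y
        = (A (p + t • (y + h)) - A (p + t • y)) (y + h) + A (p + t • y) h := by
      simp only [sub_apply, map_add]; abel
    rw [h2]
    calc _ ≤ ‖A (p + t • (y + h)) - A (p + t • y)‖ * ‖y + h‖ + ‖A (p + t • y)‖ * ‖h‖ :=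
          (norm_add_le _ _).trans (add_le_add (ContinuousLinearMap.le_opNorm _ _)
            (ContinuousLinearMap.le_opNorm _ _))
      _ ≤ C * ‖h‖ * r + C * ‖h‖ := by gcongr; exact hbd _ (hray y hy t ht)
      _ = _ := by ring
  set c₁ : ℝ := (C * r + C) * M * Real.exp 1 with hc₁
  have hΔ : ∀ y h : E, ‖y‖ < r → ‖y + h‖ < r → ∀ t ∈ Set.Icc (0 : ℝ) 1,
      ‖γ (y + h) t - γ y t‖ ≤ c₁ * ‖h‖ := by
    intro y h hy hyh t ht
    have := norm_le_of_linear_ode (γ := fun t => γ (y + h) t - γ y t)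
      (a := fun t => A (p + t • (y + h)) (y + h))
      (e := fun t => (A (p + t • (y + h)) (y + h) - A (p + t • y) y) * γ y t) (δ := 0)
      (ε := (C * r + C) * ‖h‖ * M)
      (fun t ht => by
        refine ((hγ _ hyh t ht).sub (hγ y hy t ht)).congr_deriv ?_
        simp only [mul_sub, sub_mul]
        abel)
      (fun t ht => (hsmall _ hyh t ht).trans hCr1)
      (fun t ht => (norm_mul_le _ _).trans (by
        gcongr
        · exact hvar y h hy hyh t ht
        · exact hγM y hy t ht))
      (by simp [hγ0 y hy, hγ0 _ hyh]) ht
    calc _ ≤ _ := this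
      _ = _ := by rw [hc₁]; ring
  set c₂ : ℝ := (C * r + C) * c₁ + (C * r + C) * M with hc₂
  -- the first-order expansion of `γ y t` in `y`
  have hZ : ∀ y h : E, ‖y‖ < r → ‖y + h‖ < r →
      ‖γ (y + h) 1 - γ y 1 - A (p + y) h * γ y 1‖ ≤ c₂ * Real.exp 1 * ‖h‖ ^ 2 := by
    intro y h hy hyh
    have := norm_le_of_linear_ode
      (γ := fun t => γ (y + h) t - γ y t - (t • A (p + t • y) h) * γ y t)
      (a := fun t => A (p + t • y) y)
      (e := fun t => (A (p + t • (y + h)) (y + h) - A (p + t • y) y) * (γ (y + h) t - γ y t)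
        + ((A (p + t • (y + h)) - A (p + t • y) - fderiv ℝ A (p + t • y) (t • h)) y
          + (A (p + t • (y + h)) - A (p + t • y)) h) * γ y t) (δ := 0)
      (ε := c₂ * ‖h‖ ^ 2)
      (fun t ht => by
        have hd := ((hγ _ hyh t ht).sub (hγ y hy t ht)).sub
          (((hasDerivAt_id t).smul (hrayd y h hy t ht)).hasDerivWithinAt.mul (hγ y hy t ht))
        refine hd.congr_deriv ?_
        have hf := hflat _ (hρU (hray y hy t ht)) y h
        have hf' : fderiv ℝ A (p + t • y) h y = fderiv ℝ A (p + t • y) y h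
            + A (p + t • y) h * A (p + t • y) y - A (p + t • y) y * A (p + t • y) h := by
          rw [hf]; abel
        simp only [map_smul, sub_apply, smul_apply, Pi.smul_apply', hf',
          map_add, id, smul_sub, smul_add, add_mul, sub_mul, mul_sub, smul_mul_assoc,
          mul_smul_comm, one_smul, mul_assoc]
        abel)
      (fun t ht => (hsmall _ hy t ht).trans hCr1)
      (fun t ht => by
        have hk : p + t • (y + h) - (p + t • y) = t • h := by module
        have hth : ‖t • h‖ ≤ ‖h‖ := by
          rw [norm_smul, Real.norm_of_nonneg ht.1]
          exact mul_le_of_le_one_left (norm_nonneg _) ht.2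
        have h1 := htay _ (hray y hy t ht) _ (hray _ hyh t ht)
        have h2 := hlip _ (hray _ hyh t ht) _ (hray y hy t ht)
        rw [hk] at h1 h2
        calc _ ≤ (C * r + C) * ‖h‖ * (c₁ * ‖h‖) + (C * ‖h‖ ^ 2 * r + C * ‖h‖ * ‖h‖) * M := by
              refine (norm_add_le _ _).trans (add_le_add ((norm_mul_le _ _).trans ?_)
                ((norm_mul_le _ _).trans ?_))
              · exact mul_le_mul (hvar y h hy hyh t ht) (hΔ y h hy hyh t ht) (norm_nonneg _)
                  (by positivity)
              · refine mul_le_mul ((norm_add_le _ _).trans (add_le_add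
                  ((ContinuousLinearMap.le_opNorm _ _).trans ?_)
                  ((ContinuousLinearMap.le_opNorm _ _).trans ?_))) (hγM y hy t ht)
                  (norm_nonneg _) (by positivity)
                · refine mul_le_mul (h1.trans ?_) hy.le (norm_nonneg _) (by positivity)
                  gcongr
                · gcongr
                  exact h2.trans (by gcongr)
          _ = _ := by rw [hc₂]; ring)
      (by simp [hγ0 y hy, hγ0 _ hyh]) (t := 1) (by simp)
    simp only [one_smul] at this
    calc _ ≤ _ := this
      _ = _ := by ring
  have hfund : ∀ x ∈ Metric.ball p r, IsFundamentalAt A (fun x => γ (x - p) 1) x := by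
    intro x hx
    have hy : ‖x - p‖ < r := by rwa [Metric.mem_ball, dist_eq_norm] at hx
    rw [IsFundamentalAt, hasFDerivAt_iff_isLittleO_nhds_zero]
    have hev : ∀ᶠ h : E in 𝓝 0, ‖x - p + h‖ < r := by
      have : ContinuousAt (fun h : E => ‖x - p + h‖) 0 := by fun_prop
      exact this.eventually_lt continuousAt_const (by simpa using hy)
    refine Asymptotics.IsBigO.trans_isLittleO (g := fun h : E => ‖h‖ ^ 2)
      (Asymptotics.IsBigO.of_bound (c₂ * Real.exp 1) ?_)
      ((Asymptotics.isLittleO_norm_pow_id one_lt_two))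
    filter_upwards [hev] with h hh
    have := hZ (x - p) h hy hh
    rw [Real.norm_of_nonneg (by positivity)]
    rwa [add_sub_cancel, ← add_sub_right_comm] at this
  have hXp : γ (p - p) 1 = 1 := by
    have h0 : ‖(0 : E)‖ < r := by simpa using hr0
    have := norm_le_of_linear_ode (γ := fun t => γ 0 t - 1) (a := 0) (e := 0) (δ := 0) (ε := 0)
      (fun t ht => by simpa using (hγ 0 h0 t ht).sub_const 1) (by simp) (by simp)
      (by simp [hγ0 0 h0]) (t := 1) (by simp)
    rw [sub_self]
    simpa [sub_eq_zero] using this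
  have hunit : ∀ᶠ x in 𝓝 p, IsUnit (γ (x - p) 1) := by
    have hcont : ContinuousAt (fun x => γ (x - p) 1) p :=
      (hfund p (Metric.mem_ball_self hr0)).continuousAt
    refine hcont.preimage_mem_nhds (t := {z | IsUnit z}) ?_
    rw [hXp]
    exact Units.isOpen.mem_nhds isUnit_one
  obtain ⟨r', hr', hball⟩ := Metric.eventually_nhds_iff_ball.1 hunit
  refine ⟨min r r', lt_min hr0 hr', fun x hx => hρU ?_, fun x => γ (x - p) 1, fun x hx => ⟨?_, ?_⟩⟩
  · exact Metric.ball_subset_ball ((min_le_left _ _).trans (min_le_left _ _)) hx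
  · exact hfund x (Metric.ball_subset_ball (min_le_left _ _) hx)
  · exact hball x (Metric.ball_subset_ball (min_le_right _ _) hx)

end local_existence

/-! ### Global solutions on simply connected domains -/

/-- A locally constant cocycle `c` (with values in the maps of a set `F`) on a simply connected
space admits a global flat section. This is the lifting property of the covering space glued
from the products `base i × F`, `F` discrete. -/
theorem exists_flat_section {B F : Type*} [TopologicalSpace B] [SimplyConnectedSpace B]
    [LocallyPathConnectedSpace B] (base : B → Set B) (hopen : ∀ i, IsOpen (base i))
    (hmem : ∀ i, i ∈ base i) (c : B → B → B → F → F)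
    (hself : ∀ i, ∀ x ∈ base i, ∀ v, c i i x v = v)
    (hcomp : ∀ i j k, ∀ x ∈ base i ∩ base j ∩ base k, ∀ v, c j k x (c i j x v) = c i k x v)
    (hloc : ∀ i j, ∀ x ∈ base i ∩ base j, ∀ v, ∀ᶠ y in 𝓝 x, c i j y v = c i j x v)
    (b : B) (v : F) :
    ∃ s : B → F, s b = v ∧ ∀ x, ∀ᶠ y in 𝓝 x, c y x y (s y) = s x := by
  let _ : TopologicalSpace F := ⊥
  have _ : DiscreteTopology F := ⟨rfl⟩
  let Z : FiberBundleCore B B F :=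
    { baseSet := base
      isOpen_baseSet := hopen
      indexAt := id
      mem_baseSet_at := hmem
      coordChange := c
      coordChange_self := hself
      continuousOn_coordChange := by
        rintro i j ⟨x, w⟩ ⟨hx, -⟩
        have h1 : ∀ᶠ p : B × F in 𝓝 (x, w), p.2 = w :=
          continuousAt_snd.preimage_mem_nhds
            ((isOpen_discrete {w}).mem_nhds (Set.mem_singleton w))
        have h2 : ∀ᶠ p : B × F in 𝓝 (x, w), c i j p.1 w = c i j x w :=
          (continuousAt_fst (p := (x, w))).eventually (hloc i j x hx w)
        refine ContinuousAt.continuousWithinAt ?_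
        refine Filter.Tendsto.congr' ?_ (tendsto_const_nhds (x := c i j x w))
        filter_upwards [h1, h2] with p hp1 hp2
        rw [hp1, hp2]
      coordChange_comp := hcomp }
  have hcov : IsCoveringMap (Bundle.TotalSpace.proj : Bundle.TotalSpace F Z.Fiber → B) :=
    IsCoveringMap.mk _ (fun _ => F) (fun x => Z.localTrivAt x) fun x => Z.mem_localTrivAt_baseSet x
  obtain ⟨σ, ⟨hσb, hσ⟩, -⟩ := hcov.existsUnique_continuousMap_lifts (ContinuousMap.id B) b
    (⟨b, v⟩ : Bundle.TotalSpace F Z.Fiber) rfl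
  have hproj : ∀ x, (σ x).proj = x := fun x => congrFun hσ x
  let val : Bundle.TotalSpace F Z.Fiber → F := fun e => e.2
  refine ⟨fun x => val (σ x), congrArg val hσb, fun x => ?_⟩
  have hcont : ContinuousAt (fun y => (Z.localTrivAt x (σ y)).2) x := by
    refine continuousAt_snd.comp
      (ContinuousAt.comp (g := Z.localTrivAt x) ?_ σ.continuous.continuousAt)
    refine (Z.localTrivAt x).continuousAt ?_
    rw [Z.mem_localTrivAt_source, hproj]
    exact Z.mem_localTrivAt_baseSet x
  have hev : ∀ᶠ y in 𝓝 x, (Z.localTrivAt x (σ y)).2 = (Z.localTrivAt x (σ x)).2 :=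
    hcont.preimage_mem_nhds ((isOpen_discrete {(Z.localTrivAt x (σ x)).2}).mem_nhds
      (Set.mem_singleton _))
  filter_upwards [hev] with y hy
  rw [Z.localTrivAt_snd, Z.localTrivAt_snd] at hy
  change c (σ y).proj x (σ y).proj (val (σ y)) = c (σ x).proj x (σ x).proj (val (σ x)) at hy
  rw [hproj, hproj, hself x x (hmem x)] at hy
  exact hy

section global_existence

variable {E W : Type*} [NormedAddCommGroup E] [NormedSpace ℝ E] [NormedAddCommGroup W]
  [NormedSpace ℝ W]

theorem IsFundamentalAt.hasFDerivAt_apply {A : E → E →L[ℝ] W →L[ℝ] W} {X : E → W →L[ℝ] W} {x : E}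
    (h : IsFundamentalAt A X x) (w : W) :
    HasFDerivAt (fun z => X z w) ((A x).flip (X x w)) x := by
  have := h.clm_apply (hasFDerivAt_const w x)
  refine this.congr_fderiv ?_
  ext k
  simp [ContinuousLinearMap.mul_apply']

/-- Uniqueness of solutions of `df = A f` on a domain. The derivative `h ↦ A(x)(h)(f x)` is written
`(A x).flip (f x)`. -/
theorem eqOn_of_hasFDerivAt_flip {A : E → E →L[ℝ] W →L[ℝ] W} {U : Set E} (hU : IsOpen U)
    (hc : IsPreconnected U) (hA : ContinuousOn A U) {f g : E → W}
    (hf : ∀ x ∈ U, HasFDerivAt f ((A x).flip (f x)) x)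
    (hg : ∀ x ∈ U, HasFDerivAt g ((A x).flip (g x)) x) {p : E} (hp : p ∈ U) (h : f p = g p) :
    Set.EqOn f g U := by
  have hd : ∀ x ∈ U, HasFDerivAt (fun x => f x - g x) ((A x).flip (f x - g x)) x := fun x hx => by
    rw [map_sub]
    exact (hf x hx).sub (hg x hx)
  have hK : ContinuousOn (fun x => ‖A x‖) U :=
    ContinuousOn.norm (E := E →L[ℝ] W →L[ℝ] W) hA
  have := eq_zero_of_norm_fderiv_le hU hc (f := fun x => f x - g x) (K := fun x => ‖A x‖)
    (fun x hx => (hd x hx).differentiableAt.differentiableWithinAt) hK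
    (fun x hx => by
      rw [(hd x hx).fderiv, ← (A x).opNorm_flip]
      exact ContinuousLinearMap.le_opNorm _ _) hp (by simp [h])
  exact fun x hx => sub_eq_zero.1 (this x hx)

/-- **Global integrability of flat connections** on simply connected open sets: the system
`df = A f` with flat `A` has a solution with any given initial value. -/
theorem exists_global_flat_solution [CompleteSpace W] {A : E → E →L[ℝ] W →L[ℝ] W} {U : Set E}
    (hU : IsOpen U) (hsc : IsSimplyConnected U) (hA : ContDiffOn ℝ ∞ A U)
    (hflat : ∀ x ∈ U, ∀ h k,
      fderiv ℝ A x h k + A x k * A x h = fderiv ℝ A x k h + A x h * A x k)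
    {p : E} (hp : p ∈ U) (w : W) :
    ∃ f : E → W, f p = w ∧ ∀ x ∈ U, HasFDerivAt f ((A x).flip (f x)) x := by
  classical
  have : SimplyConnectedSpace U := hsc.simplyConnectedSpace
  have : LocallyPathConnectedSpace U := hU.locallyPathConnectedSpace
  choose r hr hrU X hX using fun i : U => exists_local_fundamental_solution hU hA hflat i.2
  have hcancel : ∀ i : U, ∀ x ∈ Metric.ball (i : E) (r i), ∀ w,
      X i x (Ring.inverse (X i x) w) = w := fun i x hx w => by
    rw [← mul_apply_eq_comp, Ring.mul_inverse_cancel _ (hX i x hx).2]; rfl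
  have hcancel' : ∀ i : U, ∀ x ∈ Metric.ball (i : E) (r i), ∀ w,
      Ring.inverse (X i x) (X i x w) = w := fun i x hx w => by
    rw [← mul_apply_eq_comp, Ring.inverse_mul_cancel _ (hX i x hx).2]; rfl
  -- the transition maps are constant on the (convex) intersections of two balls
  have hconst : ∀ i j : U, ∀ x ∈ Metric.ball (i : E) (r i) ∩ Metric.ball (j : E) (r j),
      ∀ y ∈ Metric.ball (i : E) (r i) ∩ Metric.ball (j : E) (r j), ∀ w,
      Ring.inverse (X j y) (X i y w) = Ring.inverse (X j x) (X i x w) := by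
    intro i j x hx y hy w
    have := eqOn_of_hasFDerivAt_flip (A := A) (Metric.isOpen_ball.inter Metric.isOpen_ball)
      ((convex_ball (i : E) (r i)).inter (convex_ball (j : E) (r j))).isPreconnected
      (hA.continuousOn.mono fun z hz => hrU i hz.1)
      (fun z hz => (hX i z hz.1).1.hasFDerivAt_apply w)
      (fun z hz => (hX j z hz.2).1.hasFDerivAt_apply (Ring.inverse (X j x) (X i x w))) hx
      (hcancel j x hx.2 _).symm hy
    dsimp only at this
    rw [this, hcancel' j y hy.2]
  -- the initial values of the local solutions, relative to the local frames `X i`, are glued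
  obtain ⟨s, hsp, hs⟩ := exists_flat_section (B := U) (F := W)
    (fun i => Subtype.val ⁻¹' Metric.ball (i : E) (r i))
    (fun i => Metric.isOpen_ball.preimage continuous_subtype_val)
    (fun i => Metric.mem_ball_self (hr i)) (fun i j x w => Ring.inverse (X j x) (X i x w))
    (fun i x hx w => hcancel' i x hx w)
    (fun i j k x hx w => by rw [hcancel j x hx.1.2])
    (fun i j x hx w => by
      have : ∀ᶠ y in 𝓝 x, y ∈ (Subtype.val ⁻¹' Metric.ball (i : E) (r i)
          ∩ Subtype.val ⁻¹' Metric.ball (j : E) (r j) : Set U) :=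
        ((Metric.isOpen_ball.preimage continuous_subtype_val).inter
          (Metric.isOpen_ball.preimage continuous_subtype_val)).mem_nhds hx
      filter_upwards [this] with y hy
      exact hconst i j x hx y hy w)
    ⟨p, hp⟩ (Ring.inverse (X ⟨p, hp⟩ p) w)
  have hself : ∀ i : U, (i : E) ∈ Metric.ball (i : E) (r i) := fun i => Metric.mem_ball_self (hr i)
  refine ⟨fun x => if hx : x ∈ U then X ⟨x, hx⟩ x (s ⟨x, hx⟩) else 0, ?_, fun x hx => ?_⟩
  · dsimp only
    rw [dif_pos hp, hsp, hcancel ⟨p, hp⟩ p (hself _)]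
  · have hloc : ∀ᶠ y in 𝓝 x, (if hy : y ∈ U then X ⟨y, hy⟩ y (s ⟨y, hy⟩) else 0)
        = X ⟨x, hx⟩ y (s ⟨x, hx⟩) := by
      have h1 := hs ⟨x, hx⟩
      rw [nhds_subtype_eq_comap, Filter.eventually_comap] at h1
      filter_upwards [h1, hU.mem_nhds hx, Metric.ball_mem_nhds x (hr ⟨x, hx⟩)] with y hy hyU hyb
      rw [dif_pos hyU, ← hy ⟨y, hyU⟩ rfl, hcancel ⟨x, hx⟩ y hyb]
    have h2 := (hX ⟨x, hx⟩ x (hself ⟨x, hx⟩)).1.hasFDerivAt_apply (s ⟨x, hx⟩)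
    dsimp only
    rw [dif_pos hx]
    exact h2.congr_of_eventuallyEq hloc

/-- Solutions of smooth total differential systems are smooth. -/
theorem contDiffOn_of_hasFDerivAt_flip [FiniteDimensional ℝ E] {A : E → E →L[ℝ] W →L[ℝ] W}
    {U : Set E} (hU : IsOpen U) (hA : ContDiffOn ℝ ∞ A U) {f : E → W}
    (hf : ∀ x ∈ U, HasFDerivAt f ((A x).flip (f x)) x) : ContDiffOn ℝ ∞ f U := by
  refine contDiffOn_infty.2 fun n => ?_
  induction n with
  | zero =>
    exact contDiffOn_zero.2 fun x hx => (hf x hx).continuousAt.continuousWithinAt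
  | succ n ih =>
    have : ((n + 1 : ℕ) : WithTop ℕ∞) = (n : WithTop ℕ∞) + 1 := by push_cast; rfl
    rw [this, contDiffOn_succ_iff_fderiv_of_isOpen hU]
    refine ⟨fun x hx => (hf x hx).differentiableAt.differentiableWithinAt, by simp, ?_⟩
    have h1 : ContDiffOn ℝ n (fun x => (A x).flip (f x)) U :=
      contDiffOn_clm_apply.2 fun y =>
        ((contDiffOn_infty.1 hA n).clm_apply contDiffOn_const).clm_apply ih
    exact h1.congr fun x hx => (hf x hx).fderiv

end global_existence

/-! ### Systems for tuples of vectors -/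

section linear_system

variable {N : ℕ} {ι V : Type*} [Fintype ι] [DecidableEq ι] [NormedAddCommGroup V] [NormedSpace ℝ V]

/-- The operator on tuples of vectors given by a matrix of numbers. -/
def tupleCLM (V : Type*) [NormedAddCommGroup V] [NormedSpace ℝ V] (m : ι → ι → ℝ) :
    (ι → V) →L[ℝ] (ι → V) :=
  ∑ α, ∑ β, m α β • (ContinuousLinearMap.single ℝ (fun _ : ι => V) α ∘L
    ContinuousLinearMap.proj (R := ℝ) (φ := fun _ : ι => V) β)

theorem tupleCLM_apply (m : ι → ι → ℝ) (w : ι → V) (α : ι) :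
    tupleCLM V m w α = ∑ β, m α β • w β := by
  simp [tupleCLM, Finset.sum_apply, Pi.single_apply]

/-- The connection form of a linear system `∂_i f_α = ∑ β, a_{iαβ} f_β`. -/
def systemForm (V : Type*) [NormedAddCommGroup V] [NormedSpace ℝ V]
    (a : Fin N → ι → ι → (Fin N → ℝ) → ℝ) (x : Fin N → ℝ) :
    (Fin N → ℝ) →L[ℝ] (ι → V) →L[ℝ] (ι → V) :=
  ∑ i, (ContinuousLinearMap.proj (R := ℝ) (φ := fun _ : Fin N => ℝ) i).smulRight
    (tupleCLM V fun α β => a i α β x)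

theorem systemForm_apply (a : Fin N → ι → ι → (Fin N → ℝ) → ℝ) (x h : Fin N → ℝ) :
    systemForm V a x h = ∑ i, h i • tupleCLM V fun α β => a i α β x := by
  simp [systemForm, sum_apply]

variable {U : Set (Fin N → ℝ)} {a : Fin N → ι → ι → (Fin N → ℝ) → ℝ}

theorem contDiffOn_tupleCLM {m : ι → ι → (Fin N → ℝ) → ℝ} (hm : ∀ α β, ContDiffOn ℝ ∞ (m α β) U) :
    ContDiffOn ℝ ∞ (fun x => tupleCLM V fun α β => m α β x) U := by
  unfold tupleCLM
  exact ContDiffOn.sum fun α _ => ContDiffOn.sum fun β _ => (hm α β).smul contDiffOn_const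

theorem contDiffOn_systemForm (ha : ∀ i α β, ContDiffOn ℝ ∞ (a i α β) U) :
    ContDiffOn ℝ ∞ (systemForm V a) U :=
  contDiffOn_clm_apply.2 fun h => by
    simp only [systemForm_apply]
    exact ContDiffOn.sum fun i _ => (contDiffOn_tupleCLM (V := V) (ha i)).const_smul (h i)

theorem partialD_tupleCLM {m : ι → ι → (Fin N → ℝ) → ℝ} {x : Fin N → ℝ}
    (hm : ∀ α β, DifferentiableAt ℝ (m α β) x) (k : Fin N) :
    partialD k (fun x => tupleCLM V fun α β => m α β x) x
      = tupleCLM V fun α β => partialD k (m α β) x := by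
  unfold tupleCLM
  have h1 : ∀ α β, DifferentiableAt ℝ (fun x => m α β x •
      (ContinuousLinearMap.single ℝ (fun _ : ι => V) α ∘L
        ContinuousLinearMap.proj (R := ℝ) (φ := fun _ : ι => V) β)) x :=
    fun α β => (hm α β).smul (differentiableAt_const _)
  rw [partialD_sum fun α _ => DifferentiableAt.fun_sum fun β _ => h1 α β]
  refine Finset.sum_congr rfl fun α _ => ?_
  rw [partialD_sum fun β _ => h1 α β]
  exact Finset.sum_congr rfl fun β _ => partialD_smul_const (hm α β) _ k

theorem fderiv_systemForm (hU : IsOpen U) (ha : ∀ i α β, ContDiffOn ℝ ∞ (a i α β) U)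
    {x : Fin N → ℝ} (hx : x ∈ U) (h k : Fin N → ℝ) :
    fderiv ℝ (systemForm V a) x h k
      = ∑ c, ∑ i, (h c * k i) • tupleCLM V fun α β => partialD c (a i α β) x := by
  have hd : DifferentiableAt ℝ (systemForm V a) x := (contDiffOn_systemForm ha).diffAt hU hx
  refine (DFunLike.congr_fun (fderiv_eq_sum_partialD (systemForm V a) x h) k).trans ?_
  rw [sum_apply]
  refine Finset.sum_congr rfl fun c _ => ?_
  have h1 : partialD c (systemForm V a) x k = partialD c (fun x => systemForm V a x k) x :=
    (partialD_clm_apply hd k c).symm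
  have h2 : ∀ i, DifferentiableAt ℝ (fun x => tupleCLM V fun α β => a i α β x) x := fun i =>
    (contDiffOn_tupleCLM (ha i)).diffAt hU hx
  rw [smul_apply, h1]
  simp only [systemForm_apply]
  have h3 : ∀ i, DifferentiableAt ℝ (fun x => k i • tupleCLM V fun α β => a i α β x) x :=
    fun i => (h2 i).const_smul (k i)
  rw [partialD_sum fun i _ => h3 i, Finset.smul_sum]
  refine Finset.sum_congr rfl fun i _ => ?_
  rw [partialD_const_smul (h2 i), partialD_tupleCLM fun α β => (ha i α β).diffAt hU hx, smul_smul]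

/-- The compatibility conditions of a linear system say that its connection form is flat. -/
theorem systemForm_flat (hU : IsOpen U) (ha : ∀ i α β, ContDiffOn ℝ ∞ (a i α β) U)
    (hcompat : ∀ u ∈ U, ∀ i k α β,
      partialD k (a i α β) u + ∑ γ, a i α γ u * a k γ β u
        = partialD i (a k α β) u + ∑ γ, a k α γ u * a i γ β u)
    {x : Fin N → ℝ} (hx : x ∈ U) (h k : Fin N → ℝ) :
    fderiv ℝ (systemForm V a) x h k + systemForm V a x k * systemForm V a x h
      = fderiv ℝ (systemForm V a) x k h + systemForm V a x h * systemForm V a x k := by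
  have key : ∀ h k : Fin N → ℝ,
      fderiv ℝ (systemForm V a) x h k + systemForm V a x k * systemForm V a x h
        = ∑ c, ∑ i, (h c * k i) • tupleCLM V fun α β =>
          partialD c (a i α β) x + ∑ γ, a i α γ x * a c γ β x := by
    intro h k
    have hmul : ∀ i c, (tupleCLM V fun α β => a i α β x) * (tupleCLM V fun α β => a c α β x)
        = tupleCLM V fun α β => ∑ γ, a i α γ x * a c γ β x := by
      intro i c
      ext w α
      simp only [mul_apply_eq_comp, tupleCLM_apply, Finset.smul_sum, Finset.sum_smul, smul_smul]
      exact Finset.sum_comm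
    have hadd : ∀ m m' : ι → ι → ℝ, (tupleCLM V fun α β => m α β + m' α β)
        = tupleCLM V m + tupleCLM V m' := by
      intro m m'
      ext w α
      simp only [add_apply, Pi.add_apply, tupleCLM_apply, add_smul, Finset.sum_add_distrib]
    simp only [hadd, smul_add, Finset.sum_add_distrib]
    rw [fderiv_systemForm hU ha hx, systemForm_apply, systemForm_apply, Finset.sum_mul_sum,
      Finset.sum_comm (s := (Finset.univ : Finset (Fin N)))
        (f := fun i c => k i • (tupleCLM V fun α β => a i α β x) *
          h c • (tupleCLM V fun α β => a c α β x))]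
    congr 1
    refine Finset.sum_congr rfl fun c _ => Finset.sum_congr rfl fun i _ => ?_
    rw [smul_mul_smul_comm, hmul, mul_comm]
  rw [key h k, key k h, Finset.sum_comm]
  refine Finset.sum_congr rfl fun i _ => Finset.sum_congr rfl fun c _ => ?_
  rw [mul_comm (h c)]
  congr 2
  funext α β
  exact hcompat x hx i c α β

/-- A solution of the linear system is a solution of `df = A f`, where `A` is the connection form
of the system. -/
theorem hasFDerivAt_systemForm {f : ι → (Fin N → ℝ) → V} {u : Fin N → ℝ}
    (hd : ∀ α, DifferentiableAt ℝ (f α) u)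
    (hf : ∀ i α, partialD i (f α) u = ∑ β, a i α β u • f β u) :
    HasFDerivAt (fun x α => f α x) ((systemForm V a u).flip fun α => f α u) u := by
  refine hasFDerivAt_pi'.2 fun α => (hd α).hasFDerivAt.congr_fderiv ?_
  ext h
  rw [fderiv_eq_sum_partialD]
  simp only [ContinuousLinearMap.comp_apply, ContinuousLinearMap.flip_apply, systemForm_apply,
    ContinuousLinearMap.proj_apply, sum_apply, Finset.sum_apply, smul_apply, Pi.smul_apply,
    tupleCLM_apply, hf]

/-- **Frobenius theorem** for linear systems `∂_i f_α = ∑ β, a_{iαβ} f_β` on a simply connected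
open set: under the compatibility conditions there is a solution with given initial value. -/
theorem exists_linear_system_solution [CompleteSpace V] (hU : IsOpen U)
    (hsc : IsSimplyConnected U) (ha : ∀ i α β, ContDiffOn ℝ ∞ (a i α β) U)
    (hcompat : ∀ u ∈ U, ∀ i k α β,
      partialD k (a i α β) u + ∑ γ, a i α γ u * a k γ β u
        = partialD i (a k α β) u + ∑ γ, a k α γ u * a i γ β u)
    {p : Fin N → ℝ} (hp : p ∈ U) (w : ι → V) :
    ∃ f : ι → (Fin N → ℝ) → V, (∀ α, ContDiffOn ℝ ∞ (f α) U) ∧ (∀ α, f α p = w α) ∧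
      ∀ u ∈ U, ∀ i α, partialD i (f α) u = ∑ β, a i α β u • f β u := by
  obtain ⟨F, hFp, hF⟩ := exists_global_flat_solution (W := ι → V) hU hsc (contDiffOn_systemForm ha)
    (fun x hx h k => systemForm_flat hU ha hcompat hx h k) hp w
  refine ⟨fun α x => F x α,
    contDiffOn_pi.1 (contDiffOn_of_hasFDerivAt_flip hU (contDiffOn_systemForm ha) hF),
    fun α => congrFun hFp α, fun u hu i α => ?_⟩
  rw [partialD_eq_of_hasFDerivAt (hasFDerivAt_pi'.1 (hF u hu) α)]
  simp [systemForm_apply, tupleCLM_apply, Pi.single_apply, ite_smul]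

/-- Two solutions of a linear system on a domain which agree at one point are equal. -/
theorem linear_system_unique (hU : IsOpen U) (hc : IsPreconnected U)
    (ha : ∀ i α β, ContDiffOn ℝ ∞ (a i α β) U) {f g : ι → (Fin N → ℝ) → V}
    (hfd : ∀ α, ContDiffOn ℝ ∞ (f α) U) (hgd : ∀ α, ContDiffOn ℝ ∞ (g α) U)
    (hf : ∀ u ∈ U, ∀ i α, partialD i (f α) u = ∑ β, a i α β u • f β u)
    (hg : ∀ u ∈ U, ∀ i α, partialD i (g α) u = ∑ β, a i α β u • g β u)
    {p : Fin N → ℝ} (hp : p ∈ U) (h : ∀ α, f α p = g α p) {u : Fin N → ℝ} (hu : u ∈ U) (α : ι) :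
    f α u = g α u :=
  congrFun (eqOn_of_hasFDerivAt_flip hU hc (contDiffOn_systemForm (V := V) ha).continuousOn
    (fun x hx => hasFDerivAt_systemForm (fun α => (hfd α).diffAt hU hx) (hf x hx))
    (fun x hx => hasFDerivAt_systemForm (fun α => (hgd α).diffAt hU hx) (hg x hx)) hp
    (funext h) hu) α

end linear_system

/-! ### The Gauss–Weingarten equations -/

section frames

variable {N L m : ℕ} (q : ℕ)

/-- Vectors with a nondegenerate Gram matrix are linearly independent. -/
theorem linearIndependent_of_gram_det_ne_zero {ι : Type*} [Fintype ι] [DecidableEq ι]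
    {v : ι → Fin m → ℝ} (h : (Matrix.of fun α β => psInner q (v α) (v β)).det ≠ 0) :
    LinearIndependent ℝ v := by
  rw [Fintype.linearIndependent_iff]
  intro c hc
  refine congrFun (Matrix.eq_zero_of_vecMul_eq_zero h ?_)
  funext β
  have : psInner q (∑ α, c α • v α) (v β) = 0 := by rw [hc, psInner_zero_left]
  rw [psInner_sum_left] at this
  simpa [Matrix.vecMul, dotProduct, psInner_smul_left] using this

/-- The Gram matrix of a basis is nondegenerate. -/
theorem gram_det_ne_zero_of_linearIndependent {ι : Type*} [Fintype ι] [DecidableEq ι]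
    {v : ι → Fin m → ℝ} (h : LinearIndependent ℝ v) (hcard : Fintype.card ι = m) :
    (Matrix.of fun α β => psInner q (v α) (v β)).det ≠ 0 := by
  have hspan : ⊤ ≤ Submodule.span ℝ (Set.range v) :=
    (h.span_eq_top_of_card_eq_finrank' (by simpa using hcard)).ge
  intro hdet
  obtain ⟨c, hc0, hc⟩ := Matrix.exists_vecMul_eq_zero_iff.2 hdet
  refine hc0 (funext (Fintype.linearIndependent_iff.1 h c ?_))
  refine eq_zero_of_psInner_eq_zero q fun y => ?_
  obtain ⟨b, rfl⟩ := (Submodule.mem_span_range_iff_exists_fun ℝ).1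
    (hspan (Submodule.mem_top (x := y)))
  rw [psInner_sum_right]
  refine Finset.sum_eq_zero fun β _ => ?_
  have := congrFun hc β
  rw [psInner_smul_right, psInner_sum_left]
  simp only [psInner_smul_left]
  simp only [Matrix.vecMul, dotProduct, Matrix.of_apply, Pi.zero_apply] at this
  rw [this, mul_zero]

variable {t : Fin N → Fin (N + L) → ℝ} {n : Fin L → Fin (N + L) → ℝ}

theorem tangent_coeff_eq_zero (ht : (Matrix.of fun i j => psInner q (t i) (t j)).det ≠ 0)
    (hperp : ∀ a i, psInner q (n a) (t i) = 0) {a : Fin N → ℝ} {b : Fin L → ℝ}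
    (h : ∀ j, psInner q (∑ i, a i • t i + ∑ i, b i • n i) (t j) = 0) : a = 0 := by
  refine Matrix.eq_zero_of_vecMul_eq_zero ht (funext fun j => ?_)
  have := h j
  rw [psInner_add_left, psInner_sum_left, psInner_sum_left] at this
  simpa [Matrix.vecMul, dotProduct, psInner_smul_left, hperp] using this

theorem frame_linearIndependent (ht : (Matrix.of fun i j => psInner q (t i) (t j)).det ≠ 0)
    (hperp : ∀ a i, psInner q (n a) (t i) = 0) (hn : LinearIndependent ℝ n) :
    LinearIndependent ℝ (Sum.elim t n) := by
  rw [Fintype.linearIndependent_iff]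
  intro c hc
  simp only [Fintype.sum_sum_type, Sum.elim_inl, Sum.elim_inr] at hc
  have ha : (fun i => c (Sum.inl i)) = 0 :=
    tangent_coeff_eq_zero q (b := fun i => c (Sum.inr i)) ht hperp
      fun j => by rw [hc, psInner_zero_left]
  have hb : ∑ i, c (Sum.inr i) • n i = 0 := by
    simpa [fun i => congrFun ha i] using hc
  rintro (i | i)
  · exact congrFun ha i
  · exact Fintype.linearIndependent_iff.1 hn _ hb i

theorem exists_frame_coeffs (ht : (Matrix.of fun i j => psInner q (t i) (t j)).det ≠ 0)
    (hperp : ∀ a i, psInner q (n a) (t i) = 0) (hn : LinearIndependent ℝ n)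
    (x : Fin (N + L) → ℝ) : ∃ (a : Fin N → ℝ) (b : Fin L → ℝ),
      x = ∑ i, a i • t i + ∑ i, b i • n i := by
  have h := frame_linearIndependent q ht hperp hn
  have hspan : ⊤ ≤ Submodule.span ℝ (Set.range (Sum.elim t n)) :=
    (h.span_eq_top_of_card_eq_finrank' (by simp)).ge
  obtain ⟨c, rfl⟩ := (Submodule.mem_span_range_iff_exists_fun ℝ).1
    (hspan (Submodule.mem_top (x := x)))
  exact ⟨fun i => c (Sum.inl i), fun i => c (Sum.inr i), by simp [Fintype.sum_sum_type]⟩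

/-- A vector orthogonal to the tangent vectors is a combination of the normal frame. -/
theorem exists_normal_coeffs (ht : (Matrix.of fun i j => psInner q (t i) (t j)).det ≠ 0)
    (hperp : ∀ a i, psInner q (n a) (t i) = 0) (hn : LinearIndependent ℝ n)
    {x : Fin (N + L) → ℝ} (hx : ∀ i, psInner q x (t i) = 0) :
    ∃ b : Fin L → ℝ, x = ∑ i, b i • n i := by
  obtain ⟨a, b, rfl⟩ := exists_frame_coeffs q ht hperp hn x
  have ha := tangent_coeff_eq_zero q ht hperp hx
  exact ⟨b, by simp [ha]⟩

/-- Two vectors with the same scalar products with the vectors of the frame are equal. -/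
theorem eq_of_psInner_frame (ht : (Matrix.of fun i j => psInner q (t i) (t j)).det ≠ 0)
    (hperp : ∀ a i, psInner q (n a) (t i) = 0) (hn : LinearIndependent ℝ n)
    {x y : Fin (N + L) → ℝ} (h1 : ∀ i, psInner q x (t i) = psInner q y (t i))
    (h2 : ∀ a, psInner q x (n a) = psInner q y (n a)) : x = y := by
  refine sub_eq_zero.1 (eq_zero_of_psInner_eq_zero q fun z => ?_)
  obtain ⟨a, b, rfl⟩ := exists_frame_coeffs q ht hperp hn z
  rw [psInner_add_right, psInner_sum_right, psInner_sum_right]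
  simp [psInner_smul_right, psInner_sub_left, h1, h2]

theorem normal_gram_det_ne_zero (ht : (Matrix.of fun i j => psInner q (t i) (t j)).det ≠ 0)
    (hperp : ∀ a i, psInner q (n a) (t i) = 0) (hn : LinearIndependent ℝ n) :
    (Matrix.of fun α β => psInner q (n α) (n β)).det ≠ 0 := by
  have h := gram_det_ne_zero_of_linearIndependent q (frame_linearIndependent q ht hperp hn)
    (by simp)
  have hblock : (Matrix.of fun α β => psInner q (Sum.elim t n α) (Sum.elim t n β))
      = Matrix.fromBlocks (Matrix.of fun i j => psInner q (t i) (t j)) 0 0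
        (Matrix.of fun α β => psInner q (n α) (n β)) := by
    ext (i | i) (j | j)
    · simp
    · simp [psInner_comm q (t i) (n j), hperp]
    · simp [hperp]
    · simp
  rw [hblock, Matrix.det_fromBlocks_zero₂₁] at h
  exact right_ne_zero_of_mul h

end frames

section first_form

variable {N m q : ℕ} {U : Set (Fin N → ℝ)} {r : (Fin N → ℝ) → Fin m → ℝ}

theorem firstForm_symm (i j : Fin N) (u : Fin N → ℝ) :
    firstForm q r u i j = firstForm q r u j i := psInner_comm _ _ _

theorem contDiffOn_firstForm (hr : ContDiffOn ℝ ∞ r U) (hU : IsOpen U) (i j : Fin N) :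
    ContDiffOn ℝ ∞ (fun u => firstForm q r u i j) U :=
  contDiffOn_psInner q (hr.partialD hU i) (hr.partialD hU j)

theorem partialD_firstForm (hr : ContDiffOn ℝ ∞ r U) (hU : IsOpen U) {u : Fin N → ℝ}
    (hu : u ∈ U) (k i j : Fin N) :
    partialD k (fun v => firstForm q r v i j) u
      = psInner q (partialD k (partialD i r) u) (partialD j r u)
        + psInner q (partialD i r u) (partialD k (partialD j r) u) :=
  partialD_psInner q ((hr.partialD hU i).diffAt hU hu) ((hr.partialD hU j).diffAt hU hu) k

/-- The scalar products of the second derivatives with the tangent vectors are the Christoffel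
symbols of the first kind. -/
theorem psInner_second_tangent (hr : ContDiffOn ℝ ∞ r U) (hU : IsOpen U) {u : Fin N → ℝ}
    (hu : u ∈ U) (i j l : Fin N) :
    psInner q (partialD i (partialD j r) u) (partialD l r u)
      = (1 / 2 : ℝ) * (partialD i (fun v => firstForm q r v l j) u
        + partialD j (fun v => firstForm q r v i l) u
        - partialD l (fun v => firstForm q r v i j) u) := by
  rw [partialD_firstForm hr hU hu, partialD_firstForm hr hU hu, partialD_firstForm hr hU hu,
    partialD_comm hr hU hu i l, partialD_comm hr hU hu j i, partialD_comm hr hU hu j l,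
    psInner_comm q (partialD l r u), psInner_comm q (partialD i r u)]
  ring

/-- The tangential part of the second derivatives, in terms of the Christoffel symbols. -/
theorem psInner_second_tangent_eq_christoffel (hr : ContDiffOn ℝ ∞ r U) (hU : IsOpen U)
    {u : Fin N → ℝ} (hu : u ∈ U) (hdet : (firstForm q r u).det ≠ 0) (i j l : Fin N) :
    psInner q (partialD i (partialD j r) u) (partialD l r u)
      = ∑ k, christoffel (firstForm q r) k i j u * firstForm q r u k l := by
  have hinv : firstForm q r u * (firstForm q r u)⁻¹ = 1 :=
    Matrix.mul_nonsing_inv _ (isUnit_iff_ne_zero.2 hdet)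
  set w : Fin N → ℝ := fun l => psInner q (partialD i (partialD j r) u) (partialD l r u) with hw
  have hc : ∀ k, christoffel (firstForm q r) k i j u = ((firstForm q r u)⁻¹.mulVec w) k := by
    intro k
    simp only [christoffel, Matrix.mulVec, dotProduct, hw, psInner_second_tangent hr hU hu,
      Finset.mul_sum]
    exact Finset.sum_congr rfl fun l _ => by ring
  have h1 : (firstForm q r u).mulVec ((firstForm q r u)⁻¹.mulVec w) = w := by
    rw [Matrix.mulVec_mulVec, hinv, Matrix.one_mulVec]
  change w l = _
  rw [← congrFun h1 l]
  simp only [Matrix.mulVec, dotProduct] at hc ⊢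
  refine Finset.sum_congr rfl fun k _ => ?_
  rw [hc, mul_comm, firstForm_symm]

theorem christoffel_symm (hU : IsOpen U) {u : Fin N → ℝ}
    (hu : u ∈ U) (k i j : Fin N) :
    christoffel (firstForm q r) k i j u = christoffel (firstForm q r) k j i u := by
  unfold christoffel
  congr 1
  refine Finset.sum_congr rfl fun l _ => ?_
  rw [partialD_congr hU (fun v _ => firstForm_symm (q := q) (r := r) l j v) hu,
    partialD_congr hU (fun v _ => firstForm_symm (q := q) (r := r) i l v) hu,
    partialD_congr hU (fun v _ => firstForm_symm (q := q) (r := r) i j v) hu]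
  ring

variable {g : (Fin N → ℝ) → Matrix (Fin N) (Fin N) ℝ} {η : Matrix (Fin N) (Fin N) ℝ}

theorem christoffel_of_const (hU : IsOpen U) (hg : ∀ u ∈ U, g u = η) {u : Fin N → ℝ}
    (hu : u ∈ U) (k i j : Fin N) : christoffel g k i j u = 0 := by
  have h : ∀ a b c, partialD a (fun v => g v b c) u = 0 := fun a b c => by
    rw [partialD_congr hU (g := fun _ => η b c) (fun v hv => by simp only [hg v hv]) hu,
      partialD_const]
  simp [christoffel, h]

theorem curvature_of_const (hU : IsOpen U) (hg : ∀ u ∈ U, g u = η) {u : Fin N → ℝ}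
    (hu : u ∈ U) (l k i j : Fin N) : curvature g l k i j u = 0 := by
  have h : ∀ a b c d, partialD a (christoffel g b c d) u = 0 := fun a b c d => by
    rw [partialD_congr hU (g := fun _ => (0 : ℝ))
      (fun v hv => christoffel_of_const hU hg hv b c d) hu, partialD_const]
  simp [curvature, h, christoffel_of_const hU hg hu]

theorem covThird_of_const (hU : IsOpen U) (hg : ∀ u ∈ U, g u = η) (Φ : (Fin N → ℝ) → ℝ)
    {u : Fin N → ℝ} (hu : u ∈ U) (i j k : Fin N) :
    covThird g Φ i j k u = third Φ i j k u := by
  have h : Set.EqOn (covHess g Φ j k) (partialD j (partialD k Φ)) U := fun v hv => by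
    simp [covHess, christoffel_of_const hU hg hv]
  simp [covThird, christoffel_of_const hU hg hu, third, partialD_congr hU h hu]

end first_form

section flat_realization

variable {N q : ℕ} {U : Set (Fin N → ℝ)} {η μ : Matrix (Fin N) (Fin N) ℝ}
  {Φ : (Fin N → ℝ) → ℝ} {r : (Fin N → ℝ) → Fin (N + N) → ℝ}
  {n : Fin N → (Fin N → ℝ) → Fin (N + N) → ℝ}

/-- In flat coordinates all covariant conditions reduce to conditions on partial derivatives. -/
theorem isFlatRealization_of (hr : IsSubmanifold q U r) (hfirst : ∀ u ∈ U, firstForm q r u = η)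
    (hΦ : ContDiffOn ℝ ∞ Φ U) (hn : IsNormalFrame q U r n) (hgram : ∀ u ∈ U, gram q n u = μ)
    (htor : ∀ u ∈ U, ∀ i j k, torsion q n i j k u = 0)
    (hsecond : ∀ u ∈ U, ∀ i j k, secondForm q r (n i) j k u = third Φ i j k u) :
    IsFlatRealization q U η μ Φ r n where
  submanifold := hr
  flat _ hu _ _ _ _ := curvature_of_const hr.isOpen hfirst hu _ _ _ _
  torsionless := ⟨n, μ, hn, hgram, htor⟩
  smooth_potential := hΦ
  normalFrame := hn
  parallel u hu i j k := by simp [htor u hu, christoffel_of_const hr.isOpen hfirst hu]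
  second_eq u hu i j k := by rw [hsecond u hu, covThird_of_const hr.isOpen hfirst Φ hu]
  first_eq := hfirst
  gram_eq := hgram
  torsion_eq := htor
  second_eq_third := hsecond

theorem isSymm_of_firstForm_eq {u : Fin N → ℝ} (h : firstForm q r u = η) : η.IsSymm := by
  rw [← h]
  exact Matrix.IsSymm.ext fun i j => psInner_comm _ _ _

theorem isSymm_of_gram_eq {u : Fin N → ℝ} (h : gram q n u = μ) : μ.IsSymm := by
  rw [← h]
  exact Matrix.IsSymm.ext fun i j => psInner_comm _ _ _

namespace IsFlatRealization

variable (H : IsFlatRealization q U η μ Φ r n)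
include H

theorem det_first_ne_zero {u : Fin N → ℝ} (hu : u ∈ U) : η.det ≠ 0 := by
  rw [← H.first_eq u hu]
  exact H.submanifold.nonisotropic u hu

theorem det_gram_ne_zero {u : Fin N → ℝ} (hu : u ∈ U) : μ.det ≠ 0 := by
  rw [← H.gram_eq u hu]
  exact normal_gram_det_ne_zero q (H.submanifold.nonisotropic u hu) (H.normalFrame.normal u hu)
    (H.normalFrame.linearIndependent u hu)

/-- In flat coordinates the second derivatives of `r` are normal. -/
theorem psInner_second_tangent_eq_zero {u : Fin N → ℝ} (hu : u ∈ U) (i j l : Fin N) :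
    psInner q (partialD i (partialD j r) u) (partialD l r u) = 0 := by
  rw [psInner_second_tangent_eq_christoffel H.submanifold.smooth H.submanifold.isOpen hu
    (H.submanifold.nonisotropic u hu)]
  simp [christoffel_of_const H.submanifold.isOpen H.first_eq hu]

/-- The derivatives of the normal frame, by differentiating `(n_a, r_l) = 0`. -/
theorem psInner_deriv_normal_tangent {u : Fin N → ℝ} (hu : u ∈ U) (i a l : Fin N) :
    psInner q (partialD i (n a) u) (partialD l r u) = -third Φ a i l u := by
  have hU := H.submanifold.isOpen
  have h := partialD_psInner q ((H.normalFrame.smooth a).diffAt hU hu)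
    ((H.submanifold.smooth.partialD hU l).diffAt hU hu) i
  rw [partialD_congr hU (g := fun _ => (0 : ℝ)) (fun v hv => H.normalFrame.normal v hv a l) hu,
    partialD_const] at h
  have h2 : psInner q (n a u) (partialD i (partialD l r) u) = third Φ a i l u :=
    H.second_eq_third u hu a i l
  linarith

end IsFlatRealization

/-- The position vector (index `none`), the coordinate tangent vectors (indices `some (inl j)`)
and the normal frame (indices `some (inr a)`), combined into one tuple of vector functions. -/
def gwFrame {m : ℕ} (r : (Fin N → ℝ) → Fin m → ℝ) (n : Fin N → (Fin N → ℝ) → Fin m → ℝ) :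
    Option (Fin N ⊕ Fin N) → (Fin N → ℝ) → Fin m → ℝ
  | none => r
  | some (Sum.inl j) => partialD j r
  | some (Sum.inr a) => n a

/-- The coefficients of the Gauss–Weingarten system of a potential flat torsionless submanifold
in flat coordinates: `∂_i r = r_i`, `∂_i r_j = Φ_{aij} μ^{ab} n_b`,
`∂_i n_a = - Φ_{aik} η^{kl} r_l`. -/
def gwCoeff (η μ : Matrix (Fin N) (Fin N) ℝ) (Φ : (Fin N → ℝ) → ℝ) (i : Fin N) :
    Option (Fin N ⊕ Fin N) → Option (Fin N ⊕ Fin N) → (Fin N → ℝ) → ℝ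
  | none, some (Sum.inl j), _ => if i = j then 1 else 0
  | some (Sum.inl j), some (Sum.inr b), u => ∑ a, third Φ a i j u * μ⁻¹ a b
  | some (Sum.inr a), some (Sum.inl l), u => -∑ k, third Φ a i k u * η⁻¹ k l
  | _, _, _ => 0

theorem contDiffOn_gwCoeff (hU : IsOpen U) (hΦ : ContDiffOn ℝ ∞ Φ U) (i : Fin N)
    (α β : Option (Fin N ⊕ Fin N)) : ContDiffOn ℝ ∞ (gwCoeff η μ Φ i α β) U := by
  have h := fun a b c => contDiffOn_third hΦ hU a b c
  rcases α with _ | _ | α <;> rcases β with _ | _ | β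
  case some.inl.some.inr =>
    exact ContDiffOn.sum fun a _ => (h _ _ _).mul contDiffOn_const
  case some.inr.some.inl =>
    exact (ContDiffOn.sum fun a _ => (h _ _ _).mul contDiffOn_const).neg
  all_goals exact contDiffOn_const

namespace IsFlatRealization

variable (H : IsFlatRealization q U η μ Φ r n)
include H

theorem contDiffOn_gwFrame (α : Option (Fin N ⊕ Fin N)) : ContDiffOn ℝ ∞ (gwFrame r n α) U := by
  rcases α with _ | j | a
  · exact H.submanifold.smooth
  · exact H.submanifold.smooth.partialD H.submanifold.isOpen j
  · exact H.normalFrame.smooth a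

/-- The Gauss–Weingarten equations. -/
theorem partialD_gwFrame {u : Fin N → ℝ} (hu : u ∈ U) (i : Fin N)
    (α : Option (Fin N ⊕ Fin N)) :
    partialD i (gwFrame r n α) u = ∑ β, gwCoeff η μ Φ i α β u • gwFrame r n β u := by
  have hη : η⁻¹ * η = 1 := Matrix.nonsing_inv_mul _ (isUnit_iff_ne_zero.2 (H.det_first_ne_zero hu))
  have hμ : μ⁻¹ * μ = 1 := Matrix.nonsing_inv_mul _ (isUnit_iff_ne_zero.2 (H.det_gram_ne_zero hu))
  have hfirst : ∀ j l, psInner q (partialD j r u) (partialD l r u) = η j l := fun j l =>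
    congrFun (congrFun (H.first_eq u hu) j) l
  have hgram : ∀ a b, psInner q (n a u) (n b u) = μ a b := fun a b =>
    congrFun (congrFun (H.gram_eq u hu) a) b
  have hnormal := H.normalFrame.normal u hu
  have hframe : ∀ {x y : Fin (N + N) → ℝ}, _ → _ → x = y := fun {x y} =>
    eq_of_psInner_frame q (x := x) (y := y) (H.submanifold.nonisotropic u hu) hnormal
      (H.normalFrame.linearIndependent u hu)
  rcases α with _ | j | a
  · simp [gwFrame, gwCoeff, Fintype.sum_option, Fintype.sum_sum_type]
  · simp only [gwFrame, gwCoeff, Fintype.sum_option, Fintype.sum_sum_type, zero_smul,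
      Finset.sum_const_zero, zero_add]
    refine hframe (fun l => ?_) (fun c => ?_)
    · rw [H.psInner_second_tangent_eq_zero hu, psInner_sum_left]
      simp [psInner_smul_left, hnormal]
    · rw [psInner_comm, psInner_sum_left]
      change secondForm q r (n c) i j u = _
      simp only [psInner_smul_left, hgram, Finset.sum_mul, mul_assoc]
      rw [H.second_eq_third u hu, Finset.sum_comm]
      simp only [← Finset.mul_sum, ← Matrix.mul_apply, hμ]
      simp [Matrix.one_apply]
  · simp only [gwFrame, gwCoeff, Fintype.sum_option, Fintype.sum_sum_type, zero_smul,
      Finset.sum_const_zero, zero_add, add_zero]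
    refine hframe (fun l => ?_) (fun c => ?_)
    · rw [H.psInner_deriv_normal_tangent hu, psInner_sum_left]
      simp only [psInner_smul_left, hfirst, neg_mul, Finset.sum_mul, mul_assoc,
        Finset.sum_neg_distrib]
      rw [Finset.sum_comm]
      simp only [← Finset.mul_sum, ← Matrix.mul_apply, hη]
      simp [Matrix.one_apply]
    · rw [psInner_sum_left]
      change torsion q n a c i u = _
      rw [H.torsion_eq u hu]
      have hnormal' : ∀ l, psInner q (partialD l r u) (n c u) = 0 := fun l => by
        rw [psInner_comm, hnormal]
      simp only [psInner_smul_left, hnormal', mul_zero, Finset.sum_const_zero]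

/-- The Ricci equations of the submanifold are the associativity equations. -/
theorem associativity : Associativity η U Φ := by
  have hU := H.submanifold.isOpen
  have hΦ := H.smooth_potential
  intro u hu i j m k
  -- the scalar products of the derivatives of two normal vectors
  have hprod : ∀ a i b j, psInner q (partialD i (n a) u) (partialD j (n b) u)
      = ∑ k, ∑ l, third Φ a i k u * η⁻¹ k l * third Φ b j l u := by
    intro a i b j
    have hw := H.partialD_gwFrame hu i (some (Sum.inr a))
    simp only [gwFrame, gwCoeff, Fintype.sum_option, Fintype.sum_sum_type, zero_smul,
      Finset.sum_const_zero, zero_add, add_zero] at hw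
    rw [hw, psInner_sum_left, Finset.sum_comm]
    refine Finset.sum_congr rfl fun l _ => ?_
    rw [psInner_smul_left, psInner_comm, H.psInner_deriv_normal_tangent hu, neg_mul_neg,
      Finset.sum_mul]
  have hsymm : ∀ a i b j, psInner q (partialD j (partialD i (n a)) u) (n b u)
      = -psInner q (partialD i (n a) u) (partialD j (n b) u) := by
    intro a i b j
    have h := partialD_psInner q (((H.normalFrame.smooth a).partialD hU i).diffAt hU hu)
      ((H.normalFrame.smooth b).diffAt hU hu) j
    have h0 : partialD j (fun v => psInner q (partialD i (n a) v) (n b v)) u = 0 :=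
      (partialD_congr hU (g := fun _ => (0 : ℝ)) (fun v hv => H.torsion_eq v hv a b i) hu j).trans
        (partialD_const _ _ _)
    linarith
  have h1 := hsymm i j k m
  rw [partialD_comm (H.normalFrame.smooth i) hU hu, hsymm i m k j, neg_inj, hprod, hprod] at h1
  have hs : ∀ a b c, third Φ a b c u = third Φ c b a u := fun a b c => by
    rw [third_swap_left hΦ hU hu, third_swap_right hΦ hU hu, third_swap_left hΦ hU hu]
  simp only [hs _ m k, hs _ j k]
  exact h1.symm

end IsFlatRealization
end flat_realization

/-! ### Rigidity and quadratic terms -/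

section motion

variable {N q : ℕ} {U : Set (Fin N → ℝ)} {η μ : Matrix (Fin N) (Fin N) ℝ}
  {Φ : (Fin N → ℝ) → ℝ} {r r' : (Fin N → ℝ) → Fin (N + N) → ℝ}
  {n n' : Fin N → (Fin N → ℝ) → Fin (N + N) → ℝ}

/-- A linear map preserving the Gram matrix of a basis is an isometry. -/
theorem isPsIsometry_of_basis {m : ℕ} {ι : Type*} (b : Module.Basis ι ℝ (Fin m → ℝ))
    {A : (Fin m → ℝ) ≃ₗ[ℝ] (Fin m → ℝ)}
    (h : ∀ α β, psInner q (A (b α)) (A (b β)) = psInner q (b α) (b β)) : IsPsIsometry q A := by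
  have : (psForm q).compl₁₂ (A : (Fin m → ℝ) →ₗ[ℝ] (Fin m → ℝ)) (A : _ →ₗ[ℝ] _) = psForm q :=
    b.ext fun α => b.ext fun β => h α β
  intro x y
  exact LinearMap.congr_fun₂ this x y

/-- Rigidity: both realizations solve the same Gauss–Weingarten system, and the linear map
matching their frames at one point is an isometry. -/
theorem IsFlatRealization.exists_motion (H : IsFlatRealization q U η μ Φ r n)
    (H' : IsFlatRealization q U η μ Φ r' n') :
    ∃ (A : (Fin (N + N) → ℝ) ≃ₗ[ℝ] (Fin (N + N) → ℝ)) (b : Fin (N + N) → ℝ),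
      IsPsIsometry q A ∧ ∀ u ∈ U, r' u = A (r u) + b ∧ ∀ i, n' i u = A (n i u) := by
  obtain ⟨p, hp⟩ := H.submanifold.isConnected.nonempty
  have hU := H.submanifold.isOpen
  have hli := frame_linearIndependent q (H.submanifold.nonisotropic p hp)
    (H.normalFrame.normal p hp) (H.normalFrame.linearIndependent p hp)
  have hli' := frame_linearIndependent q (H'.submanifold.nonisotropic p hp)
    (H'.normalFrame.normal p hp) (H'.normalFrame.linearIndependent p hp)
  set B := basisOfLinearIndependentOfCardEqFinrank' _ hli (by simp) with hB
  set B' := basisOfLinearIndependentOfCardEqFinrank' _ hli' (by simp) with hB'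
  set A := B.equiv B' (Equiv.refl _) with hA
  have hAB : ∀ α, A (B α) = B' α := fun α => by simp [hA]
  have hBv : ∀ α, B α = gwFrame r n (some α) p := by
    rintro (j | a) <;> simp [hB, gwFrame]
  have hBv' : ∀ α, B' α = gwFrame r' n' (some α) p := by
    rintro (j | a) <;> simp [hB', gwFrame]
  have hiso : IsPsIsometry q A := by
    have hfirst : ∀ j l, psInner q (partialD j r p) (partialD l r p)
        = psInner q (partialD j r' p) (partialD l r' p) := fun j l =>
      congrFun (congrFun ((H.first_eq p hp).trans (H'.first_eq p hp).symm) j) l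
    have hgram : ∀ a b, psInner q (n a p) (n b p) = psInner q (n' a p) (n' b p) := fun a b =>
      congrFun (congrFun ((H.gram_eq p hp).trans (H'.gram_eq p hp).symm) a) b
    have h0 := H.normalFrame.normal p hp
    have h0' := H'.normalFrame.normal p hp
    refine isPsIsometry_of_basis B fun α β => ?_
    rw [hAB, hAB, hBv, hBv, hBv', hBv']
    rcases α with j | a <;> rcases β with l | b <;> simp only [gwFrame]
    · exact (hfirst _ _).symm
    · rw [psInner_comm, psInner_comm q _ (n b p), h0, h0']
    · rw [h0, h0']
    · exact (hgram _ _).symm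
  set b := r' p - A (r p) with hb
  let T : (Fin (N + N) → ℝ) →L[ℝ] (Fin (N + N) → ℝ) :=
    LinearMap.toContinuousLinearMap (A : (Fin (N + N) → ℝ) →ₗ[ℝ] (Fin (N + N) → ℝ))
  have hT : ∀ x, T x = A x := fun _ => rfl
  -- the image of the first realization under the motion, as a tuple of vector functions
  let f : Option (Fin N ⊕ Fin N) → (Fin N → ℝ) → Fin (N + N) → ℝ := fun α u =>
    T (gwFrame r n α u) + (if α = none then b else 0)
  have hTs : ∀ α, ContDiffOn ℝ ∞ (fun u => T (gwFrame r n α u)) U := fun α =>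
    T.contDiff.comp_contDiffOn (H.contDiffOn_gwFrame α)
  have hfd : ∀ α, ContDiffOn ℝ ∞ (f α) U := fun α => (hTs α).add contDiffOn_const
  have hf : ∀ u ∈ U, ∀ i α, partialD i (f α) u = ∑ β, gwCoeff η μ Φ i α β u • f β u := by
    intro u hu i α
    rw [partialD_add ((hTs α).diffAt hU hu) (differentiableAt_const _), partialD_const, add_zero,
      partialD_clm_comp T ((H.contDiffOn_gwFrame α).diffAt hU hu), H.partialD_gwFrame hu, map_sum]
    refine Finset.sum_congr rfl fun β _ => ?_
    rcases β with _ | β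
    · rcases α with _ | _ | _ <;> simp [gwCoeff]
    · simp [f]
  have key := fun {u} (hu : u ∈ U) α => linear_system_unique hU
    H.submanifold.isConnected.isPreconnected
    (fun i α β => contDiffOn_gwCoeff hU H.smooth_potential i α β) H'.contDiffOn_gwFrame hfd
    (fun u hu => H'.partialD_gwFrame hu) hf hp (fun α => by
      rcases α with _ | α
      · simp [f, hT, gwFrame, hb]
      · rw [← hBv', ← hAB, hBv]
        simp [f, hT]) hu α
  refine ⟨A, b, hiso, fun u hu => ⟨?_, fun i => ?_⟩⟩
  · simpa [f, hT, gwFrame] using key hu none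
  · simpa [f, hT, gwFrame] using key hu (some (Sum.inr i))

end motion

section quadratic

variable {N : ℕ} {U : Set (Fin N → ℝ)}

theorem partialD_linear (c : Fin N → ℝ) (i : Fin N) (u : Fin N → ℝ) :
    partialD i (fun v : Fin N → ℝ => ∑ j, c j * v j) u = c i := by
  rw [partialD_sum fun j _ => by fun_prop]
  have h : ∀ j, partialD i (fun v : Fin N → ℝ => c j * v j) u = if i = j then c j else 0 :=
    fun j => by
      rw [partialD_const_mul (f := fun v : Fin N → ℝ => v j) (by fun_prop), partialD_coord]
      simp
  simp [h]

theorem partialD_quadratic (a : Matrix (Fin N) (Fin N) ℝ) (k : Fin N) (u : Fin N → ℝ) :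
    partialD k (fun v : Fin N → ℝ => ∑ i, ∑ j, a i j * v i * v j) u
      = ∑ j, (a k j + a j k) * u j := by
  rw [partialD_sum fun j _ => by fun_prop]
  have h : ∀ i, partialD k (fun v : Fin N → ℝ => ∑ j, a i j * v i * v j) u
      = (if k = i then ∑ j, a i j * u j else 0) + a i k * u i := by
    intro i
    rw [partialD_sum fun j _ => by fun_prop]
    have h1 : ∀ j, partialD k (fun v : Fin N → ℝ => a i j * v i * v j) u
        = (if k = i then a i j * u j else 0) + (if k = j then a i j * u i else 0) := by
      intro j
      rw [partialD_mul (f := fun v : Fin N → ℝ => a i j * v i) (by fun_prop) (by fun_prop),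
        partialD_const_mul (f := fun v : Fin N → ℝ => v i) (by fun_prop), partialD_coord,
        partialD_coord]
      split_ifs <;> ring
    simp only [h1, Finset.sum_add_distrib]
    congr 1
    · split_ifs <;> simp
    · simp
  simp only [h, Finset.sum_add_distrib, add_mul]
  simp

theorem third_quadratic (a : Matrix (Fin N) (Fin N) ℝ) (b : Fin N → ℝ) (d : ℝ) (i j k : Fin N)
    (u : Fin N → ℝ) :
    third (fun v : Fin N → ℝ => (∑ i, ∑ j, a i j * v i * v j) + (∑ i, b i * v i) + d) i j k u
      = 0 := by
  have h1 : partialD k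
      (fun v : Fin N → ℝ => (∑ i, ∑ j, a i j * v i * v j) + (∑ i, b i * v i) + d)
      = fun v => ∑ j, (a k j + a j k) * v j + b k := by
    funext v
    rw [partialD_add (by fun_prop) (by fun_prop), partialD_add (by fun_prop) (by fun_prop),
      partialD_const, partialD_linear, partialD_quadratic, add_zero]
  have h2 : partialD j (fun v : Fin N → ℝ => ∑ j, (a k j + a j k) * v j + b k)
      = fun _ => a k j + a j k := by
    funext v
    rw [partialD_add (by fun_prop) (by fun_prop), partialD_const, add_zero,
      partialD_linear (fun j => a k j + a j k)]
  rw [third, h1, h2, partialD_const]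

theorem third_add {Φ Ψ : (Fin N → ℝ) → ℝ} (hU : IsOpen U) (hΦ : ContDiffOn ℝ ∞ Φ U)
    (hΨ : ContDiffOn ℝ ∞ Ψ U) {u : Fin N → ℝ} (hu : u ∈ U) (i j k : Fin N) :
    third (fun v => Φ v + Ψ v) i j k u = third Φ i j k u + third Ψ i j k u := by
  have h1 : Set.EqOn (partialD k fun v => Φ v + Ψ v) (fun v => partialD k Φ v + partialD k Ψ v) U :=
    fun v hv => partialD_add (hΦ.diffAt hU hv) (hΨ.diffAt hU hv) k
  have h2 : Set.EqOn (partialD j (partialD k fun v => Φ v + Ψ v))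
      (fun v => partialD j (partialD k Φ) v + partialD j (partialD k Ψ) v) U := fun v hv =>
    (partialD_congr hU h1 hv j).trans
      (partialD_add ((hΦ.partialD hU k).diffAt hU hv) ((hΨ.partialD hU k).diffAt hU hv) j)
  exact (partialD_congr hU h2 hu i).trans
    (partialD_add (((hΦ.partialD hU k).partialD hU j).diffAt hU hu)
      (((hΨ.partialD hU k).partialD hU j).diffAt hU hu) i)

/-- A function on a domain whose third derivatives vanish is a polynomial of degree at
most two. -/
theorem exists_quadratic_of_third_eq_zero {D : (Fin N → ℝ) → ℝ} (hU : IsOpen U)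
    (hc : IsConnected U) (hD : ContDiffOn ℝ ∞ D U) (h : ∀ u ∈ U, ∀ i j k, third D i j k u = 0) :
    ∃ (a : Matrix (Fin N) (Fin N) ℝ) (b : Fin N → ℝ) (d : ℝ), ∀ u ∈ U,
      D u = (∑ i, ∑ j, a i j * u i * u j) + (∑ i, b i * u i) + d := by
  obtain ⟨p, hp⟩ := hc.nonempty
  set a : Matrix (Fin N) (Fin N) ℝ :=
    Matrix.of fun j k => (1 / 2 : ℝ) * partialD j (partialD k D) p with ha
  have hsymm : ∀ j k, a j k = a k j := fun j k => by
    simp only [ha, Matrix.of_apply]; rw [partialD_comm hD hU hp]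
  have h2 : ∀ u ∈ U, ∀ j k, partialD j (partialD k D) u = a j k + a k j := fun u hu j k => by
    rw [hsymm k j, eq_of_partialD_eq_zero ((hD.partialD hU k).partialD hU j) hU hc.isPreconnected
      (fun v hv i => h v hv i j k) hu hp]
    simp only [ha, Matrix.of_apply]; ring
  set b : Fin N → ℝ := fun k => partialD k D p - ∑ j, (a k j + a j k) * p j with hb
  have h1 : ∀ u ∈ U, ∀ k, partialD k D u = (∑ j, (a k j + a j k) * u j) + b k := by
    intro u hu k
    have hs : ContDiffOn ℝ ∞ (fun v : Fin N → ℝ => ∑ j, (a k j + a j k) * v j) U := by fun_prop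
    have := eq_of_partialD_eq_zero ((hD.partialD hU k).sub hs) hU hc.isPreconnected
      (fun v hv i => by
        refine (partialD_sub ((hD.partialD hU k).diffAt hU hv) (hs.diffAt hU hv) i).trans ?_
        rw [partialD_linear fun j => a k j + a j k, h2 v hv]
        ring) hu hp
    change partialD k D u - ∑ j, (a k j + a j k) * u j
      = partialD k D p - ∑ j, (a k j + a j k) * p j at this
    simp only [hb]
    linarith
  refine ⟨a, b, D p - ((∑ i, ∑ j, a i j * p i * p j) + ∑ i, b i * p i), fun u hu => ?_⟩
  have hs : ContDiffOn ℝ ∞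
      (fun v : Fin N → ℝ => (∑ i, ∑ j, a i j * v i * v j) + ∑ i, b i * v i) U := by fun_prop
  have := eq_of_partialD_eq_zero (hD.sub hs) hU hc.isPreconnected
      (fun v hv i => by
        refine (partialD_sub (hD.diffAt hU hv) (hs.diffAt hU hv) i).trans ?_
        rw [partialD_add (by fun_prop) (by fun_prop), partialD_linear, partialD_quadratic,
          h1 v hv, sub_self]) hu hp
  change D u - ((∑ i, ∑ j, a i j * u i * u j) + ∑ i, b i * u i)
    = D p - ((∑ i, ∑ j, a i j * p i * p j) + ∑ i, b i * p i) at this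
  linarith

/-- The potential enters only through its third derivatives, which are the second fundamental
forms, so it is determined up to polynomials of degree at most two. -/
theorem IsFlatRealization.potential_iff {q : ℕ} {η μ : Matrix (Fin N) (Fin N) ℝ}
    {Φ : (Fin N → ℝ) → ℝ} {r : (Fin N → ℝ) → Fin (N + N) → ℝ}
    {n : Fin N → (Fin N → ℝ) → Fin (N + N) → ℝ} (H : IsFlatRealization q U η μ Φ r n)
    (Φ' : (Fin N → ℝ) → ℝ) : IsFlatRealization q U η μ Φ' r n ↔
      ∃ (a : Matrix (Fin N) (Fin N) ℝ) (b : Fin N → ℝ) (d : ℝ), ∀ u ∈ U,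
        Φ' u = Φ u + (∑ i, ∑ j, a i j * u i * u j) + (∑ i, b i * u i) + d := by
  have hU := H.submanifold.isOpen
  have hΦ := H.smooth_potential
  constructor
  · intro H'
    have hD : ContDiffOn ℝ ∞ (fun u => Φ' u - Φ u) U := H'.smooth_potential.sub hΦ
    obtain ⟨a, b, d, h⟩ := exists_quadratic_of_third_eq_zero hU H.submanifold.isConnected hD
      (fun u hu i j k => by
        have h1 := third_add hU hΦ hD hu i j k
        have h2 : (fun v => Φ v + (Φ' v - Φ v)) = Φ' := by funext v; ring
        rw [h2, ← H.second_eq_third u hu, ← H'.second_eq_third u hu] at h1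
        linarith)
    exact ⟨a, b, d, fun u hu => by linarith [h u hu]⟩
  · rintro ⟨a, b, d, h⟩
    have hQ : ContDiffOn ℝ ∞
        (fun v : Fin N → ℝ => (∑ i, ∑ j, a i j * v i * v j) + (∑ i, b i * v i) + d) U := by
      fun_prop
    have heq : Set.EqOn Φ' (fun v : Fin N → ℝ =>
        Φ v + ((∑ i, ∑ j, a i j * v i * v j) + (∑ i, b i * v i) + d)) U := fun v hv => by
      simp only [h v hv]; ring
    refine isFlatRealization_of H.submanifold H.first_eq ((hΦ.add hQ).congr heq) H.normalFrame
      H.gram_eq H.torsion_eq fun u hu i j k => ?_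
    rw [H.second_eq_third u hu, third_congr hU heq hu, third_add hU hΦ hQ hu, third_quadratic,
      add_zero]

end quadratic

/-! ### Existence of the submanifold -/

section inertia

variable {N : ℕ}

/-- Sylvester normal form: a nondegenerate symmetric matrix is congruent to a diagonal matrix of
signs, with `negIndex η` negative ones. -/
theorem exists_sign_diagonalization {η : Matrix (Fin N) (Fin N) ℝ} (hs : η.IsSymm)
    (hd : η.det ≠ 0) : ∃ (P : Matrix (Fin N) (Fin N) ℝ) (s : Fin N → ℝ),
      (∀ k, s k = 1 ∨ s k = -1) ∧ Fintype.card {k // s k = -1} = negIndex η ∧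
      ∀ α β, η α β = ∑ k, s k * (P k α * P k β) := by
  have hA : η.IsHermitian := by
    rw [Matrix.IsHermitian, Matrix.conjTranspose_eq_transpose_of_trivial]; exact hs
  set e := hA.eigenvalues with he
  have he0 : ∀ k, e k ≠ 0 := by
    intro k hk
    refine hd ?_
    rw [hA.det_eq_prod_eigenvalues]
    exact Finset.prod_eq_zero (Finset.mem_univ k) (by simpa using hk)
  set Q : Matrix (Fin N) (Fin N) ℝ := (hA.eigenvectorUnitary : Matrix (Fin N) (Fin N) ℝ) with hQ
  refine ⟨Matrix.of fun k α => √|e k| * Q α k, fun k => if e k < 0 then -1 else 1,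
    fun k => ?_, ?_, fun α β => ?_⟩
  · dsimp only
    split_ifs <;> simp
  · rw [negIndex, hA.roots_charpoly_eq_eigenvalues, Multiset.countP_map, Fintype.card_subtype]
    rw [Finset.card_def, Finset.filter_val]
    congr 1
    refine Multiset.filter_congr fun k _ => ?_
    change (if e k < 0 then (-1 : ℝ) else 1) = -1 ↔ e k < 0
    split_ifs with h <;> simp [h]
    norm_num
  · have hsp := congrFun (congrFun hA.spectral_theorem α) β
    rw [hsp]
    simp only [Unitary.conjStarAlgAut_apply, Matrix.mul_apply, Matrix.diagonal_apply, mul_ite,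
      mul_zero, Finset.sum_ite_eq', Finset.mem_univ, if_true, Matrix.star_apply, Function.comp,
      Matrix.of_apply]
    refine Finset.sum_congr rfl fun k _ => ?_
    have h1 : √|e k| * √|e k| = |e k| := Real.mul_self_sqrt (abs_nonneg _)
    have h2 : (if e k < 0 then (-1 : ℝ) else 1) * |e k| = e k := by
      split_ifs with h
      · rw [abs_of_neg h]; ring
      · rw [abs_of_nonneg (not_lt.1 h)]; ring
    calc _ = Q α k * e k * Q β k := by simp [hQ, he]
      _ = Q α k * ((if e k < 0 then (-1 : ℝ) else 1) * (√|e k| * √|e k|)) * Q β k := by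
        rw [h1, h2]
      _ = _ := by ring

/-- An enumeration of a finite type which lists the elements with a given property first. -/
theorem exists_equiv_lt_iff {ι : Type*} [Fintype ι] {m q : ℕ} (hι : Fintype.card ι = m)
    (p : ι → Prop) [DecidablePred p] (hp : Fintype.card {i // p i} = q) :
    ∃ σ : ι ≃ Fin m, ∀ i, (σ i : ℕ) < q ↔ p i := by
  classical
  have hqm : q ≤ m := by rw [← hp, ← hι]; exact Fintype.card_subtype_le p
  let σ₀ : ι ≃ Fin m := Fintype.equivFinOfCardEq hι
  have hcard : Fintype.card {j : Fin m // p (σ₀.symm j)}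
      = Fintype.card {j : Fin m // (j : ℕ) < q} := by
    rw [← Fintype.card_congr (σ₀.subtypeEquiv (p := p) fun i => by simp), hp]
    rw [Fintype.card_subtype, Fin.card_filter_val_lt, min_eq_right hqm]
  let e := Fintype.equivOfCardEq hcard
  refine ⟨σ₀.trans e.extendSubtype, fun i => ⟨fun h => ?_, fun h => ?_⟩⟩
  · by_contra hi
    exact e.extendSubtype_not_mem (σ₀ i) (by simpa using hi) h
  · exact e.extendSubtype_mem (σ₀ i) (by simpa using h)

/-- In the pseudo-Euclidean space of the appropriate index there is a basis whose Gram matrix is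
the orthogonal sum of two given nondegenerate symmetric matrices. -/
theorem exists_vectors_gram_fromBlocks {η μ : Matrix (Fin N) (Fin N) ℝ} (hη : η.IsSymm)
    (hη0 : η.det ≠ 0) (hμ : μ.IsSymm) (hμ0 : μ.det ≠ 0) :
    ∃ v : Fin N ⊕ Fin N → Fin (N + N) → ℝ, ∀ α β,
      psInner (negIndex η + negIndex μ) (v α) (v β) = Matrix.fromBlocks η 0 0 μ α β := by
  obtain ⟨P, s, hs, hcard, hP⟩ := exists_sign_diagonalization hη hη0
  obtain ⟨P', s', hs', hcard', hP'⟩ := exists_sign_diagonalization hμ hμ0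
  obtain ⟨σ, hσ⟩ := exists_equiv_lt_iff (ι := Fin N ⊕ Fin N) (m := N + N)
    (q := negIndex η + negIndex μ) (by simp) (fun i => Sum.elim s s' i = -1) (by
      rw [← hcard, ← hcard', ← Fintype.card_sum]
      exact Fintype.card_congr (Equiv.subtypeSum ..))
  have hsgn : ∀ i, (if (σ i : ℕ) < negIndex η + negIndex μ then (-1 : ℝ) else 1)
      = Sum.elim s s' i := by
    intro i
    rw [if_congr (hσ i) rfl rfl]
    rcases i with k | k
    · rcases hs k with h | h <;> simp [h]; norm_num
    · rcases hs' k with h | h <;> simp [h]; norm_num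
  refine ⟨fun α m => Matrix.fromBlocks P 0 0 P' (σ.symm m) α, fun α β => ?_⟩
  rw [psInner, ← σ.sum_comp]
  simp only [hsgn, Equiv.symm_apply_apply, Fintype.sum_sum_type]
  rcases α with i | i <;> rcases β with j | j <;> simp [hP, hP']

end inertia

section existence

variable {N : ℕ} {U : Set (Fin N → ℝ)} {η μ : Matrix (Fin N) (Fin N) ℝ} {Φ : (Fin N → ℝ) → ℝ}

/-- The coefficient matrices `a_i` of the Gauss–Weingarten system satisfy `∂_k a_i = ∂_i a_k`,
because fourth derivatives of `Φ` are symmetric. The integrability conditions thus reduce to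
`a_i a_k = a_k a_i`. -/
theorem partialD_gwCoeff (hU : IsOpen U) (hΦ : ContDiffOn ℝ ∞ Φ U) {u : Fin N → ℝ} (hu : u ∈ U)
    (i k : Fin N) (α β : Option (Fin N ⊕ Fin N)) :
    partialD k (gwCoeff η μ Φ i α β) u = partialD i (gwCoeff η μ Φ k α β) u := by
  have hd := fun a b c => (contDiffOn_third hΦ hU a b c).diffAt hU hu
  have hswap : ∀ a j, partialD k (third Φ a i j) u = partialD i (third Φ a k j) u := by
    intro a j
    rw [partialD_congr hU (fun v hv => third_swap_left hΦ hU hv a i j) hu,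
      partialD_congr hU (fun v hv => third_swap_left hΦ hU hv a k j) hu,
      partialD_third_comm hΦ hU hu]
  rcases α with _ | j | a <;> rcases β with _ | l | b
  case some.inl.some.inr =>
    change partialD k (fun u => ∑ a, third Φ a i j u * μ⁻¹ a b) u
      = partialD i (fun u => ∑ a, third Φ a k j u * μ⁻¹ a b) u
    rw [partialD_sum fun a _ => (hd _ _ _).mul_const _,
      partialD_sum fun a _ => (hd _ _ _).mul_const _]
    refine Finset.sum_congr rfl fun a _ => ?_
    exact (partialD_smul_const (hd _ _ _) _ _).trans ((congrArg (· • _) (hswap a j)).trans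
      (partialD_smul_const (hd _ _ _) _ _).symm)
  case some.inr.some.inl =>
    have hneg : ∀ i, gwCoeff η μ Φ i (some (Sum.inr a)) (some (Sum.inl l))
        = fun u => ∑ k, third Φ a i k u * -η⁻¹ k l := fun i => by
      funext u
      simp [gwCoeff]
    rw [hneg, hneg, partialD_sum fun a _ => (hd _ _ _).mul_const _,
      partialD_sum fun a _ => (hd _ _ _).mul_const _]
    refine Finset.sum_congr rfl fun c _ => ?_
    exact (partialD_smul_const (hd _ _ _) _ _).trans ((congrArg (· • _) (hswap a c)).trans
      (partialD_smul_const (hd _ _ _) _ _).symm)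
  all_goals exact (partialD_const _ _ _).trans (partialD_const _ _ _).symm

theorem third_rotate (hU : IsOpen U) (hΦ : ContDiffOn ℝ ∞ Φ U) {u : Fin N → ℝ} (hu : u ∈ U)
    (a b c : Fin N) : third Φ a b c u = third Φ b c a u := by
  rw [third_swap_left hΦ hU hu, third_swap_right hΦ hU hu]

/-- The integrability conditions of the Gauss–Weingarten system with proportional `η` and `μ` are
the associativity equations. -/
theorem gwCoeff_compat {c : ℝ} (hc : c ≠ 0) (hη0 : η.det ≠ 0) (hU : IsOpen U)
    (hΦ : ContDiffOn ℝ ∞ Φ U) (hass : Associativity η U Φ) {u : Fin N → ℝ} (hu : u ∈ U)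
    (i k : Fin N) (α β : Option (Fin N ⊕ Fin N)) :
    partialD k (gwCoeff η (c⁻¹ • η) Φ i α β) u
        + ∑ γ, gwCoeff η (c⁻¹ • η) Φ i α γ u * gwCoeff η (c⁻¹ • η) Φ k γ β u
      = partialD i (gwCoeff η (c⁻¹ • η) Φ k α β) u
        + ∑ γ, gwCoeff η (c⁻¹ • η) Φ k α γ u * gwCoeff η (c⁻¹ • η) Φ i γ β u := by
  have hinv : (c⁻¹ • η)⁻¹ = c • η⁻¹ := by
    have := Matrix.inv_smul' (A := η) (Units.mk0 c⁻¹ (inv_ne_zero hc)) (isUnit_iff_ne_zero.2 hη0)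
    simpa [Units.smul_def] using this
  have hrot := third_rotate hU hΦ hu
  have hr := third_swap_right hΦ hU hu
  rw [partialD_gwCoeff hU hΦ hu]
  congr 1
  -- with `A_i = (Φ_{iab} η^{bc})`, the products of coefficients are multiples of `A_i A_k`
  set A : Fin N → Fin N → Fin N → ℝ := fun i j b => ∑ a, third Φ a i j u * η⁻¹ a b with hA
  have hAA : ∀ i k j m, ∑ b, A i j b * A k b m = ∑ b, A k j b * A i b m := by
    intro i k j m
    have h1 : ∀ i k, ∑ b, A i j b * A k b m
        = ∑ d, (∑ a, ∑ b, third Φ j i a u * η⁻¹ a b * third Φ b k d u) * η⁻¹ d m := by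
      intro i k
      simp only [hA, Finset.sum_mul_sum]
      simp only [Finset.sum_mul]
      rw [Finset.sum_congr rfl fun b _ => Finset.sum_comm, Finset.sum_comm]
      refine Finset.sum_congr rfl fun d _ => ?_
      rw [Finset.sum_comm]
      refine Finset.sum_congr rfl fun a _ => Finset.sum_congr rfl fun b _ => ?_
      rw [hrot a i j, hrot i j a, hr j a i, hrot d k b, hrot k b d, hr b d k]
      ring
    rw [h1, h1]
    refine Finset.sum_congr rfl fun d _ => ?_
    rw [hass u hu]
  have hAs : ∀ i k b, A i k b = A k i b := fun i k b => by
    simp only [hA]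
    exact Finset.sum_congr rfl fun a _ => by rw [hr]
  have e1 : ∀ i j b, gwCoeff η (c⁻¹ • η) Φ i (some (Sum.inl j)) (some (Sum.inr b)) u
      = c * A i j b := fun i j b => by
    simp only [gwCoeff, hinv, hA, Finset.mul_sum, Matrix.smul_apply, smul_eq_mul]
    exact Finset.sum_congr rfl fun a _ => by ring
  have e2 : ∀ i a l, gwCoeff η (c⁻¹ • η) Φ i (some (Sum.inr a)) (some (Sum.inl l)) u
      = -A i a l := fun i a l => by
    simp only [gwCoeff, hA]
    exact congrArg _ (Finset.sum_congr rfl fun k _ => by rw [hrot a i k, hrot i k a, hr])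
  have e0 : ∀ i j, gwCoeff η (c⁻¹ • η) Φ i none (some (Sum.inl j)) u = if i = j then 1 else 0 :=
    fun _ _ => rfl
  have z1 : ∀ i α, gwCoeff η (c⁻¹ • η) Φ i α none u = 0 := by
    rintro i (_ | _ | _) <;> rfl
  have z2 : ∀ i b, gwCoeff η (c⁻¹ • η) Φ i none (some (Sum.inr b)) u = 0 := fun _ _ => rfl
  have z3 : ∀ i j l, gwCoeff η (c⁻¹ • η) Φ i (some (Sum.inl j)) (some (Sum.inl l)) u = 0 :=
    fun _ _ _ => rfl
  have z4 : ∀ i j l, gwCoeff η (c⁻¹ • η) Φ i (some (Sum.inr j)) (some (Sum.inr l)) u = 0 :=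
    fun _ _ _ => rfl
  have hf : ∀ f g : Fin N → ℝ, ∑ b, c * f b * -g b = -c * ∑ b, f b * g b := fun f g => by
    rw [Finset.mul_sum]; exact Finset.sum_congr rfl fun b _ => by ring
  have hf' : ∀ f g : Fin N → ℝ, ∑ b, -f b * (c * g b) = -c * ∑ b, f b * g b := fun f g => by
    rw [Finset.mul_sum]; exact Finset.sum_congr rfl fun b _ => by ring
  rcases α with _ | j | a <;> rcases β with _ | l | b <;>
    simp only [Fintype.sum_option, Fintype.sum_sum_type, e0, e1, e2, z1, z2, z3, z4, mul_zero,
      zero_mul, Finset.sum_const_zero, add_zero, zero_add, ite_mul, one_mul,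
      Finset.sum_ite_eq, Finset.mem_univ, if_true, hf, hf']
  · rw [hAs]
  · rw [hAA]
  · rw [hAA]

/-- A solution of the Gauss–Weingarten system whose Gram matrix is the orthogonal sum of `η` and
`μ` at one point has this Gram matrix everywhere. -/
theorem gram_gwSystem {q : ℕ} (hη : η.IsSymm) (hη0 : η.det ≠ 0) (hμ : μ.IsSymm) (hμ0 : μ.det ≠ 0)
    (hU : IsOpen U) (hc : IsPreconnected U) (hΦ : ContDiffOn ℝ ∞ Φ U) {m : ℕ}
    {f : Option (Fin N ⊕ Fin N) → (Fin N → ℝ) → Fin m → ℝ}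
    (hfs : ∀ α, ContDiffOn ℝ ∞ (f α) U)
    (hf : ∀ u ∈ U, ∀ i α, partialD i (f α) u = ∑ β, gwCoeff η μ Φ i α β u • f β u)
    {p : Fin N → ℝ} (hp : p ∈ U) (h0 : ∀ α β, psInner q (f (some α) p) (f (some β) p)
      = Matrix.fromBlocks η 0 0 μ α β) {u : Fin N → ℝ} (hu : u ∈ U) (α β : Fin N ⊕ Fin N) :
    psInner q (f (some α) u) (f (some β) u) = Matrix.fromBlocks η 0 0 μ α β := by
  set G : Matrix (Fin N ⊕ Fin N) (Fin N ⊕ Fin N) ℝ := Matrix.fromBlocks η 0 0 μ with hG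
  have hGs : ∀ α β, G α β = G β α := fun α β =>
    (Matrix.IsSymm.fromBlocks hη (by simp) hμ).apply β α
  set a : Fin N → (Fin N ⊕ Fin N) → (Fin N ⊕ Fin N) → (Fin N → ℝ) → ℝ :=
    fun i α β => gwCoeff η μ Φ i (some α) (some β) with ha
  have has : ∀ i α β, ContDiffOn ℝ ∞ (a i α β) U := fun i α β => contDiffOn_gwCoeff hU hΦ i _ _
  have hη1 : η⁻¹ * η = 1 := Matrix.nonsing_inv_mul _ (isUnit_iff_ne_zero.2 hη0)
  have hμ1 : μ⁻¹ * μ = 1 := Matrix.nonsing_inv_mul _ (isUnit_iff_ne_zero.2 hμ0)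
  -- `G` is a stationary solution of the system satisfied by the Gram matrix
  have hstat : ∀ u ∈ U, ∀ i α β, ∑ γ, a i α γ u * G γ β + ∑ γ, a i β γ u * G α γ = 0 := by
    intro u hu i
    have h1 : ∀ j b, ∑ γ, a i (Sum.inl j) γ u * G γ (Sum.inr b) = third Φ b i j u := by
      intro j b
      simp only [Fintype.sum_sum_type, ha, gwCoeff, hG, Matrix.fromBlocks_apply₁₂,
        Matrix.fromBlocks_apply₂₂, Matrix.zero_apply, mul_zero, Finset.sum_const_zero, zero_add,
        Finset.sum_mul, mul_assoc]
      rw [Finset.sum_comm]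
      simp only [← Finset.mul_sum, ← Matrix.mul_apply, hμ1]
      simp [Matrix.one_apply]
    have h2 : ∀ b j, ∑ γ, a i (Sum.inr b) γ u * G γ (Sum.inl j) = -third Φ b i j u := by
      intro b j
      simp only [Fintype.sum_sum_type, ha, gwCoeff, hG, Matrix.fromBlocks_apply₁₁,
        Matrix.fromBlocks_apply₂₁, Matrix.zero_apply, mul_zero, Finset.sum_const_zero, add_zero,
        neg_mul, Finset.sum_neg_distrib, Finset.sum_mul, mul_assoc]
      rw [Finset.sum_comm]
      simp only [← Finset.mul_sum, ← Matrix.mul_apply, hη1]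
      simp [Matrix.one_apply]
    have h3 : ∀ j l, ∑ γ, a i (Sum.inl j) γ u * G γ (Sum.inl l) = 0 := by
      intro j l
      simp [Fintype.sum_sum_type, ha, gwCoeff, hG]
    have h4 : ∀ j l, ∑ γ, a i (Sum.inr j) γ u * G γ (Sum.inr l) = 0 := by
      intro j l
      simp [Fintype.sum_sum_type, ha, gwCoeff, hG]
    intro α β
    simp only [hGs α]
    rcases α with j | b <;> rcases β with l | d <;> simp only [h1, h2, h3, h4] <;> ring
  -- the difference of the Gram matrix and `G` solves a homogeneous system indexed by pairs
  have hD := linear_system_unique (V := ℝ) hU hc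
    (a := fun i (α β : (Fin N ⊕ Fin N) × (Fin N ⊕ Fin N)) u =>
      (if α.2 = β.2 then a i α.1 β.1 u else 0) + (if α.1 = β.1 then a i α.2 β.2 u else 0))
    (f := fun α u => psInner q (f (some α.1) u) (f (some α.2) u) - G α.1 α.2) (g := fun _ _ => 0)
    (fun i α β => by
      refine ContDiffOn.add ?_ ?_
      · split_ifs
        · exact has _ _ _
        · exact contDiffOn_const
      · split_ifs
        · exact has _ _ _
        · exact contDiffOn_const)
    (fun α => (contDiffOn_psInner q (hfs _) (hfs _)).sub contDiffOn_const)
    (fun α => contDiffOn_const)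
    (fun u hu i α => by
      have hz : ∀ α, gwCoeff η μ Φ i (some α) none u = 0 := by rintro (_ | _) <;> rfl
      rw [partialD_sub (differentiableAt_psInner q ((hfs _).diffAt hU hu) ((hfs _).diffAt hU hu))
        (differentiableAt_const _), partialD_const, sub_zero,
        partialD_psInner q ((hfs _).diffAt hU hu) ((hfs _).diffAt hU hu), hf u hu, hf u hu,
        psInner_sum_left, psInner_sum_right]
      simp only [psInner_smul_left, psInner_smul_right, Fintype.sum_option, hz, zero_mul, zero_add]
      have hs := hstat u hu i α.1 α.2
      simp only [Fintype.sum_prod_type, smul_eq_mul, add_mul, ite_mul, zero_mul,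
        Finset.sum_add_distrib, Finset.sum_ite_eq, Finset.mem_univ, if_true, mul_sub,
        Finset.sum_sub_distrib]
      rw [Finset.sum_comm (f := fun x y => if α.1 = x then _ else _),
        Finset.sum_comm (f := fun x y => if α.1 = x then _ else _)]
      simp only [Finset.sum_ite_eq, Finset.mem_univ, if_true]
      simp only [ha] at hs ⊢
      linarith)
    (fun u hu i α => by simp [partialD_const]) hp (fun α => by simp [h0]) hu (α, β)
  exact sub_eq_zero.1 hD

/-- Every solution of the associativity equations on a simply connected open set is realized by a
potential flat torsionless submanifold. -/
theorem exists_flat_realization {c : ℝ} (hη : η.IsSymm) (hη0 : η.det ≠ 0) (hc : c ≠ 0)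
    (hU : IsOpen U) (hsc : IsSimplyConnected U) (hΦ : ContDiffOn ℝ ∞ Φ U)
    (hass : Associativity η U Φ) :
    ∃ (r : (Fin N → ℝ) → Fin (N + N) → ℝ) (n : Fin N → (Fin N → ℝ) → Fin (N + N) → ℝ),
      IsFlatRealization (negIndex η + negIndex (c⁻¹ • η)) U η (c⁻¹ • η) Φ r n := by
  set q := negIndex η + negIndex (c⁻¹ • η)
  have hμ : (c⁻¹ • η).IsSymm := hη.smul _
  have hμ0 : (c⁻¹ • η).det ≠ 0 := by
    rw [Matrix.det_smul]
    exact mul_ne_zero (pow_ne_zero _ (inv_ne_zero hc)) hη0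
  have hpc : IsPathConnected U := hsc.isPathConnected
  obtain ⟨p, hp⟩ := hsc.nonempty
  obtain ⟨v, hv⟩ := exists_vectors_gram_fromBlocks hη hη0 hμ hμ0
  obtain ⟨f, hfs, hfp, hf⟩ := exists_linear_system_solution hU hsc
    (contDiffOn_gwCoeff (η := η) (μ := c⁻¹ • η) hU hΦ)
    (fun u hu => gwCoeff_compat hc hη0 hU hΦ hass hu) hp (fun α => α.elim 0 v)
  have hgram := fun {u} (hu : u ∈ U) => gram_gwSystem (q := q) hη hη0 hμ hμ0 hU
    hpc.isConnected.isPreconnected hΦ hfs hf hp (fun α β => by rw [hfp, hfp]; exact hv α β) hu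
  set r := f none
  set n := fun a => f (some (Sum.inr a)) with hn
  have hrt : ∀ u ∈ U, ∀ j, partialD j r u = f (some (Sum.inl j)) u := fun u hu j => by
    rw [hf u hu]
    simp [Fintype.sum_option, Fintype.sum_sum_type, gwCoeff]
  have hfirst : ∀ u ∈ U, firstForm q r u = η := fun u hu => by
    ext i j
    rw [firstForm, Matrix.of_apply, hrt u hu, hrt u hu, hgram hu]
    simp
  have hgn : ∀ u ∈ U, gram q n u = c⁻¹ • η := fun u hu => by
    ext i j
    rw [gram, Matrix.of_apply, hgram hu]
    simp
  have hdn : ∀ u ∈ U, ∀ i a, partialD i (n a) u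
      = ∑ l, gwCoeff η (c⁻¹ • η) Φ i (some (Sum.inr a)) (some (Sum.inl l)) u
        • f (some (Sum.inl l)) u := fun u hu i a => by
    rw [hf u hu]
    simp [Fintype.sum_option, Fintype.sum_sum_type, gwCoeff]
  have hdt : ∀ u ∈ U, ∀ i j, partialD i (partialD j r) u
      = ∑ b, gwCoeff η (c⁻¹ • η) Φ i (some (Sum.inl j)) (some (Sum.inr b)) u • n b u :=
    fun u hu i j => by
    rw [partialD_congr hU (fun w hw => hrt w hw j) hu, hf u hu]
    simp [Fintype.sum_option, Fintype.sum_sum_type, gwCoeff, hn]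
  have hindep : ∀ u ∈ U,
      (Matrix.of fun i j => psInner q (partialD i r u) (partialD j r u)).det ≠ 0 := fun u hu => by
    have := hfirst u hu
    rw [firstForm] at this
    rwa [this]
  refine ⟨r, n, isFlatRealization_of ⟨hU, hpc.isConnected, hfs _,
    fun u hu => linearIndependent_of_gram_det_ne_zero q (hindep u hu), hindep⟩ hfirst hΦ
    ⟨fun a => hfs _, fun u hu a i => ?_, fun u hu => ?_⟩ hgn (fun u hu i j k => ?_)
    fun u hu i j k => ?_⟩
  · rw [hrt u hu, hgram hu]
    simp
  · refine linearIndependent_of_gram_det_ne_zero q ?_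
    have := hgn u hu
    rw [gram] at this
    rwa [this]
  · rw [torsion, hdn u hu, psInner_sum_left]
    refine Finset.sum_eq_zero fun l _ => ?_
    rw [psInner_smul_left, hgram hu]
    simp
  · rw [secondForm, hdt u hu, psInner_comm, psInner_sum_left]
    have hμ1 : (c⁻¹ • η)⁻¹ * (c⁻¹ • η) = 1 :=
      Matrix.nonsing_inv_mul _ (isUnit_iff_ne_zero.2 hμ0)
    have hg : ∀ a b, psInner q (n a u) (n b u) = (c⁻¹ • η) a b := fun a b =>
      congrFun (congrFun (hgn u hu) a) b
    simp only [psInner_smul_left, hg, gwCoeff, Finset.sum_mul, mul_assoc]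
    rw [Finset.sum_comm]
    simp only [← Finset.mul_sum, ← Matrix.mul_apply, hμ1]
    simp [Matrix.one_apply]

end existence

/-! ### Coordinate changes -/

section composition

variable {N : ℕ} {F : Type*} [NormedAddCommGroup F] [NormedSpace ℝ F]
  {U W : Set (Fin N → ℝ)} {φ : (Fin N → ℝ) → Fin N → ℝ} {f : (Fin N → ℝ) → F}

theorem contDiffOn_partialD_apply (hW : IsOpen W) (hφ : ContDiffOn ℝ ∞ φ W) (a i : Fin N) :
    ContDiffOn ℝ ∞ (fun z => partialD a φ z i) W :=
  contDiffOn_pi.1 (hφ.partialD hW a) i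

theorem partialD_partialD_apply (hW : IsOpen W) (hφ : ContDiffOn ℝ ∞ φ W) {y : Fin N → ℝ}
    (hy : y ∈ W) (a b i : Fin N) :
    partialD a (fun z => partialD b φ z i) y = partialD a (partialD b φ) y i :=
  (partialD_apply ((hφ.partialD hW b).diffAt hW hy) a i).symm

theorem partialD_comp_of_mapsTo (hU : IsOpen U) (hW : IsOpen W) (hφ : ContDiffOn ℝ ∞ φ W)
    (hm : Set.MapsTo φ W U) (hf : ContDiffOn ℝ ∞ f U) {y : Fin N → ℝ} (hy : y ∈ W) (a : Fin N) :
    partialD a (fun z => f (φ z)) y = ∑ i, partialD a φ y i • partialD i f (φ y) :=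
  partialD_comp (hf.diffAt hU (hm hy)) (hφ.diffAt hW hy) a

/-- The second-order chain rule. -/
theorem partialD_partialD_comp (hU : IsOpen U) (hW : IsOpen W) (hφ : ContDiffOn ℝ ∞ φ W)
    (hm : Set.MapsTo φ W U) (hf : ContDiffOn ℝ ∞ f U) {y : Fin N → ℝ} (hy : y ∈ W)
    (a b : Fin N) :
    partialD a (partialD b (fun z => f (φ z))) y
      = ∑ k, partialD a (partialD b φ) y k • partialD k f (φ y)
        + ∑ i, ∑ j, (partialD a φ y i * partialD b φ y j) • partialD i (partialD j f) (φ y) := by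
  have h1 : ∀ j, DifferentiableAt ℝ (fun z => partialD b φ z j) y := fun j =>
    (contDiffOn_partialD_apply hW hφ b j).diffAt hW hy
  have h2 : ∀ j, DifferentiableAt ℝ (fun z => partialD j f (φ z)) y := fun j =>
    (((hf.partialD hU j).comp hφ hm).diffAt hW hy)
  rw [partialD_congr hW (fun z hz => partialD_comp_of_mapsTo hU hW hφ hm hf hz b) hy,
    partialD_sum fun j _ => (h1 j).fun_smul (h2 j)]
  have h3 : ∀ j, partialD a (fun z => partialD b φ z j • partialD j f (φ z)) y
      = (∑ i, (partialD a φ y i * partialD b φ y j) • partialD i (partialD j f) (φ y))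
        + partialD a (partialD b φ) y j • partialD j f (φ y) := fun j => by
    rw [partialD_smul (h1 j) (h2 j), partialD_partialD_apply hW hφ hy,
      partialD_comp_of_mapsTo hU hW hφ hm (hf.partialD hU j) hy, Finset.smul_sum]
    congr 1
    exact Finset.sum_congr rfl fun i _ => by rw [smul_smul, mul_comm]
  rw [Finset.sum_congr rfl fun j _ => h3 j, Finset.sum_add_distrib, Finset.sum_comm, add_comm]

end composition

section smooth_christoffel

variable {N : ℕ} {U : Set (Fin N → ℝ)}

theorem contDiffOn_det {ι : Type*} [Fintype ι] [DecidableEq ι]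
    {M : (Fin N → ℝ) → Matrix ι ι ℝ} (hM : ∀ i j, ContDiffOn ℝ ∞ (fun u => M u i j) U) :
    ContDiffOn ℝ ∞ (fun u => (M u).det) U := by
  simp only [Matrix.det_apply]
  exact ContDiffOn.sum fun σ _ => (contDiffOn_prod fun i _ => hM _ _).const_smul _

theorem contDiffOn_matrix_inv {ι : Type*} [Fintype ι] [DecidableEq ι]
    {M : (Fin N → ℝ) → Matrix ι ι ℝ} (hM : ∀ i j, ContDiffOn ℝ ∞ (fun u => M u i j) U)
    (hdet : ∀ u ∈ U, (M u).det ≠ 0) (i j : ι) : ContDiffOn ℝ ∞ (fun u => (M u)⁻¹ i j) U := by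
  simp only [Matrix.inv_def, Ring.inverse_eq_inv', Matrix.smul_apply, smul_eq_mul,
    Matrix.adjugate_apply]
  refine ((contDiffOn_det hM).inv hdet).mul (contDiffOn_det fun k l => ?_)
  simp only [Matrix.updateRow_apply]
  split_ifs
  · exact contDiffOn_const
  · exact hM k l

theorem contDiffOn_christoffel (hU : IsOpen U) {g : (Fin N → ℝ) → Matrix (Fin N) (Fin N) ℝ}
    (hg : ∀ i j, ContDiffOn ℝ ∞ (fun u => g u i j) U) (hdet : ∀ u ∈ U, (g u).det ≠ 0)
    (k i j : Fin N) : ContDiffOn ℝ ∞ (christoffel g k i j) U :=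
  contDiffOn_const.mul (ContDiffOn.sum fun l _ => (contDiffOn_matrix_inv hg hdet k l).mul
    ((((hg _ _).partialD hU i).add ((hg _ _).partialD hU j)).sub ((hg _ _).partialD hU l)))

theorem contDiffOn_covHess (hU : IsOpen U) {g : (Fin N → ℝ) → Matrix (Fin N) (Fin N) ℝ}
    (hg : ∀ i j, ContDiffOn ℝ ∞ (fun u => g u i j) U) (hdet : ∀ u ∈ U, (g u).det ≠ 0)
    {Φ : (Fin N → ℝ) → ℝ} (hΦ : ContDiffOn ℝ ∞ Φ U) (j k : Fin N) :
    ContDiffOn ℝ ∞ (covHess g Φ j k) U :=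
  ((hΦ.partialD hU k).partialD hU j).sub (ContDiffOn.sum fun l _ =>
    (contDiffOn_christoffel hU hg hdet l j k).mul (hΦ.partialD hU l))

end smooth_christoffel

section flat_coordinates

variable {N : ℕ} {U W : Set (Fin N → ℝ)} {φ : (Fin N → ℝ) → Fin N → ℝ}

/-- The transformation law of a connection with Christoffel symbols `Γ` under `u = φ(y)`, when the
symbols vanish in the coordinates `y`: `∂_a ∂_b φ^k = - Γ^k_{ij} ∂_a φ^i ∂_b φ^j`. -/
def FlattensAt (Γ : Fin N → Fin N → Fin N → (Fin N → ℝ) → ℝ)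
    (φ : (Fin N → ℝ) → Fin N → ℝ) (y : Fin N → ℝ) : Prop :=
  ∀ a b k, partialD a (partialD b φ) y k
    = -∑ i, ∑ j, Γ k i j (φ y) * (partialD a φ y i * partialD b φ y j)

/-- In flat coordinates the third covariant derivative becomes the third partial derivative. -/
theorem third_comp_eq_covThird {g : (Fin N → ℝ) → Matrix (Fin N) (Fin N) ℝ} (hU : IsOpen U)
    (hW : IsOpen W) (hφ : ContDiffOn ℝ ∞ φ W) (hm : Set.MapsTo φ W U)
    (hg : ∀ i j, ContDiffOn ℝ ∞ (fun u => g u i j) U) (hdet : ∀ u ∈ U, (g u).det ≠ 0)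
    (hflat : ∀ y ∈ W, FlattensAt (christoffel g) φ y) {Φ : (Fin N → ℝ) → ℝ}
    (hΦ : ContDiffOn ℝ ∞ Φ U) {y : Fin N → ℝ} (hy : y ∈ W) (a b c : Fin N) :
    third (fun z => Φ (φ z)) a b c y = ∑ i, ∑ j, ∑ k,
      (partialD a φ y i * partialD b φ y j * partialD c φ y k) * covThird g Φ i j k (φ y) := by
  have hess : Set.EqOn (partialD b (partialD c fun z => Φ (φ z)))
      (fun z => ∑ j, ∑ k, (partialD b φ z j * partialD c φ z k) * covHess g Φ j k (φ z)) W := by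
    intro z hz
    rw [partialD_partialD_comp hU hW hφ hm hΦ hz]
    simp only [hflat z hz b c, smul_eq_mul, covHess, mul_sub, Finset.sum_sub_distrib, neg_mul,
      Finset.sum_neg_distrib, Finset.sum_mul, Finset.mul_sum]
    rw [sub_eq_neg_add]
    congr 2
    rw [Finset.sum_comm]
    refine Finset.sum_congr rfl fun j _ => ?_
    rw [Finset.sum_comm]
    refine Finset.sum_congr rfl fun k _ => Finset.sum_congr rfl fun l _ => ?_
    ring
  have h1 : ∀ b j, DifferentiableAt ℝ (fun z => partialD b φ z j) y := fun b j =>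
    (contDiffOn_partialD_apply hW hφ b j).diffAt hW hy
  have hH := fun j k => contDiffOn_covHess hU hg hdet hΦ j k
  have h2 : ∀ j k, DifferentiableAt ℝ (fun z => covHess g Φ j k (φ z)) y := fun j k =>
    ((hH j k).comp hφ hm).diffAt hW hy
  rw [third, partialD_congr hW hess hy,
    partialD_sum fun j _ => DifferentiableAt.fun_sum fun k _ =>
      ((h1 b j).fun_mul (h1 c k)).fun_mul (h2 j k)]
  have h3 : ∀ j, partialD a (fun z => ∑ k, (partialD b φ z j * partialD c φ z k)
        * covHess g Φ j k (φ z)) y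
      = ∑ k, ((partialD b φ y j * partialD c φ y k)
          * (∑ i, partialD a φ y i * partialD i (covHess g Φ j k) (φ y))
        + (partialD b φ y j * partialD a (partialD c φ) y k
          + partialD a (partialD b φ) y j * partialD c φ y k) * covHess g Φ j k (φ y)) := by
    intro j
    rw [partialD_sum fun k _ => ((h1 b j).fun_mul (h1 c k)).fun_mul (h2 j k)]
    refine Finset.sum_congr rfl fun k _ => ?_
    rw [partialD_mul ((h1 b j).fun_mul (h1 c k)) (h2 j k), partialD_mul (h1 b j) (h1 c k),
      partialD_partialD_apply hW hφ hy, partialD_partialD_apply hW hφ hy,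
      partialD_comp_of_mapsTo hU hW hφ hm (hH j k) hy]
    simp only [smul_eq_mul]
  simp only [h3, hflat y hy a b, hflat y hy a c]
  set A := fun i => partialD a φ y i
  set B := fun i => partialD b φ y i
  set C := fun i => partialD c φ y i
  set H := fun j k => covHess g Φ j k (φ y)
  set Γ := fun k i j => christoffel g k i j (φ y)
  change ∑ j, ∑ k, (B j * C k * (∑ i, A i * partialD i (covHess g Φ j k) (φ y))
      + (B j * -(∑ i, ∑ l, Γ k i l * (A i * C l)) + -(∑ i, ∑ l, Γ j i l * (A i * B l)) * C k)
        * H j k)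
    = ∑ i, ∑ j, ∑ k, A i * B j * C k * (partialD i (covHess g Φ j k) (φ y)
      - ∑ l, Γ l i j * H l k - ∑ l, Γ l i k * H j l)
  have e1 : ∑ j, ∑ k, B j * C k * (∑ i, A i * partialD i (covHess g Φ j k) (φ y))
      = ∑ i, ∑ j, ∑ k, A i * B j * C k * partialD i (covHess g Φ j k) (φ y) := by
    simp only [Finset.mul_sum]
    rw [Finset.sum_congr rfl fun j _ => Finset.sum_comm, Finset.sum_comm]
    exact Finset.sum_congr rfl fun i _ => Finset.sum_congr rfl fun j _ =>
      Finset.sum_congr rfl fun k _ => by ring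
  have e2 : ∑ j, ∑ k, (∑ i, ∑ l, Γ j i l * (A i * B l)) * C k * H j k
      = ∑ i, ∑ j, ∑ k, A i * B j * C k * ∑ l, Γ l i j * H l k := by
    simp only [Finset.mul_sum, Finset.sum_mul]
    -- reorder the summation indices from `(j, k, i, l)` to `(i, l, k, j)`
    calc _ = ∑ j, ∑ i, ∑ k, ∑ l, Γ j i l * (A i * B l) * C k * H j k :=
          Finset.sum_congr rfl fun j _ => Finset.sum_comm
      _ = ∑ i, ∑ j, ∑ l, ∑ k, Γ j i l * (A i * B l) * C k * H j k := by
          rw [Finset.sum_comm]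
          exact Finset.sum_congr rfl fun i _ => Finset.sum_congr rfl fun j _ => Finset.sum_comm
      _ = ∑ i, ∑ l, ∑ k, ∑ j, Γ j i l * (A i * B l) * C k * H j k :=
          Finset.sum_congr rfl fun i _ => by
            rw [Finset.sum_comm]
            exact Finset.sum_congr rfl fun l _ => Finset.sum_comm
      _ = _ := Finset.sum_congr rfl fun i _ => Finset.sum_congr rfl fun l _ =>
          Finset.sum_congr rfl fun k _ => Finset.sum_congr rfl fun j _ => by ring
  have e3 : ∑ j, ∑ k, B j * (∑ i, ∑ l, Γ k i l * (A i * C l)) * H j k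
      = ∑ i, ∑ j, ∑ k, A i * B j * C k * ∑ l, Γ l i k * H j l := by
    simp only [Finset.mul_sum, Finset.sum_mul]
    calc _ = ∑ j, ∑ i, ∑ k, ∑ l, B j * (Γ k i l * (A i * C l)) * H j k :=
          Finset.sum_congr rfl fun j _ => Finset.sum_comm
      _ = ∑ i, ∑ j, ∑ l, ∑ k, B j * (Γ k i l * (A i * C l)) * H j k := by
          rw [Finset.sum_comm]
          exact Finset.sum_congr rfl fun i _ => Finset.sum_congr rfl fun j _ => Finset.sum_comm
      _ = _ := Finset.sum_congr rfl fun i _ => Finset.sum_congr rfl fun j _ =>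
          Finset.sum_congr rfl fun l _ => Finset.sum_congr rfl fun k _ => by ring
  simp only [Finset.sum_add_distrib, mul_sub, Finset.sum_sub_distrib, add_mul, mul_neg, neg_mul,
    Finset.sum_neg_distrib]
  rw [e1, e2, e3]
  ring

variable {m q : ℕ} {r : (Fin N → ℝ) → Fin m → ℝ}

/-- The first fundamental form in new coordinates. -/
theorem firstForm_comp (hU : IsOpen U) (hW : IsOpen W) (hφ : ContDiffOn ℝ ∞ φ W)
    (hm : Set.MapsTo φ W U) (hr : ContDiffOn ℝ ∞ r U) {y : Fin N → ℝ} (hy : y ∈ W) :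
    firstForm q (fun z => r (φ z)) y
      = Matrix.of (fun a i => partialD a φ y i) * firstForm q r (φ y)
        * (Matrix.of fun a i => partialD a φ y i).transpose := by
  ext a b
  rw [Matrix.mul_apply, firstForm, Matrix.of_apply, partialD_comp_of_mapsTo hU hW hφ hm hr hy,
    partialD_comp_of_mapsTo hU hW hφ hm hr hy, psInner_sum_right]
  refine Finset.sum_congr rfl fun j _ => ?_
  rw [psInner_smul_right, psInner_sum_left, Matrix.mul_apply, mul_comm]
  simp [psInner_smul_left, firstForm]

/-- The tangential part of the second derivatives in new coordinates measures the failure of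
the coordinates to be flat. -/
theorem psInner_second_comp (hU : IsOpen U) (hW : IsOpen W) (hφ : ContDiffOn ℝ ∞ φ W)
    (hm : Set.MapsTo φ W U) (hr : ContDiffOn ℝ ∞ r U) (hdet : ∀ u ∈ U, (firstForm q r u).det ≠ 0)
    {y : Fin N → ℝ} (hy : y ∈ W) (a b l : Fin N) :
    psInner q (partialD a (partialD b fun z => r (φ z)) y) (partialD l r (φ y))
      = ∑ k, (partialD a (partialD b φ) y k
        + ∑ i, ∑ j, christoffel (firstForm q r) k i j (φ y)
          * (partialD a φ y i * partialD b φ y j)) * firstForm q r (φ y) k l := by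
  rw [partialD_partialD_comp hU hW hφ hm hr hy, psInner_add_left, psInner_sum_left,
    psInner_sum_left]
  simp only [psInner_sum_left, psInner_smul_left, add_mul, Finset.sum_add_distrib,
    psInner_second_tangent_eq_christoffel hr hU (hm hy) (hdet _ (hm hy))]
  congr 1
  simp only [Finset.mul_sum, Finset.sum_mul]
  rw [Finset.sum_congr rfl fun i _ => Finset.sum_comm, Finset.sum_comm]
  exact Finset.sum_congr rfl fun i _ => Finset.sum_congr rfl fun j _ =>
      Finset.sum_congr rfl fun k _ => by ring

/-- If the first fundamental form is constant in the coordinates `y`, its Christoffel symbols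
vanish in these coordinates. -/
theorem IsFlatChart.flattensAt {η : Matrix (Fin N) (Fin N) ℝ} (h : IsFlatChart q U r W φ η)
    (hU : IsOpen U) (hr : ContDiffOn ℝ ∞ r U) (hdet : ∀ u ∈ U, (firstForm q r u).det ≠ 0)
    {y : Fin N → ℝ} (hy : y ∈ W) : FlattensAt (christoffel (firstForm q r)) φ y := by
  intro a b k
  have hR : ContDiffOn ℝ ∞ (fun z => r (φ z)) W := hr.comp h.smooth h.mapsTo
  set J : Matrix (Fin N) (Fin N) ℝ := Matrix.of fun a i => partialD a φ y i with hJ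
  have hJu : IsUnit J := Matrix.linearIndependent_rows_iff_isUnit.1 (h.regular y hy)
  set X : Fin N → ℝ := fun l =>
    psInner q (partialD a (partialD b fun z => r (φ z)) y) (partialD l r (φ y)) with hX
  have hXJ : J.mulVec X = 0 := by
    funext c
    have h0 : psInner q (partialD a (partialD b fun z => r (φ z)) y)
        (partialD c (fun z => r (φ z)) y) = 0 := by
      rw [psInner_second_tangent hR h.isOpen hy]
      have hz : ∀ a b c, partialD a (fun v => firstForm q (fun z => r (φ z)) v b c) y = 0 :=
        fun a b c => by
          rw [partialD_congr h.isOpen (g := fun _ => η b c)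
            (fun v hv => by simp only [h.first_eq v hv]) hy, partialD_const]
      simp [hz]
    rw [partialD_comp_of_mapsTo hU h.isOpen h.smooth h.mapsTo hr hy, psInner_sum_right] at h0
    simpa [Matrix.mulVec, dotProduct, hJ, hX, psInner_smul_right] using h0
  have hX0 : X = 0 := Matrix.eq_zero_of_mulVec_eq_zero
    ((Matrix.isUnit_iff_isUnit_det J).1 hJu).ne_zero hXJ
  have := Matrix.eq_zero_of_vecMul_eq_zero (hdet _ (h.mapsTo hy))
    (v := fun k => partialD a (partialD b φ) y k
        + ∑ i, ∑ j, christoffel (firstForm q r) k i j (φ y)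
          * (partialD a φ y i * partialD b φ y j)) (funext fun l => by
      rw [← hX0, hX]
      exact (psInner_second_comp hU h.isOpen h.smooth h.mapsTo hr hdet hy a b l).symm)
  have := congrFun this k
  simp only [Pi.zero_apply] at this
  linarith

end flat_coordinates

/-! ### Flat coordinates on a potential submanifold -/

section potential

variable {N q : ℕ} {U W : Set (Fin N → ℝ)} {φ : (Fin N → ℝ) → Fin N → ℝ}
  {r : (Fin N → ℝ) → Fin (N + N) → ℝ} {Φ : (Fin N → ℝ) → ℝ}
  {n : Fin N → (Fin N → ℝ) → Fin (N + N) → ℝ} {η : Matrix (Fin N) (Fin N) ℝ}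

theorem gram_pullFrame (y : Fin N → ℝ) :
    gram q (pullFrame φ n) y = Matrix.of (fun a i => partialD a φ y i) * gram q n (φ y)
      * (Matrix.of fun a i => partialD a φ y i).transpose := by
  ext a b
  rw [Matrix.mul_apply, gram, Matrix.of_apply, pullFrame, pullFrame, psInner_sum_right]
  refine Finset.sum_congr rfl fun j _ => ?_
  rw [psInner_smul_right, psInner_sum_left, Matrix.mul_apply, mul_comm]
  simp [psInner_smul_left, gram]

/-- In flat coordinates a frame which is parallel up to its covector index has zero torsion. -/
theorem torsion_pullFrame {Γ : Fin N → Fin N → Fin N → (Fin N → ℝ) → ℝ} (hU : IsOpen U)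
    (hW : IsOpen W) (hφ : ContDiffOn ℝ ∞ φ W) (hm : Set.MapsTo φ W U)
    (hn : ∀ i, ContDiffOn ℝ ∞ (n i) U)
    (hpar : ∀ u ∈ U, ∀ i j k, torsion q n i j k u = ∑ l, Γ l k i u * gram q n u l j)
    {y : Fin N → ℝ} (hy : y ∈ W) (hflat : FlattensAt Γ φ y) (a b c : Fin N) :
    torsion q (pullFrame φ n) a b c y = 0 := by
  have h1 : ∀ i, DifferentiableAt ℝ (fun z => partialD a φ z i) y := fun i =>
    (contDiffOn_partialD_apply hW hφ a i).diffAt hW hy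
  have h2 : ∀ i, DifferentiableAt ℝ (fun z => n i (φ z)) y := fun i =>
    ((hn i).comp hφ hm).diffAt hW hy
  have hd : partialD c (pullFrame φ n a) y
      = ∑ i, (partialD a φ y i • (∑ k, partialD c φ y k • partialD k (n i) (φ y))
        + partialD c (partialD a φ) y i • n i (φ y)) := by
    refine (partialD_sum (fun i _ => (h1 i).fun_smul (h2 i)) c).trans ?_
    refine Finset.sum_congr rfl fun i _ => ?_
    rw [partialD_smul (h1 i) (h2 i), partialD_partialD_apply hW hφ hy,
      partialD_comp_of_mapsTo hU hW hφ hm (hn i) hy]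
  -- the torsion is linear in the second normal field
  suffices h : ∀ j, psInner q (partialD c (pullFrame φ n a) y) (n j (φ y)) = 0 by
    rw [torsion, pullFrame, psInner_sum_right]
    simp [psInner_smul_right, h]
  intro j
  have ht : ∀ k i, psInner q (partialD k (n i) (φ y)) (n j (φ y))
      = ∑ l, Γ l k i (φ y) * gram q n (φ y) l j := fun k i => hpar _ (hm hy) i j k
  have hg : ∀ i, psInner q (n i (φ y)) (n j (φ y)) = gram q n (φ y) i j := fun i => rfl
  rw [hd, psInner_sum_left]
  simp only [psInner_add_left, psInner_smul_left, psInner_sum_left, ht, hg, hflat c a, neg_mul,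
    Finset.sum_add_distrib, Finset.sum_neg_distrib, Finset.mul_sum, Finset.sum_mul]
  rw [add_neg_eq_zero]
  -- both sides are sums over `(i, k, l)`; the right-hand side is indexed by `(l, k, i)`
  calc _ = ∑ i, ∑ l, ∑ k, partialD a φ y i * (partialD c φ y k
          * (Γ l k i (φ y) * gram q n (φ y) l j)) :=
        Finset.sum_congr rfl fun i _ => Finset.sum_comm
    _ = ∑ l, ∑ i, ∑ k, partialD a φ y i * (partialD c φ y k
          * (Γ l k i (φ y) * gram q n (φ y) l j)) := Finset.sum_comm
    _ = ∑ l, ∑ k, ∑ i, partialD a φ y i * (partialD c φ y k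
          * (Γ l k i (φ y) * gram q n (φ y) l j)) :=
        Finset.sum_congr rfl fun l _ => Finset.sum_comm
    _ = _ := Finset.sum_congr rfl fun l _ => Finset.sum_congr rfl fun k _ =>
        Finset.sum_congr rfl fun i _ => by ring

namespace IsPotentialFlatTorsionless

variable (H : IsPotentialFlatTorsionless q U r Φ n)
include H

/-- A potential flat torsionless submanifold, rewritten in flat coordinates. -/
theorem exists_isFlatRealization (h : IsFlatChart q U r W φ η) :
    η.IsSymm ∧ η.det ≠ 0 ∧ ∃ μ : Matrix (Fin N) (Fin N) ℝ, μ.IsSymm ∧ μ.det ≠ 0 ∧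
      IsFlatRealization q W η μ (fun y => Φ (φ y)) (fun y => r (φ y)) (pullFrame φ n) := by
  have hU := H.submanifold.isOpen
  have hW := h.isOpen
  have hφ := h.smooth
  have hm := h.mapsTo
  have hr := H.submanifold.smooth
  have hdet := H.submanifold.nonisotropic
  obtain ⟨p, hp⟩ := h.isConnected.nonempty
  have hJ : ∀ y ∈ W, (Matrix.of fun a i => partialD a φ y i).det ≠ 0 := fun y hy =>
    ((Matrix.isUnit_iff_isUnit_det _).1
      (Matrix.linearIndependent_rows_iff_isUnit.1 (h.regular y hy))).ne_zero
  have hflat : ∀ y ∈ W, FlattensAt (christoffel (firstForm q r)) φ y := fun y hy =>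
    h.flattensAt hU hr hdet hy
  have hdet' : ∀ y ∈ W, (firstForm q (fun z => r (φ z)) y).det ≠ 0 := fun y hy => by
    rw [firstForm_comp hU hW hφ hm hr hy, Matrix.det_mul, Matrix.det_mul, Matrix.det_transpose]
    exact mul_ne_zero (mul_ne_zero (hJ y hy) (hdet _ (hm hy))) (hJ y hy)
  have hgdet : ∀ y ∈ W, (gram q (pullFrame φ n) y).det ≠ 0 := fun y hy => by
    rw [gram_pullFrame, Matrix.det_mul, Matrix.det_mul, Matrix.det_transpose]
    exact mul_ne_zero (mul_ne_zero (hJ y hy) (normal_gram_det_ne_zero q (hdet _ (hm hy))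
      (H.normalFrame.normal _ (hm hy)) (H.normalFrame.linearIndependent _ (hm hy)))) (hJ y hy)
  have hns : ∀ a, ContDiffOn ℝ ∞ (pullFrame φ n a) W := fun a =>
    ContDiffOn.sum fun i _ =>
      (contDiffOn_partialD_apply hW hφ a i).smul ((H.normalFrame.smooth i).comp hφ hm)
  have htor : ∀ y ∈ W, ∀ a b c, torsion q (pullFrame φ n) a b c y = 0 := fun y hy =>
    torsion_pullFrame hU hW hφ hm H.normalFrame.smooth H.parallel hy (hflat y hy)
  -- zero torsion makes the Gram matrix constant
  have hgram : ∀ y ∈ W, gram q (pullFrame φ n) y = gram q (pullFrame φ n) p := fun y hy => by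
    ext a b
    refine eq_of_partialD_eq_zero (contDiffOn_psInner q (hns a) (hns b)) hW
      h.isConnected.isPreconnected (fun z hz c => ?_) hy hp
    rw [partialD_psInner q ((hns a).diffAt hW hz) ((hns b).diffAt hW hz), psInner_comm q _
      (partialD c _ z)]
    change torsion q (pullFrame φ n) a b c z + torsion q (pullFrame φ n) b a c z = 0
    rw [htor z hz, htor z hz, add_zero]
  refine ⟨isSymm_of_firstForm_eq (h.first_eq p hp), ?_, gram q (pullFrame φ n) p,
    isSymm_of_gram_eq rfl, hgdet p hp, isFlatRealization_of ⟨hW, h.isConnected, hr.comp hφ hm,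
      fun y hy => linearIndependent_of_gram_det_ne_zero q (hdet' y hy), hdet'⟩ h.first_eq
      (H.smooth_potential.comp hφ hm) ⟨hns, fun y hy a b => ?_, fun y hy =>
        linearIndependent_of_gram_det_ne_zero q (hgdet y hy)⟩ hgram htor fun y hy a b c => ?_⟩
  · rw [← h.first_eq p hp]
    exact hdet' p hp
  · rw [pullFrame, partialD_comp_of_mapsTo hU hW hφ hm hr hy, psInner_sum_left]
    simp [psInner_sum_right, psInner_smul_left, psInner_smul_right,
      H.normalFrame.normal _ (hm hy)]
  · have hs : ∀ i j k, psInner q (n i (φ y)) (partialD j (partialD k r) (φ y))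
        = covThird (firstForm q r) Φ i j k (φ y) := H.second_eq _ (hm hy)
    rw [third_comp_eq_covThird hU hW hφ hm (contDiffOn_firstForm hr hU) hdet hflat
      H.smooth_potential hy, secondForm, pullFrame, partialD_partialD_comp hU hW hφ hm hr hy,
      psInner_sum_left]
    refine Finset.sum_congr rfl fun i _ => ?_
    rw [psInner_smul_left, psInner_add_right, psInner_sum_right, psInner_sum_right]
    simp only [psInner_smul_right, psInner_sum_right, H.normalFrame.normal _ (hm hy), mul_zero,
      Finset.sum_const_zero, zero_add, hs, Finset.mul_sum]
    exact Finset.sum_congr rfl fun j _ => Finset.sum_congr rfl fun k _ => by ring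

/-- The scalar products `C_{iβ} = (n_i, ν_β)` with a torsion-free normal frame form, for each `β`,
a covariantly constant covector field. -/
theorem partialD_psInner_torsionless {ν : Fin N → (Fin N → ℝ) → Fin (N + N) → ℝ}
    (hν : IsNormalFrame q U r ν) (hνt : ∀ u ∈ U, ∀ α β i, torsion q ν α β i u = 0)
    {u : Fin N → ℝ} (hu : u ∈ U) (k i β : Fin N) :
    partialD k (fun v => psInner q (n i v) (ν β v)) u
      = ∑ l, christoffel (firstForm q r) l k i u * psInner q (n l u) (ν β u) := by
  have hU := H.submanifold.isOpen
  have hdet := H.submanifold.nonisotropic u hu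
  rw [partialD_psInner q ((H.normalFrame.smooth i).diffAt hU hu) ((hν.smooth β).diffAt hU hu)]
  obtain ⟨b, hb⟩ := exists_normal_coeffs q hdet (hν.normal u hu) (hν.linearIndependent u hu)
    (H.normalFrame.normal u hu i)
  obtain ⟨b', hb'⟩ := exists_normal_coeffs q hdet (H.normalFrame.normal u hu)
    (H.normalFrame.linearIndependent u hu) (hν.normal u hu β)
  have h0 : psInner q (n i u) (partialD k (ν β) u) = 0 := by
    rw [hb, psInner_sum_left]
    refine Finset.sum_eq_zero fun γ _ => ?_
    rw [psInner_smul_left, psInner_comm]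
    change b γ * torsion q ν β γ k u = 0
    rw [hνt u hu, mul_zero]
  have h1 : ∀ j, psInner q (partialD k (n i) u) (n j u)
      = ∑ l, christoffel (firstForm q r) l k i u * psInner q (n l u) (n j u) :=
    fun j => H.parallel u hu i j k
  rw [h0, add_zero, hb']
  simp only [psInner_sum_right, psInner_smul_right, h1, Finset.mul_sum]
  rw [Finset.sum_comm]
  exact Finset.sum_congr rfl fun l _ => Finset.sum_congr rfl fun j _ => by ring

/-- The covector fields `C_{iβ} du^i` are linearly independent, both frames being bases of the
nondegenerate normal space. -/
theorem det_psInner_ne_zero {ν : Fin N → (Fin N → ℝ) → Fin (N + N) → ℝ}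
    (hν : IsNormalFrame q U r ν) {u : Fin N → ℝ} (hu : u ∈ U) :
    (Matrix.of fun i β => psInner q (n i u) (ν β u)).det ≠ 0 := by
  have hdet := H.submanifold.nonisotropic u hu
  intro h
  obtain ⟨c, hc0, hc⟩ := Matrix.exists_vecMul_eq_zero_iff.2 h
  refine hc0 (funext (Fintype.linearIndependent_iff.1 (H.normalFrame.linearIndependent u hu) c ?_))
  refine eq_of_psInner_frame q hdet (hν.normal u hu) (hν.linearIndependent u hu) (fun j => ?_)
    fun β => ?_
  · simp [psInner_sum_left, psInner_smul_left, psInner_zero_left, H.normalFrame.normal u hu]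
  · have := congrFun hc β
    simpa [psInner_sum_left, psInner_smul_left, psInner_zero_left, Matrix.vecMul,
      dotProduct] using this

/-- Flat coordinates exist near every point: the covariantly constant covector fields
`C_{iβ} du^i` are closed, hence locally differentials `dy^β`, and the metric has constant
coefficients in the coordinates `y`. -/
theorem exists_isFlatChart {p : Fin N → ℝ} (hp : p ∈ U) :
    ∃ W φ η, IsFlatChart q U r W φ η ∧ p ∈ φ '' W := by
  have hU := H.submanifold.isOpen
  have hr := H.submanifold.smooth
  have hdet := H.submanifold.nonisotropic
  obtain ⟨ν, -, hν, -, hνt⟩ := H.torsionless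
  set C : Fin N → Fin N → (Fin N → ℝ) → ℝ := fun i β u => psInner q (n i u) (ν β u)
  have hCs : ∀ i β, ContDiffOn ℝ ∞ (C i β) U := fun i β =>
    contDiffOn_psInner q (H.normalFrame.smooth i) (hν.smooth β)
  have hCd : ∀ u ∈ U, ∀ k i β, partialD k (C i β) u
      = ∑ l, christoffel (firstForm q r) l k i u * C l β u := fun u hu k i β =>
    H.partialD_psInner_torsionless hν hνt hu k i β
  have hC0 : ∀ u ∈ U, (Matrix.of fun i β => C i β u).det ≠ 0 := fun u hu =>
    H.det_psInner_ne_zero hν hu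
  obtain ⟨ρ, hρ, hB⟩ := Metric.isOpen_iff.1 hU p hp
  set B := Metric.ball p ρ
  have hBo : IsOpen B := Metric.isOpen_ball
  -- the closed forms `C_{iβ} du^i` and their primitives
  set θ : Fin N → (Fin N → ℝ) → (Fin N → ℝ) →L[ℝ] ℝ := fun β u =>
    ∑ i, C i β u • ContinuousLinearMap.proj (R := ℝ) (φ := fun _ : Fin N => ℝ) i with hθ
  have hθs : ∀ β, ContDiffOn ℝ ∞ (θ β) U := fun β =>
    ContDiffOn.sum fun i _ => (hCs i β).smul contDiffOn_const
  have hθa : ∀ β u h, θ β u h = ∑ i, C i β u * h i := fun β u h => by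
    simp [hθ, sum_apply]
  have hprim : ∀ β, ∃ Y : (Fin N → ℝ) → ℝ, ∀ u ∈ B, HasFDerivAt Y (θ β u) u := by
    intro β
    refine (convex_ball p ρ).exists_forall_hasFDerivAt_of_fderiv_symmetric hBo
      (fun u hu => ((hθs β).diffAt hU (hB hu)).differentiableWithinAt) fun u hu h k => ?_
    have hder : ∀ h k, fderiv ℝ (θ β) u h k
        = ∑ c, ∑ i, h c * k i * partialD c (C i β) u := by
      intro h k
      rw [fderiv_eq_sum_partialD, sum_apply]
      refine Finset.sum_congr rfl fun c _ => ?_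
      rw [smul_apply, ← partialD_clm_apply ((hθs β).diffAt hU (hB hu))]
      simp only [hθa]
      rw [partialD_sum fun i _ => ((hCs i β).diffAt hU (hB hu)).mul_const _, smul_eq_mul,
        Finset.mul_sum]
      refine Finset.sum_congr rfl fun i _ => ?_
      have := partialD_smul_const ((hCs i β).diffAt hU (hB hu)) (k i) c
      simp only [smul_eq_mul] at this
      rw [this]
      ring
    rw [hder, hder, Finset.sum_comm]
    refine Finset.sum_congr rfl fun i _ => Finset.sum_congr rfl fun c _ => ?_
    rw [hCd u (hB hu), hCd u (hB hu)]
    simp only [christoffel_symm hU (hB hu) _ c i]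
    ring
  choose Y hY using hprim
  have hYd : ∀ u ∈ B, HasFDerivAt (fun v β => Y β v) (ContinuousLinearMap.pi fun β => θ β u) u :=
    fun u hu => hasFDerivAt_pi.2 fun β => hY β u hu
  have hYs : ContDiffOn ℝ ∞ (fun v β => Y β v) B := by
    refine contDiffOn_pi.2 fun β => ?_
    rw [contDiffOn_infty_iff_fderiv_of_isOpen hBo]
    exact ⟨fun u hu => (hY β u hu).differentiableAt.differentiableWithinAt,
      ((hθs β).mono hB).congr fun u hu => (hY β u hu).fderiv⟩
  have hinv : ∀ u ∈ B, ∃ e : (Fin N → ℝ) ≃L[ℝ] (Fin N → ℝ),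
      (e : (Fin N → ℝ) →L[ℝ] (Fin N → ℝ)) = ContinuousLinearMap.pi fun β => θ β u := by
    intro u hu
    set L : (Fin N → ℝ) →L[ℝ] (Fin N → ℝ) := ContinuousLinearMap.pi fun β => θ β u
    have hinj : Function.Injective (L : (Fin N → ℝ) →ₗ[ℝ] (Fin N → ℝ)) := by
      rw [← LinearMap.ker_eq_bot, LinearMap.ker_eq_bot']
      intro h hh
      refine Matrix.eq_zero_of_vecMul_eq_zero (hC0 u (hB hu)) (funext fun β => ?_)
      have : θ β u h = 0 := congrFun hh β
      rw [hθa] at this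
      simpa [Matrix.vecMul, dotProduct, mul_comm] using this
    exact ⟨(LinearEquiv.ofInjectiveEndo _ hinj).toContinuousLinearEquiv, by ext; rfl⟩
  have hpB : p ∈ B := Metric.mem_ball_self hρ
  obtain ⟨e₀, he₀⟩ := hinv p hpB
  have hYp : ContDiffAt ℝ ∞ (fun v β => Y β v) p := hYs.contDiffAt (hBo.mem_nhds hpB)
  set e := hYp.toOpenPartialHomeomorph (fun v β => Y β v) (he₀ ▸ hYd p hpB) (by simp)
  have hecoe : ∀ v, e v = fun β => Y β v := fun v => rfl
  have hps : p ∈ e.source := hYp.mem_toOpenPartialHomeomorph_source (he₀ ▸ hYd p hpB) (by simp)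
  have hpt : e p ∈ e.target := e.map_source hps
  have hnhds : e.target ∩ e.symm ⁻¹' B ∈ 𝓝 (e p) :=
    Filter.inter_mem (e.open_target.mem_nhds hpt)
      ((e.continuousAt_symm hpt).preimage_mem_nhds
        (by rw [e.left_inv hps]; exact hBo.mem_nhds hpB))
  obtain ⟨δ, hδ, hW⟩ := Metric.mem_nhds_iff.1 hnhds
  set W := Metric.ball (e p) δ
  have hWo : IsOpen W := Metric.isOpen_ball
  have hpW : e p ∈ W := Metric.mem_ball_self hδ
  have hm : Set.MapsTo e.symm W U := fun y hy => hB (hW hy).2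
  have hφ : ContDiffOn ℝ ∞ e.symm W := by
    intro y hy
    obtain ⟨e₁, he₁⟩ := hinv _ (hW hy).2
    exact (e.contDiffAt_symm (hW hy).1 (f₀' := e₁) (by rw [he₁]; exact hYd _ (hW hy).2)
      (hYs.contDiffAt (hBo.mem_nhds (hW hy).2))).contDiffWithinAt
  have hcon : IsConnected W := (convex_ball (e p) δ).isConnected ⟨_, hpW⟩
  -- the Jacobian matrix of `φ = y⁻¹` is inverse to `C`
  have hJC : ∀ y ∈ W, ∀ a β, ∑ i, partialD a e.symm y i * C i β (e.symm y)
      = if a = β then 1 else 0 := by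
    intro y hy a β
    have h1 : Set.EqOn (fun z => Y β (e.symm z)) (fun z => z β) W := fun z hz =>
      congrFun (e.right_inv (hW hz).1) β
    have h2 := partialD_congr hWo h1 hy a
    rw [partialD_coord, partialD_comp (hY β _ (hW hy).2).differentiableAt (hφ.diffAt hWo hy)] at h2
    rw [← h2]
    refine Finset.sum_congr rfl fun i _ => ?_
    rw [partialD_eq_of_hasFDerivAt (hY β _ (hW hy).2), hθa]
    simp [Pi.single_apply]
  -- differentiating `J C = 1` and using that `C` is covariantly constant
  have hflat : ∀ y ∈ W, FlattensAt (christoffel (firstForm q r)) e.symm y := by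
    intro y hy a b
    have hu : e.symm y ∈ U := hm hy
    have hder : ∀ β, ∑ l, (partialD a (partialD b e.symm) y l
        + ∑ i, ∑ j, christoffel (firstForm q r) l i j (e.symm y)
          * (partialD a e.symm y i * partialD b e.symm y j)) * C l β (e.symm y) = 0 := by
      intro β
      have h1 : ∀ i, DifferentiableAt ℝ (fun z => partialD b e.symm z i) y := fun i =>
        (contDiffOn_partialD_apply hWo hφ b i).diffAt hWo hy
      have h2 : ∀ i, DifferentiableAt ℝ (fun z => C i β (e.symm z)) y := fun i =>
        ((hCs i β).comp hφ hm).diffAt hWo hy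
      have h3 := partialD_congr hWo (fun z hz => hJC z hz b β) hy a
      rw [partialD_const, partialD_sum fun i _ => (h1 i).fun_mul (h2 i)] at h3
      rw [← h3]
      have h4 : ∀ i, partialD a (fun z => partialD b e.symm z i * C i β (e.symm z)) y
          = partialD b e.symm y i * (∑ k, partialD a e.symm y k *
            ∑ l, christoffel (firstForm q r) l k i (e.symm y) * C l β (e.symm y))
            + partialD a (partialD b e.symm) y i * C i β (e.symm y) := by
        intro i
        rw [partialD_mul (h1 i) (h2 i), partialD_partialD_apply hWo hφ hy,
          partialD_comp_of_mapsTo hU hWo hφ hm (hCs i β) hy]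
        simp only [hCd _ hu, smul_eq_mul]
      simp only [h4, add_mul, Finset.sum_add_distrib]
      rw [add_comm]
      congr 1
      simp only [Finset.mul_sum, Finset.sum_mul]
      calc _ = ∑ i, ∑ l, ∑ j, christoffel (firstForm q r) l i j (e.symm y)
            * (partialD a e.symm y i * partialD b e.symm y j) * C l β (e.symm y) :=
            Finset.sum_comm
        _ = ∑ i, ∑ j, ∑ l, christoffel (firstForm q r) l i j (e.symm y)
            * (partialD a e.symm y i * partialD b e.symm y j) * C l β (e.symm y) :=
            Finset.sum_congr rfl fun i _ => Finset.sum_comm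
        _ = ∑ j, ∑ i, ∑ l, christoffel (firstForm q r) l i j (e.symm y)
            * (partialD a e.symm y i * partialD b e.symm y j) * C l β (e.symm y) :=
            Finset.sum_comm
        _ = _ := Finset.sum_congr rfl fun j _ => Finset.sum_congr rfl fun i _ =>
            Finset.sum_congr rfl fun l _ => by ring
    have hz := Matrix.eq_zero_of_vecMul_eq_zero (hC0 _ hu) (v := fun l =>
      partialD a (partialD b e.symm) y l
        + ∑ i, ∑ j, christoffel (firstForm q r) l i j (e.symm y)
          * (partialD a e.symm y i * partialD b e.symm y j)) (funext hder)
    intro k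
    exact eq_neg_of_add_eq_zero_left (congrFun hz k)
  have hR : ContDiffOn ℝ ∞ (fun z => r (e.symm z)) W := hr.comp hφ hm
  -- the Christoffel symbols of the first kind vanish in the coordinates `y`, so the metric is
  -- constant
  have hsecond : ∀ y ∈ W, ∀ a b c, psInner q (partialD a (partialD b fun z => r (e.symm z)) y)
      (partialD c (fun z => r (e.symm z)) y) = 0 := by
    intro y hy a b c
    rw [partialD_comp_of_mapsTo hU hWo hφ hm hr hy, psInner_sum_right]
    refine Finset.sum_eq_zero fun l _ => ?_
    rw [psInner_smul_right, psInner_second_comp hU hWo hφ hm hr hdet hy]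
    simp [hflat y hy a b]
  refine ⟨W, e.symm, firstForm q (fun z => r (e.symm z)) (e p),
    ⟨hWo, hcon, hφ, hm, e.symm.injOn.mono fun y hy => (hW hy).1, fun y hy => ?_, fun y hy => ?_⟩,
    e p, hpW, e.left_inv hps⟩
  · have hmul : (Matrix.of fun a i => partialD a e.symm y i)
        * (Matrix.of fun i β => C i β (e.symm y)) = 1 := by
      ext a β
      rw [Matrix.mul_apply, Matrix.one_apply]
      exact hJC y hy a β
    exact Matrix.linearIndependent_rows_iff_isUnit.2
      (IsUnit.of_mul_eq_one _ hmul)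
  · ext a b
    refine eq_of_partialD_eq_zero (contDiffOn_firstForm hR hWo a b) hWo hcon.isPreconnected
      (fun z hz c => ?_) hy hpW
    rw [partialD_firstForm hR hWo hz, hsecond z hz, psInner_comm, hsecond z hz, add_zero]

end IsPotentialFlatTorsionless
end potential

end

theorem theorem5 (N : ℕ) :
    -- every potential flat torsionless submanifold gives, in flat coordinates, a solution
    (∀ (q : ℕ) (U : Set (Fin N → ℝ)) (r : (Fin N → ℝ) → Fin (N + N) → ℝ)
        (Φ : (Fin N → ℝ) → ℝ) (n : Fin N → (Fin N → ℝ) → Fin (N + N) → ℝ),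
      IsPotentialFlatTorsionless q U r Φ n →
        (∀ p ∈ U, ∃ W φ η, IsFlatChart q U r W φ η ∧ p ∈ φ '' W) ∧
        (∀ W φ η, IsFlatChart q U r W φ η →
          η.IsSymm ∧ η.det ≠ 0 ∧ Associativity η W (fun y => Φ (φ y)) ∧
          ∃ μ : Matrix (Fin N) (Fin N) ℝ, μ.IsSymm ∧ μ.det ≠ 0 ∧
            IsFlatRealization q W η μ (fun y => Φ (φ y)) (fun y => r (φ y))
              (pullFrame φ n))) ∧
    -- the solutions are exactly the functions realized by such submanifolds
    (∀ (η : Matrix (Fin N) (Fin N) ℝ) (c : ℝ) (U : Set (Fin N → ℝ)) (Φ : (Fin N → ℝ) → ℝ),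
      η.IsSymm → η.det ≠ 0 → c ≠ 0 → IsOpen U → IsSimplyConnected U →
      ContDiffOn ℝ ∞ Φ U →
        (Associativity η U Φ ↔
          ∃ (r : (Fin N → ℝ) → Fin (N + N) → ℝ)
            (n : Fin N → (Fin N → ℝ) → Fin (N + N) → ℝ),
            IsFlatRealization (negIndex η + negIndex (c⁻¹ • η)) U η (c⁻¹ • η) Φ r n)) ∧
    -- uniqueness up to motions
    (∀ (q : ℕ) (U : Set (Fin N → ℝ)) (η μ : Matrix (Fin N) (Fin N) ℝ) (Φ : (Fin N → ℝ) → ℝ)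
        (r r' : (Fin N → ℝ) → Fin (N + N) → ℝ)
        (n n' : Fin N → (Fin N → ℝ) → Fin (N + N) → ℝ),
      IsFlatRealization q U η μ Φ r n → IsFlatRealization q U η μ Φ r' n' →
        ∃ (A : (Fin (N + N) → ℝ) ≃ₗ[ℝ] (Fin (N + N) → ℝ)) (b : Fin (N + N) → ℝ),
          IsPsIsometry q A ∧
          ∀ u ∈ U, r' u = A (r u) + b ∧ ∀ i, n' i u = A (n i u)) ∧
    -- the potential is determined by the submanifold and its frame up to quadratic terms
    (∀ (q : ℕ) (U : Set (Fin N → ℝ)) (η μ : Matrix (Fin N) (Fin N) ℝ)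
        (Φ Φ' : (Fin N → ℝ) → ℝ) (r : (Fin N → ℝ) → Fin (N + N) → ℝ)
        (n : Fin N → (Fin N → ℝ) → Fin (N + N) → ℝ),
      IsFlatRealization q U η μ Φ r n →
        (IsFlatRealization q U η μ Φ' r n ↔
          ∃ (a : Matrix (Fin N) (Fin N) ℝ) (b : Fin N → ℝ) (d : ℝ), ∀ u ∈ U,
            Φ' u = Φ u + (∑ i, ∑ j, a i j * u i * u j) + (∑ i, b i * u i) + d)) := by
  refine ⟨fun q U r Φ n H => ⟨fun p hp => H.exists_isFlatChart hp, fun W φ η h => ?_⟩,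
    fun η c U Φ hη hη0 hc hU hsc hΦ =>
      ⟨fun hass => exists_flat_realization hη hη0 hc hU hsc hΦ hass,
        fun ⟨r, n, H⟩ => H.associativity⟩,
    fun q U η μ Φ r r' n n' H H' => H.exists_motion H',
    fun q U η μ Φ Φ' r n H => H.potential_iff Φ'⟩
  obtain ⟨h1, h2, μ, h3, h4, H'⟩ := H.exists_isFlatRealization h
  exact ⟨h1, h2, H'.associativity, μ, h3, h4, H'⟩
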